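/- Let $N\ge 3$ and let $\xi\in\mathbb C$ with $\xi^N=1$. For moduli $u=(u_0,\dots,u_{N-2})\in\mathbb C^{N-1}$ let $A(x)=x^N-\sum_{n=0}^{N-2}u_nx^n$, and consider the Seiberg–Witten curve $y^2=A(x)^2-1$ with the differential $\lambda=xA'(x)\,dx/y$. All complex powers and square roots below are principal. Near the Argyres–Douglas point $u_0=1$, $u_1=\dots=u_{N-2}=0$, write $$u_0=1-v,\qquad u_n=v^{1-\frac nN}v_n\quad(1\le n\le N-2),\qquad v\in\mathbb C\setminus(-\infty,0].$$ For $v_n=0$ $(n\ge1)$ the large branch point labelled by $\xi$ is $x=(2-v)^{1/N}\xi$; let $b$ denote the root of $A(b)=1$ obtained from it by continuity for small $(v_1,\dots,v_{N-2})$. Let $Q(\xi)$ be defined by $$\pi i\,Q(\xi)=\int_0^{b}\lambda ,$$ the integral being taken along the lift to the curve of the straight segment from $x=0$ to $x=b$, which meets no branch point before its end and starts at the point $(x,y)=(0,-i\sqrt v\,\sqrt{2-v})$ (the other point above $x=0$ gives $-Q(\xi)$). For $\ell=(\ell_1,\dots,\ell_{N-2})\in\mathbb N^{N-2}$ put $$L=1+\sum_{j}j\,\ell_j,\qquad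 M=\sum_j\ell_j,\qquad \alpha=\frac{NM-L}{2N},$$ and, with $F={}_2F_1$, put $$f_1(\alpha,v)=\frac{2(2v)^{\frac12-2\alpha}}{1-4\alpha}F\big(\tfrac12,\tfrac12;\tfrac32-2\alpha;\tfrac v2\big),\qquad f_2(\alpha,v)=F\big(2\alpha,2\alpha;2\alpha+\tfrac12;\tfrac v2\big),$$ $$Y(1,\alpha;1-v)=-\Gamma(\tfrac12)\Gamma(\tfrac12+2\alpha)f_1(\alpha,v)+\frac{2\pi^2\,\Gamma(\tfrac12)\Gamma(\tfrac12-2\alpha)}{\Gamma(1-\alpha)^2\,\Gamma(\tfrac12-\alpha)^2}f_2(\alpha,v).\tag{1}$$ If $4\alpha$ is an odd integer, the right side of (1) is understood as its limit in $\alpha$. Then: 1. For every $\ell$ and every $v\in\mathbb C\setminus(-\infty,0]$ with $|v|<2$, the right side of (1), as a function of a complex parameter tending to $\alpha$, has a limit equal to $Y(1,\alpha;1-v)$; in particular, the limit required when $4\alpha$ is odd exists. 2. For every $\ell$ and every $u_0=1-v$ with $|u_0|<1$, the function (1) agrees with the coefficient function of the expansion around the $\mathbb Z_{2N}$-symmetric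 point, $$Y(1,\alpha;u_0)=2u_0\cos^2(\pi\alpha)\,\Gamma(\alpha+\tfrac12)^2F\big(\alpha+\tfrac12,\alpha+\tfrac12;\tfrac32;u_0^2\big)+\sin^2(\pi\alpha)\,\Gamma(\alpha)^2F\big(\alpha,\alpha;\tfrac12;u_0^2\big).$$ 3. There is $r>0$ such that for every $\eta>0$ there is $\delta>0$ such that, for all $v$ with $0<|v|<r$ and $|\arg v|\le\pi-\eta$, the branch point $b$ extends to a continuous function of $(v_1,\dots,v_{N-2})$ on $\{|v_n|<\delta \text{ for all } n\}$, the function $Q(\xi)$ is defined there by the integral above, and $$Q(\xi)=\sum_{\ell_1,\dots,\ell_{N-2}=0}^\infty\frac{2^{M-\frac LN}}{2\pi^2N}\,\xi^L\,\Gamma\big(\tfrac LN\big)\,Y(1,\alpha;1-v)\,v^{\frac{NM-L+1}{N}}\,\frac{v_1^{\ell_1}\cdots v_{N-2}^{\ell_{N-2}}}{\ell_1!\cdots\ell_{N-2}!},$$ the series converging unconditionally. 4. For $v_1=\dots=v_{N-2}=0$ and all $v\in\mathbb C\setminus(-\infty,0]$ with $|v|<r$, $$Q(\xi)=\frac{2^{-\frac1N}}{2\pi^2N}\,\xi\,\Gamma\big(\tfrac1N\big)\,Y\big(1,-\tfrac1{2N};1-v\big).$$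 -/

import Mathlib

open Filter Topology MeasureTheory

noncomputable section

/-- The moduli `(u₀, (u₁, …, u_{N-2}))`; the entry `j` of the second component is `u_{j+1}`. -/
abbrev SWModuli (N : ℕ) : Type := ℂ × (Fin (N - 2) → ℂ)

/-- `A(x) = x^N - u₀ - ∑_{n=1}^{N-2} uₙ xⁿ`. The curve is `y² = A(x)² - 1`. -/
def swA (N : ℕ) (u : SWModuli N) (x : ℂ) : ℂ :=
  x ^ N - u.1 - ∑ j : Fin (N - 2), u.2 j * x ^ ((j : ℕ) + 1)

/-- `π i q = ∫_0^b x A'(x) dx / y`: the Abelian integral of the Seiberg-Witten differential along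
the lift to the curve `y² = A(x)² - 1` of the straight segment from `x = 0` to the point `x = b`.
The lift `t ↦ (t b, y t)` is continuous, it meets no branch point before its end, and it starts at
the point above `x = 0` with `y = -i √(1 - u₀) √(1 + u₀)` (principal roots; note `A 0 = -u₀`).
Starting at the other point above `0` would change the sign of `q`. -/
def IsAbelianQ (N : ℕ) (u : SWModuli N) (b q : ℂ) : Prop :=
  ∃ y : ℝ → ℂ,
    ContinuousOn y (Set.Icc 0 1) ∧
    y 0 = -Complex.I * (1 - u.1) ^ (1 / 2 : ℂ) * (1 + u.1) ^ (1 / 2 : ℂ) ∧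
    (∀ t ∈ Set.Icc (0 : ℝ) 1, y t ^ 2 = swA N u (t * b) ^ 2 - 1) ∧
    (∀ t ∈ Set.Ico (0 : ℝ) 1, y t ≠ 0) ∧
    IntervalIntegrable (fun t : ℝ => (t * b) * deriv (swA N u) (t * b) / y t * b) volume 0 1 ∧
    Real.pi * Complex.I * q =
      ∫ t in (0 : ℝ)..1, (t * b) * deriv (swA N u) (t * b) / y t * b

/-- The moduli `u₀ = 1 - v` and `uₙ = v^{1 - n/N} vₙ` for `n = 1, …, N-2`; the entry `j` of `w` is
`v_{j+1}`. -/
def adModuli (N : ℕ) (v : ℂ) (w : Fin (N - 2) → ℂ) : SWModuli N :=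
  (1 - v, fun j => v ^ (1 - ((j : ℕ) + 1 : ℂ) / N) * w j)

/-- `L = 1 + ∑ j ℓ_j`. -/
def wtL {N : ℕ} (l : Fin (N - 2) → ℕ) : ℕ := 1 + ∑ j : Fin (N - 2), ((j : ℕ) + 1) * l j

/-- `M = ∑ ℓ_j`. -/
def wtM {N : ℕ} (l : Fin (N - 2) → ℕ) : ℕ := ∑ j, l j

/-- `α = (N M - L) / (2 N)`. -/
def wtAlpha {N : ℕ} (l : Fin (N - 2) → ℕ) : ℂ := ((N : ℂ) * wtM l - wtL l) / (2 * N)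

/-- The coefficient function `Y(e, α; u₀)`, for `e = ξ^N`, of the expansion of `Q(ξ)` around the
`ℤ_{2N}` symmetric point. -/
def swY (e α u₀ : ℂ) : ℂ :=
  2 * u₀ * e * Complex.cos (Real.pi * α) ^ 2 * Complex.Gamma (α + 1 / 2) ^ 2 *
      ordinaryHypergeometric (α + 1 / 2) (α + 1 / 2) (3 / 2 : ℂ) (u₀ ^ 2) +
    Complex.sin (Real.pi * α) ^ 2 * Complex.Gamma α ^ 2 *
      ordinaryHypergeometric α α (1 / 2 : ℂ) (u₀ ^ 2)

def swF₁ (α v : ℂ) : ℂ :=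
  2 * (2 * v) ^ (1 / 2 - 2 * α) / (1 - 4 * α) *
    ordinaryHypergeometric (1 / 2 : ℂ) (1 / 2) (3 / 2 - 2 * α) (v / 2)

def swF₂ (α v : ℂ) : ℂ :=
  ordinaryHypergeometric (2 * α) (2 * α) (2 * α + 1 / 2) (v / 2)

/-- The combination of `f₁(α, v)` and `f₂(α, v)` that expresses `Y(1, α; 1 - v)`. -/
def longComb (α v : ℂ) : ℂ :=
  -(Complex.Gamma (1 / 2) * Complex.Gamma (1 / 2 + 2 * α)) * swF₁ α v +
    2 * Real.pi ^ 2 * Complex.Gamma (1 / 2) * Complex.Gamma (1 / 2 - 2 * α) /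
        (Complex.Gamma (1 - α) ^ 2 * Complex.Gamma (1 / 2 - α) ^ 2) * swF₂ α v

open Classical in
/-- `longComb`, completed by its limit in `α` at the exceptional values (`4 α` an odd integer) at
which its two terms are singular. -/
def longY (α v : ℂ) : ℂ :=
  if ∃ k : ℤ, 4 * α = 2 * k + 1 then limUnder (𝓝[≠] α) (fun a => longComb a v)
  else longComb α v

/-- The term of the expansion with multi-index `ℓ`. -/
def longTerm (N : ℕ) (ξ v : ℂ) (w : Fin (N - 2) → ℂ) (l : Fin (N - 2) → ℕ) : ℂ :=
  (2 : ℂ) ^ ((wtM l : ℂ) - (wtL l : ℂ) / N) / (2 * Real.pi ^ 2 * N) * ξ ^ wtL l *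
    Complex.Gamma ((wtL l : ℂ) / N) * longY (wtAlpha l) v *
    v ^ (((N : ℂ) * wtM l - wtL l + 1) / N) * ∏ j, w j ^ l j / ((l j).factorial : ℂ)

end

/-! Integration by parts replaces the differential by `arccos (A x) dx`: the end terms vanish
because of the factor `x` at `0` and because `arccos 1 = 0` at the branch point
(`isAbelianQ_of_arccosBranch`). In the coordinate `z = x ^ N` the polynomial becomes `z - 1 + v - τ
P(z)` with `τ = 1`, where `P` collects the terms with `v_n`, and `Q(ξ)` is a multiple of `∫
arccos(A) z^(s-1) dz`, `s = 1/N`, taken from `0` to the root near `2` of `A = 1`.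

Let `I_k(τ, v)` be this integral with the extra weight `P^k`, the `v` inside the coefficients of `P`
being frozen. Since `A` depends on the parameters only through `v - τ P` and the integrand vanishes
at the moving end point, `∂_τ I_k = -∂_v I_{k+1}`, hence `∂_τ^n I_0 = (-1)^n ∂_v^n I_n`, a form of
Lagrange inversion (`integral_deriv_add_integral_deriv`, `iteratedDeriv_abelianIntegral`).
Everything is holomorphic for `|τ| < 2`, so the Taylor series at `τ = 0` may be evaluated at `τ =
1`. At `τ = 0` the multinomial theorem leaves only the integrals `∫_0^{2-v} z^p dz / √((z + v)(2 - v
- z))`.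

Suitably normalized, these periods `y_p` satisfy `∂_v y_{p+1} = -2 y_p` and a second order equation
in `v`. Thus `(-1/2)^n ∂_v^n y_{n-2α}` continues `y_{-2α}` in `α`, and this is `Y(1, α; 1 - v)`. It
equals the combination (1) because the two hypergeometric components are periods at `v` and at `2 -
v`, as a comparison of all derivatives at `v = 1` shows; the singular contributions of `2 - v`
cancel, so the limits at exceptional `α` exist (`longComb_eq_normPeriod`, `tendsto_longComb`). The
Taylor series at `v = 1`, split by parity, is the expansion around the symmetric point
(`hasSum_longY`, `swY_eq_longY`).

Unconditional convergence comes from Cauchy estimates: each coefficient is itself a `τ`-derivative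
of such an integral for a perturbation with a single monomial (`norm_coeff_mul_le`). The estimates
are uniform as `v → 0` in a sector because `P` is small relative to `|v| + |z|`, which keeps `1 + A`
off the cut (`mem_slitPlane_of_angle`). -/

/-! ### Differentiation of integrals in holomorphic parameters -/

/-- A parametric integral over `(0, 1)` of functions that depend holomorphically on the parameter
and have a common integrable bound can be differentiated under the integral sign. -/
theorem hasDerivAt_integral_of_differentiableOn_of_norm_le {Θ : ℂ → ℝ → ℂ} {bd : ℝ → ℝ} {z₀ : ℂ}
    {R : ℝ} (hR : 0 < R) (hbd : IntervalIntegrable bd volume 0 1)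
    (hcont : ∀ z ∈ Metric.ball z₀ R, ContinuousOn (Θ z) (Set.Ioo 0 1))
    (hdiff : ∀ t ∈ Set.Ioo (0 : ℝ) 1, DifferentiableOn ℂ (fun z => Θ z t) (Metric.ball z₀ R))
    (hle : ∀ z ∈ Metric.ball z₀ R, ∀ t ∈ Set.Ioo (0 : ℝ) 1, ‖Θ z t‖ ≤ bd t) :
    IntervalIntegrable (fun t => deriv (fun z => Θ z t) z₀) volume 0 1 ∧
      HasDerivAt (fun z => ∫ t in (0 : ℝ)..1, Θ z t)
        (∫ t in (0 : ℝ)..1, deriv (fun z => Θ z t) z₀) z₀ := by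
  have hres : volume.restrict (Set.uIoc (0 : ℝ) 1) = volume.restrict (Set.Ioo (0 : ℝ) 1) := by
    rw [Set.uIoc_of_le zero_le_one]
    exact (Measure.restrict_congr_set Ioo_ae_eq_Ioc).symm
  have hae : ∀ {p : ℝ → Prop}, (∀ t ∈ Set.Ioo (0 : ℝ) 1, p t) →
      ∀ᵐ t ∂volume, t ∈ Set.uIoc (0 : ℝ) 1 → p t := by
    intro p hp
    rw [← ae_restrict_iff' measurableSet_uIoc, hres]
    exact (ae_restrict_mem measurableSet_Ioo).mono fun t ht => hp t ht
  have hmeas : ∀ z ∈ Metric.ball z₀ R,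
      AEStronglyMeasurable (Θ z) (volume.restrict (Set.uIoc (0 : ℝ) 1)) := by
    intro z hz
    rw [hres]
    exact (hcont z hz).aestronglyMeasurable measurableSet_Ioo
  have hz₀ : z₀ ∈ Metric.ball z₀ R := Metric.mem_ball_self hR
  have hD : ∀ t ∈ Set.Ioo (0 : ℝ) 1, ∀ z ∈ Metric.ball z₀ R,
      HasDerivAt (fun z => Θ z t) (deriv (fun z => Θ z t) z) z := fun t ht z hz =>
    ((hdiff t ht).differentiableAt (Metric.isOpen_ball.mem_nhds hz)).hasDerivAt
  refine intervalIntegral.hasDerivAt_integral_of_dominated_loc_of_deriv_le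
    (F' := fun z t => deriv (fun z => Θ z t) z) (bound := fun t => bd t / (R / 2))
    (s := Metric.ball z₀ (R / 2)) (Metric.ball_mem_nhds _ (by positivity)) ?_ ?_ ?_ ?_ ?_ ?_
  · filter_upwards [Metric.ball_mem_nhds z₀ hR] with z hz using hmeas z hz
  · refine hbd.mono_fun' (hmeas z₀ hz₀) ?_
    rw [hres]
    exact (ae_restrict_mem measurableSet_Ioo).mono fun t ht => hle z₀ hz₀ t ht
  -- Measurability of the derivative in `t`: it is a pointwise limit of difference quotients along a
  -- sequence.
  · obtain ⟨u, -, hu0, hu⟩ := exists_seq_strictAnti_tendsto' hR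
    have hu' : Tendsto (fun n => z₀ + (u n : ℂ)) atTop (𝓝[≠] z₀) := by
      refine tendsto_nhdsWithin_iff.2 ⟨?_, Eventually.of_forall fun n => ?_⟩
      · simpa using tendsto_const_nhds.add ((Complex.continuous_ofReal.tendsto 0).comp hu)
      · simpa using (hu0 n).1.ne'
    refine aestronglyMeasurable_of_tendsto_ae atTop
      (f := fun n t => slope (fun z => Θ z t) z₀ (z₀ + (u n : ℂ))) (fun n => ?_) ?_
    · have hmem : z₀ + (u n : ℂ) ∈ Metric.ball z₀ R := by
        simpa [abs_of_pos (hu0 n).1] using (hu0 n).2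
      simp only [slope_def_field]
      exact ((hmeas _ hmem).sub (hmeas _ hz₀)).mul_const _
    · rw [hres]
      exact (ae_restrict_mem measurableSet_Ioo).mono fun t ht =>
        (hasDerivAt_iff_tendsto_slope.1 (hD t ht z₀ hz₀)).comp hu'
  -- Cauchy's estimate on discs of radius `R / 2` turns the bound for the functions into one for
  -- their derivatives.
  · refine hae fun t ht z hz => ?_
    have hsub : Metric.closedBall z (R / 2) ⊆ Metric.ball z₀ R := fun y hy => by
      simp only [Metric.mem_closedBall, Metric.mem_ball] at *
      linarith [dist_triangle y z z₀]
    refine Complex.norm_deriv_le_of_forall_mem_sphere_norm_le (by positivity) ?_ ?_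
    · exact ((hdiff t ht).mono hsub).diffContOnCl_ball subset_rfl
    · exact fun y hy => hle y (hsub (Metric.sphere_subset_closedBall hy)) t ht
  · exact hbd.div_const _
  · refine hae fun t ht z hz => hD t ht z ?_
    exact Metric.ball_subset_ball (by linarith) hz

/-- Derivatives in two complex variables commute, for a bounded and separately holomorphic
function. -/
theorem hasDerivAt_iteratedDeriv_of_hasDerivAt {F G : ℂ → ℂ → ℂ} {τ₀ v₀ : ℂ} {R ρ C : ℝ}
    (hR : 0 < R) (hρ : 0 < ρ)
    (hF : ∀ τ ∈ Metric.ball τ₀ R, DifferentiableOn ℂ (F τ) (Metric.ball v₀ ρ))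
    (hG : DifferentiableOn ℂ (G τ₀) (Metric.ball v₀ ρ))
    (hFG : ∀ τ ∈ Metric.ball τ₀ R, ∀ v ∈ Metric.ball v₀ ρ,
      HasDerivAt (fun τ => F τ v) (G τ v) τ)
    (hC : ∀ τ ∈ Metric.ball τ₀ R, ∀ v ∈ Metric.ball v₀ ρ, ‖F τ v‖ ≤ C) (n : ℕ) :
    HasDerivAt (fun τ => iteratedDeriv n (F τ) v₀) (iteratedDeriv n (G τ₀) v₀) τ₀ := by
  have hr : 0 < ρ / 2 := by positivity
  have hsub : Metric.closedBall v₀ (ρ / 2) ⊆ Metric.ball v₀ ρ :=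
    Metric.closedBall_subset_ball (by linarith)
  have hτ₀ : τ₀ ∈ Metric.ball τ₀ R := Metric.mem_ball_self hR
  set K : ℂ := (2 * Real.pi * Complex.I / (n.factorial : ℂ)) with hK
  have hK0 : K ≠ 0 := by
    rw [hK]
    exact div_ne_zero Complex.two_pi_I_ne_zero (Nat.cast_ne_zero.2 n.factorial_ne_zero)
  -- With Cauchy's formula for the `n`-th derivative, it remains to differentiate a circle integral
  -- in `τ`.
  have key : ∀ f : ℂ → ℂ, DifferentiableOn ℂ f (Metric.ball v₀ ρ) →
      iteratedDeriv n f v₀ = K⁻¹ *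
        ∮ z in C(v₀, ρ / 2), (1 / (z - v₀) ^ (n + 1)) • f z := by
    intro f hf
    rw [(hf.mono hsub).circleIntegral_one_div_sub_center_pow_smul hr n, smul_eq_mul,
      ← mul_assoc, inv_mul_cancel₀ hK0, one_mul]
  rw [key _ hG]
  have hmem : ∀ θ, circleMap v₀ (ρ / 2) θ ∈ Metric.ball v₀ ρ := fun θ =>
    hsub (circleMap_mem_closedBall _ hr.le _)
  have hne : ∀ θ, circleMap v₀ (ρ / 2) θ - v₀ ≠ 0 := fun θ =>
    sub_ne_zero.2 (circleMap_ne_center hr.ne')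
  have hcts : ∀ f : ℂ → ℂ, DifferentiableOn ℂ f (Metric.ball v₀ ρ) → Continuous fun θ =>
      deriv (circleMap v₀ (ρ / 2)) θ • (1 / (circleMap v₀ (ρ / 2) θ - v₀) ^ (n + 1)) •
        f (circleMap v₀ (ρ / 2) θ) := by
    intro f hf
    have h1 : Continuous fun θ => f (circleMap v₀ (ρ / 2) θ) :=
      hf.continuousOn.comp_continuous (continuous_circleMap _ _) hmem
    have h2 : Continuous fun θ => deriv (circleMap v₀ (ρ / 2)) θ := by
      simp only [deriv_circleMap]
      exact (continuous_circleMap _ _).mul continuous_const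
    simp only [smul_eq_mul]
    refine h2.mul (Continuous.mul ?_ h1)
    exact continuous_const.div (((continuous_circleMap _ _).sub continuous_const).pow _)
      fun θ => pow_ne_zero _ (hne θ)
  have hder := intervalIntegral.hasDerivAt_integral_of_dominated_loc_of_deriv_le
    (μ := volume) (a := 0) (b := 2 * Real.pi) (s := Metric.ball τ₀ (R / 2)) (x₀ := τ₀)
    (F := fun τ θ => deriv (circleMap v₀ (ρ / 2)) θ •
      (1 / (circleMap v₀ (ρ / 2) θ - v₀) ^ (n + 1)) • F τ (circleMap v₀ (ρ / 2) θ))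
    (F' := fun τ θ => deriv (circleMap v₀ (ρ / 2)) θ •
      (1 / (circleMap v₀ (ρ / 2) θ - v₀) ^ (n + 1)) • G τ (circleMap v₀ (ρ / 2) θ))
    (bound := fun _ => (ρ / 2) * ((1 / (ρ / 2) ^ (n + 1)) * (C / (R / 2))))
    (Metric.ball_mem_nhds _ (by positivity)) ?_ ?_ ?_ ?_ ?_ ?_
  · have h2 := hder.2.const_mul K⁻¹
    refine (h2.congr_of_eventuallyEq ?_)
    filter_upwards [Metric.ball_mem_nhds τ₀ hR] with τ hτ
    rw [key _ (hF τ hτ)]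
    rfl
  · filter_upwards [Metric.ball_mem_nhds τ₀ hR] with τ hτ
    exact (hcts _ (hF τ hτ)).aestronglyMeasurable
  · exact (hcts _ (hF τ₀ hτ₀)).intervalIntegrable _ _
  · exact (hcts _ hG).aestronglyMeasurable
  · refine Eventually.of_forall fun θ _ τ hτ => ?_
    have hsub' : Metric.closedBall τ (R / 2) ⊆ Metric.ball τ₀ R := fun y hy => by
      simp only [Metric.mem_closedBall, Metric.mem_ball] at *
      linarith [dist_triangle y τ τ₀]
    have hτ' : τ ∈ Metric.ball τ₀ R := hsub' (Metric.mem_closedBall_self (by positivity))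
    -- No bound on `G` is assumed; it follows from the bound on `F` by Cauchy's estimate in `τ`.
    have hGb : ‖G τ (circleMap v₀ (ρ / 2) θ)‖ ≤ C / (R / 2) := by
      rw [← (hFG τ hτ' _ (hmem θ)).deriv]
      refine Complex.norm_deriv_le_of_forall_mem_sphere_norm_le (by positivity) ?_ ?_
      · refine DifferentiableOn.diffContOnCl_ball (U := Metric.ball τ₀ R) (fun y hy => ?_) hsub'
        exact (hFG y hy _ (hmem θ)).differentiableAt.differentiableWithinAt
      · exact fun y hy => hC y (hsub' (Metric.sphere_subset_closedBall hy)) _ (hmem θ)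
    rw [norm_smul, norm_smul]
    have e1 : ‖deriv (circleMap v₀ (ρ / 2)) θ‖ = ρ / 2 := by
      simp [abs_of_pos hr]
    have e2 : ‖1 / (circleMap v₀ (ρ / 2) θ - v₀) ^ (n + 1)‖ = 1 / (ρ / 2) ^ (n + 1) := by
      simp [circleMap_sub_center, abs_of_pos hr]
    rw [e1, e2]
    gcongr
  · exact intervalIntegrable_const
  · refine Eventually.of_forall fun θ _ τ hτ => ?_
    exact ((hFG τ (Metric.ball_subset_ball (by linarith) hτ) _ (hmem θ)).fun_const_smul _).fun_const_smul _

/-- A family of bounded separately holomorphic functions with `∂_τ f_k = -∂_v f_{k+1}`. -/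
theorem iteratedDeriv_eq_of_hasDerivAt_neg_deriv {f : ℕ → ℂ → ℂ → ℂ} {v₀ : ℂ} {R ρ C : ℝ}
    (hρ : 0 < ρ)
    (hf : ∀ k, ∀ τ ∈ Metric.ball 0 R, DifferentiableOn ℂ (f k τ) (Metric.ball v₀ ρ))
    (hd : ∀ k, ∀ τ ∈ Metric.ball 0 R, ∀ v ∈ Metric.ball v₀ ρ,
      HasDerivAt (fun τ => f k τ v) (-deriv (f (k + 1) τ) v) τ)
    (hC : ∀ k, ∀ τ ∈ Metric.ball 0 R, ∀ v ∈ Metric.ball v₀ ρ, ‖f k τ v‖ ≤ C) (n k : ℕ) :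
    ∀ τ ∈ Metric.ball 0 R, iteratedDeriv n (fun τ => f k τ v₀) τ =
      (-1) ^ n * iteratedDeriv n (f (k + n) τ) v₀ := by
  induction n with
  | zero => simp
  | succ n ih =>
    intro τ hτ
    obtain ⟨r, hr, hsub⟩ := Metric.isOpen_iff.1 Metric.isOpen_ball τ hτ
    have h1 := hasDerivAt_iteratedDeriv_of_hasDerivAt (F := f (k + n))
      (G := fun τ v => -deriv (f (k + n + 1) τ) v) (C := C) hr hρ
      (fun τ' h' => hf _ τ' (hsub h'))
      ((hf _ τ hτ).deriv Metric.isOpen_ball).neg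
      (fun τ' h' v hv => hd _ τ' (hsub h') v hv) (fun τ' h' v hv => hC _ τ' (hsub h') v hv) n
    have h2 := (h1.const_mul ((-1 : ℂ) ^ n)).congr_of_eventuallyEq
      (f₁ := iteratedDeriv n (fun τ => f k τ v₀))
      (Filter.eventually_of_mem (Metric.isOpen_ball.mem_nhds hτ) ih)
    rw [iteratedDeriv_succ, h2.deriv, iteratedDeriv_succ', ← add_assoc]
    have : iteratedDeriv n (fun v => -deriv (f (k + n + 1) τ) v) v₀ =
        -iteratedDeriv n (deriv (f (k + n + 1) τ)) v₀ := by
      exact iteratedDeriv_fun_neg n _ _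
    rw [this, pow_succ]
    ring

theorem intervalIntegrable_rpow_mul_one_sub_rpow {a b : ℝ} (ha : -1 < a) (hb : -1 < b) :
    IntervalIntegrable (fun t : ℝ => t ^ a * (1 - t) ^ b) volume 0 1 := by
  have h := (Complex.betaIntegral_convergent (u := (a + 1 : ℝ)) (v := (b + 1 : ℝ))
    (by simp; linarith) (by simp; linarith)).norm
  refine h.congr fun t ht => ?_
  rw [Set.uIoc_of_le zero_le_one] at ht
  have h1 : 0 ≤ 1 - t := by linarith [ht.2]
  rw [norm_mul]
  congr 1
  · rw [show ((a + 1 : ℝ) : ℂ) - 1 = (a : ℂ) by push_cast; ring, ← Complex.ofReal_cpow ht.1.le]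
    simp [abs_of_nonneg (Real.rpow_nonneg ht.1.le a)]
  · rw [show ((b + 1 : ℝ) : ℂ) - 1 = (b : ℂ) by push_cast; ring,
      show (1 : ℂ) - t = ((1 - t : ℝ) : ℂ) by push_cast; ring, ← Complex.ofReal_cpow h1]
    simp [abs_of_nonneg (Real.rpow_nonneg h1 b)]

/-! ### The period integrals and their contiguity relations -/

/-- The plane cut along `(-∞, 0]` and `[2, ∞)`. -/
def doubleSlitPlane : Set ℂ := {v | v ∈ Complex.slitPlane ∧ 2 - v ∈ Complex.slitPlane}

theorem isOpen_doubleSlitPlane : IsOpen doubleSlitPlane :=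
  Complex.isOpen_slitPlane.inter (Complex.isOpen_slitPlane.preimage (by fun_prop))

/-- The point is `(1 - σ) v + 2 σ`, and the slit plane is star-shaped about `2`. -/
theorem add_mul_mem_slitPlane {v : ℂ} (hv : v ∈ Complex.slitPlane) {σ : ℝ}
    (hσ : σ ∈ Set.Icc (0 : ℝ) 1) : v + (2 - v) * σ ∈ Complex.slitPlane := by
  rw [Complex.mem_slitPlane_iff] at hv ⊢
  simp only [Complex.add_re, Complex.mul_re, Complex.sub_re, Complex.add_im, Complex.mul_im,
    Complex.sub_im, Complex.ofReal_re, Complex.ofReal_im, Complex.re_ofNat, Complex.im_ofNat]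
  obtain ⟨h0, h1⟩ := hσ
  rcases eq_or_lt_of_le h1 with rfl | h1
  · left; norm_num
  rcases hv with h | h
  · left; nlinarith
  · right
    have : v.im * (1 - σ) ≠ 0 := mul_ne_zero h (by linarith)
    intro h'
    apply this
    linear_combination h'

theorem two_sub_mem_doubleSlitPlane {v : ℂ} (hv : v ∈ doubleSlitPlane) :
    2 - v ∈ doubleSlitPlane := ⟨hv.2, by simpa using hv.1⟩

theorem mem_doubleSlitPlane_of_norm_lt {v : ℂ} (hv : v ∈ Complex.slitPlane) (h : ‖v‖ < 2) :
    v ∈ doubleSlitPlane := by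
  refine ⟨hv, Complex.mem_slitPlane_iff.2 (Or.inl ?_)⟩
  have := (Complex.re_le_norm v).trans_lt h
  simp; linarith

theorem one_mem_doubleSlitPlane : (1 : ℂ) ∈ doubleSlitPlane :=
  mem_doubleSlitPlane_of_norm_lt Complex.one_mem_slitPlane (by simp)

/-- The integrand `z ^ p / √((z + v) (2 - v - z))` in the variable `z = (2 - v) σ`. -/
noncomputable def periodIntegrand (p v : ℂ) (σ : ℝ) : ℂ :=
  (2 - v) ^ (p + 1 / 2) * (σ : ℂ) ^ p * (1 - σ : ℂ) ^ (-(1 / 2) : ℂ) *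
    (v + (2 - v) * σ) ^ (-(1 / 2) : ℂ)

/-- `∫_0^{2-v} z ^ p dz / √((z + v) (2 - v - z))`. -/
noncomputable def periodIntegral (p v : ℂ) : ℂ := ∫ σ in (0 : ℝ)..1, periodIntegrand p v σ

theorem one_sub_mem_slitPlane {σ : ℝ} (hσ : σ < 1) : (1 - σ : ℂ) ∈ Complex.slitPlane := by
  rw [Complex.mem_slitPlane_iff]; left; simp; linarith

theorem norm_one_sub_cpow {σ : ℝ} (hσ : σ < 1) (p : ℂ) :
    ‖(1 - σ : ℂ) ^ p‖ = (1 - σ) ^ p.re := by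
  rw [show (1 - σ : ℂ) = ((1 - σ : ℝ) : ℂ) by push_cast; ring,
    Complex.norm_cpow_eq_rpow_re_of_pos (by linarith)]

/-- The domination for differentiating in `p` or in `v`: the factors without end point singularity
are bounded by compactness, and the rest by a beta integrand whose exponent `p₀.re - R` stays above
`-1`. -/
theorem exists_norm_periodIntegrand_le {p₀ v₀ : ℂ} (hp : -1 < p₀.re) (hv : v₀ ∈ doubleSlitPlane) :
    ∃ R > 0, Metric.ball v₀ R ⊆ doubleSlitPlane ∧ (∀ p ∈ Metric.ball p₀ R, -1 < p.re) ∧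
      ∃ bd : ℝ → ℝ, IntervalIntegrable bd volume 0 1 ∧
      ∀ p ∈ Metric.ball p₀ R, ∀ v ∈ Metric.ball v₀ R, ∀ σ ∈ Set.Ioo (0 : ℝ) 1,
        ‖periodIntegrand p v σ‖ ≤ bd σ := by
  obtain ⟨r, hr, hrE⟩ := Metric.isOpen_iff.1 isOpen_doubleSlitPlane v₀ hv
  set R := min (r / 2) ((p₀.re + 1) / 2) with hR
  have hR0 : 0 < R := lt_min (by linarith) (by linarith)
  have hRr : R ≤ r / 2 := min_le_left _ _
  have hRp : R ≤ (p₀.re + 1) / 2 := min_le_right _ _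
  have hsub : Metric.closedBall v₀ R ⊆ doubleSlitPlane :=
    (Metric.closedBall_subset_ball (by linarith)).trans hrE
  have hre : ∀ p ∈ Metric.ball p₀ R, p₀.re - R ≤ p.re := by
    intro p hp
    have h1 := (Complex.abs_re_le_norm (p - p₀)).trans_lt (mem_ball_iff_norm.1 hp)
    rw [Complex.sub_re, abs_lt] at h1
    linarith
  have hK : IsCompact (Metric.closedBall p₀ R ×ˢ Metric.closedBall v₀ R ×ˢ Set.Icc (0 : ℝ) 1) :=
    (isCompact_closedBall _ _).prod ((isCompact_closedBall _ _).prod isCompact_Icc)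
  obtain ⟨C, hC⟩ := hK.exists_bound_of_continuousOn
    (f := fun x : ℂ × ℂ × ℝ => (2 - x.2.1) ^ (x.1 + 1 / 2) *
      (x.2.1 + (2 - x.2.1) * (x.2.2 : ℂ)) ^ (-(1 / 2) : ℂ)) (by
    refine ContinuousOn.mul ?_ ?_
    · refine ContinuousOn.cpow (by fun_prop) (by fun_prop) fun x hx => (hsub hx.2.1).2
    · refine ContinuousOn.cpow (by fun_prop) (by fun_prop) fun x hx =>
        add_mul_mem_slitPlane (hsub hx.2.1).1 hx.2.2)
  refine ⟨R, hR0, Metric.ball_subset_closedBall.trans hsub, fun p hp => ?_,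
    fun σ => C * (σ ^ (p₀.re - R) * (1 - σ) ^ (-(1 / 2) : ℝ)), ?_, ?_⟩
  · linarith [hre p hp]
  · exact (intervalIntegrable_rpow_mul_one_sub_rpow (by linarith) (by norm_num)).const_mul _
  · intro p hp v hv σ hσ
    have h1 := hC (p, v, σ) ⟨Metric.ball_subset_closedBall hp, Metric.ball_subset_closedBall hv,
      Set.Ioo_subset_Icc_self hσ⟩
    have h2 : ‖(σ : ℂ) ^ p‖ ≤ σ ^ (p₀.re - R) := by
      rw [Complex.norm_cpow_eq_rpow_re_of_pos hσ.1]
      exact Real.rpow_le_rpow_of_exponent_ge hσ.1 hσ.2.le (hre p hp)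
    have h3 : ‖(1 - σ : ℂ) ^ (-(1 / 2) : ℂ)‖ = (1 - σ) ^ (-(1 / 2) : ℝ) := by
      rw [norm_one_sub_cpow hσ.2]; norm_num
    have h4 : periodIntegrand p v σ = ((2 - v) ^ (p + 1 / 2) *
      (v + (2 - v) * (σ : ℂ)) ^ (-(1 / 2) : ℂ)) * ((σ : ℂ) ^ p * (1 - σ : ℂ) ^ (-(1 / 2) : ℂ)) := by
      unfold periodIntegrand; ring
    rw [h4, norm_mul, norm_mul _ ((1 - σ : ℂ) ^ (-(1 / 2) : ℂ)), h3]
    have h5 : 0 ≤ (1 - σ) ^ (-(1 / 2) : ℝ) := Real.rpow_nonneg (by linarith [hσ.2]) _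
    exact mul_le_mul h1 (mul_le_mul_of_nonneg_right h2 h5) (mul_nonneg (norm_nonneg _) h5)
      ((norm_nonneg _).trans h1)

theorem ofReal_mem_slitPlane_of_pos {σ : ℝ} (hσ : 0 < σ) : (σ : ℂ) ∈ Complex.slitPlane :=
  Complex.ofReal_mem_slitPlane.2 hσ

theorem continuousOn_periodIntegrand {p v : ℂ} (hv : v ∈ doubleSlitPlane) :
    ContinuousOn (periodIntegrand p v) (Set.Ioo 0 1) := by
  unfold periodIntegrand
  refine ContinuousOn.mul (ContinuousOn.mul (ContinuousOn.mul continuousOn_const ?_) ?_) ?_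
  · exact ContinuousOn.cpow_const (by fun_prop) fun σ hσ => ofReal_mem_slitPlane_of_pos hσ.1
  · exact ContinuousOn.cpow_const (by fun_prop) fun σ hσ => one_sub_mem_slitPlane hσ.2
  · exact ContinuousOn.cpow_const (by fun_prop) fun σ hσ =>
      add_mul_mem_slitPlane hv.1 (Set.Ioo_subset_Icc_self hσ)

theorem intervalIntegrable_periodIntegrand {p v : ℂ} (hp : -1 < p.re) (hv : v ∈ doubleSlitPlane) :
    IntervalIntegrable (periodIntegrand p v) volume 0 1 := by
  obtain ⟨R, hR, -, -, bd, hbd, h⟩ := exists_norm_periodIntegrand_le hp hv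
  have hres : volume.restrict (Set.uIoc (0 : ℝ) 1) = volume.restrict (Set.Ioo (0 : ℝ) 1) := by
    rw [Set.uIoc_of_le zero_le_one]
    exact (Measure.restrict_congr_set Ioo_ae_eq_Ioc).symm
  refine hbd.mono_fun' ?_ ?_
  · rw [hres]
    exact (continuousOn_periodIntegrand hv).aestronglyMeasurable measurableSet_Ioo
  · rw [hres]
    exact (ae_restrict_mem measurableSet_Ioo).mono fun t ht =>
      h p (Metric.mem_ball_self hR) v (Metric.mem_ball_self hR) t ht

theorem continuousAt_periodIntegral_left {p v : ℂ} (hp : -1 < p.re) (hv : v ∈ doubleSlitPlane) :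
    ContinuousAt (fun p => periodIntegral p v) p := by
  obtain ⟨R, hR, -, -, bd, hbd, h⟩ := exists_norm_periodIntegrand_le hp hv
  refine (hasDerivAt_integral_of_differentiableOn_of_norm_le
    (Θ := fun p σ => periodIntegrand p v σ) hR hbd (fun p _ => continuousOn_periodIntegrand hv)
    (fun σ hσ => ?_)
    (fun p hp σ hσ => h p hp v (Metric.mem_ball_self hR) σ hσ)).2.continuousAt
  have h1 := Complex.slitPlane_ne_zero hv.2
  have h2 : (σ : ℂ) ≠ 0 := Complex.ofReal_ne_zero.2 hσ.1.ne'
  unfold periodIntegrand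
  refine Differentiable.differentiableOn ?_
  refine Differentiable.mul (Differentiable.mul (Differentiable.mul ?_ ?_) ?_) ?_
  · exact (differentiable_id.add_const _).const_cpow (Or.inl h1)
  · exact differentiable_id.const_cpow (Or.inl h2)
  · exact differentiable_const _
  · exact differentiable_const _

theorem hasDerivAt_ofReal_cpow {p : ℂ} {σ : ℝ} (hσ : 0 < σ) :
    HasDerivAt (fun σ : ℝ => (σ : ℂ) ^ p) (p * (σ : ℂ) ^ (p - 1)) σ := by
  have := ((hasDerivAt_id (σ : ℂ)).cpow_const (c := p)
    (ofReal_mem_slitPlane_of_pos hσ)).comp_ofReal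
  simpa using this

theorem hasDerivAt_one_sub_cpow {p : ℂ} {σ : ℝ} (hσ : σ < 1) :
    HasDerivAt (fun σ : ℝ => (1 - σ : ℂ) ^ p) (-(p * (1 - σ : ℂ) ^ (p - 1))) σ := by
  have := (((hasDerivAt_id (σ : ℂ)).const_sub 1).cpow_const (c := p)
    (one_sub_mem_slitPlane hσ)).comp_ofReal
  simpa using this

theorem hasDerivAt_add_mul_cpow {p v : ℂ} {σ : ℝ} (hv : v ∈ Complex.slitPlane)
    (hσ : σ ∈ Set.Icc (0 : ℝ) 1) :
    HasDerivAt (fun σ : ℝ => (v + (2 - v) * σ : ℂ) ^ p)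
      (p * (v + (2 - v) * σ : ℂ) ^ (p - 1) * (2 - v)) σ := by
  have := ((((hasDerivAt_id (σ : ℂ)).const_mul (2 - v)).const_add v).cpow_const (c := p)
    (add_mul_mem_slitPlane hv hσ)).comp_ofReal
  simpa using this

theorem continuous_one_sub_cpow {p : ℂ} (hp : 0 < p.re) :
    Continuous fun σ : ℝ => (1 - σ : ℂ) ^ p := by
  have := (Complex.continuous_ofReal_cpow_const hp).comp (continuous_const.sub continuous_id)
    (Y := ℝ) (f := fun σ : ℝ => 1 - σ)
  simpa [Function.comp_def] using this

theorem continuousOn_add_mul_cpow {p v : ℂ} (hv : v ∈ Complex.slitPlane) :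
    ContinuousOn (fun σ : ℝ => (v + (2 - v) * σ : ℂ) ^ p) (Set.Icc 0 1) := fun _ hσ =>
  (hasDerivAt_add_mul_cpow hv hσ).continuousAt.continuousWithinAt

/-- The `v`-derivative of the integrand for `p + 1`, plus `p + 1` times the integrand for `p`, is
the `σ`-derivative of a function vanishing at both ends. Scaling the path to `(0, 1)` beforehand
removes the moving end point, at which the integrand is singular. -/
theorem hasDerivAt_periodIntegral {p v : ℂ} (hp : -1 < p.re) (hv : v ∈ doubleSlitPlane) :
    HasDerivAt (periodIntegral (p + 1)) (-(p + 1) * periodIntegral p v) v := by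
  have hp' : -1 < (p + 1).re := by simp; linarith
  obtain ⟨R, hR, hRE, -, bd, hbd, h⟩ := exists_norm_periodIntegrand_le hp' hv
  have hder : ∀ w ∈ doubleSlitPlane, ∀ σ ∈ Set.Ioo (0 : ℝ) 1,
      HasDerivAt (fun v => periodIntegrand (p + 1) v σ)
        ((2 - w) ^ (p + 1 / 2) * (σ : ℂ) ^ p * (1 - σ : ℂ) ^ (-(1 / 2) : ℂ) *
          (w + (2 - w) * σ) ^ (-(1 / 2) : ℂ) * (-(p + 3 / 2) * σ -
            1 / 2 * (1 - σ) * (2 - w) * σ / (w + (2 - w) * σ))) w := by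
    intro w hw σ hσ
    have hY := add_mul_mem_slitPlane hw.1 (Set.Ioo_subset_Icc_self hσ)
    have hY0 := Complex.slitPlane_ne_zero hY
    have hX0 := Complex.slitPlane_ne_zero hw.2
    have hσ0 : (σ : ℂ) ≠ 0 := Complex.ofReal_ne_zero.2 hσ.1.ne'
    have d1 : HasDerivAt (fun v : ℂ => (2 - v) ^ (p + 1 + 1 / 2))
        ((p + 1 + 1 / 2) * (2 - w) ^ (p + 1 + 1 / 2 - 1) * (-1)) w :=
      ((hasDerivAt_id w).const_sub 2).cpow_const hw.2
    have d2 : HasDerivAt (fun v : ℂ => (v + (2 - v) * σ) ^ (-(1 / 2) : ℂ))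
        (-(1 / 2) * (w + (2 - w) * σ) ^ (-(1 / 2) - 1 : ℂ) * (1 + (-1) * σ)) w :=
      ((hasDerivAt_id w).add (((hasDerivAt_id w).const_sub 2).mul_const (σ : ℂ))).cpow_const hY
    have d3 := ((d1.mul_const ((σ : ℂ) ^ (p + 1))).mul_const
      ((1 - σ : ℂ) ^ (-(1 / 2) : ℂ))).mul d2
    refine d3.congr_deriv ?_
    rw [Complex.cpow_sub _ _ hY0, Complex.cpow_one, Complex.cpow_add _ _ hσ0, Complex.cpow_one,
      show p + 1 + 1 / 2 = (p + 1 / 2) + 1 by ring, Complex.cpow_add _ _ hX0, Complex.cpow_one,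
      add_sub_cancel_right]
    field_simp
    ring
  obtain ⟨hint, hK⟩ := hasDerivAt_integral_of_differentiableOn_of_norm_le
    (Θ := fun v σ => periodIntegrand (p + 1) v σ) hR hbd
    (fun v hv => continuousOn_periodIntegrand (hRE hv))
    (fun σ hσ w hw => (hder w (hRE hw) σ hσ).differentiableAt.differentiableWithinAt)
    (fun v hv σ hσ => h _ (Metric.mem_ball_self hR) v hv σ hσ)
  refine hK.congr_deriv ?_
  have hint2 := (intervalIntegrable_periodIntegrand hp hv).const_mul (p + 1)
  have hzero := intervalIntegral.integral_eq_sub_of_hasDerivAt_of_le (a := 0) (b := 1)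
    (f := fun σ : ℝ => (2 - v) ^ (p + 1 / 2) * (σ : ℂ) ^ (p + 1) * (1 - σ : ℂ) ^ (1 / 2 : ℂ) *
      (v + (2 - v) * σ) ^ (-(1 / 2) : ℂ)) zero_le_one ?_ ?_ (hint.add hint2)
  · rw [intervalIntegral.integral_add hint hint2] at hzero
    simp only [intervalIntegral.integral_const_mul] at hzero
    have h1 : p + 1 ≠ 0 := by
      intro h; rw [h] at hp'; simp at hp'; have := congrArg Complex.re h; simp at this; linarith
    unfold periodIntegral
    simp [h1] at hzero
    linear_combination hzero
  · refine ContinuousOn.mul (ContinuousOn.mul (ContinuousOn.mul continuousOn_const ?_) ?_) ?_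
    · exact (Complex.continuous_ofReal_cpow_const (by simp; linarith)).continuousOn
    · exact (continuous_one_sub_cpow (by norm_num)).continuousOn
    · exact continuousOn_add_mul_cpow hv.1
  · intro σ hσ
    have hY0 := Complex.slitPlane_ne_zero (add_mul_mem_slitPlane hv.1 (Set.Ioo_subset_Icc_self hσ))
    have h10 := Complex.slitPlane_ne_zero (one_sub_mem_slitPlane hσ.2)
    have hσ0 : (σ : ℂ) ≠ 0 := Complex.ofReal_ne_zero.2 hσ.1.ne'
    have d := (((hasDerivAt_ofReal_cpow (p := p + 1) hσ.1).const_mul ((2 - v) ^ (p + 1 / 2))).mul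
      (hasDerivAt_one_sub_cpow (p := 1 / 2) hσ.2)).mul
      (hasDerivAt_add_mul_cpow (p := -(1 / 2)) hv.1 (Set.Ioo_subset_Icc_self hσ))
    refine d.congr_deriv ?_
    rw [(hder v hv σ hσ).deriv]
    unfold periodIntegrand
    simp only [Pi.mul_apply]
    rw [show (1 / 2 - 1 : ℂ) = -(1 / 2) by norm_num,
      show (1 / 2 : ℂ) = -(1 / 2) + 1 by norm_num, Complex.cpow_add _ _ h10, Complex.cpow_one,
      show -(-(1 / 2) + 1 : ℂ) = -(1 / 2) by norm_num,
      Complex.cpow_sub _ _ hY0, Complex.cpow_one, Complex.cpow_add _ _ hσ0, Complex.cpow_one,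
      add_sub_cancel_right]
    field_simp
    ring

/-- Integrate the derivative of `z^p √((z + v)(2 - v - z))`, which vanishes at both ends, in the
scaled variable `z = (2 - v) σ`. -/
theorem periodIntegral_recurrence {p v : ℂ} (hp : 0 < p.re) (hv : v ∈ doubleSlitPlane) :
    p * (v * (2 - v)) * periodIntegral (p - 1) v + (2 * p + 1) * (1 - v) * periodIntegral p v -
      (p + 1) * periodIntegral (p + 1) v = 0 := by
  have i1 := (intervalIntegrable_periodIntegrand (p := p - 1) (by simpa using hp) hv).const_mul
    (p * (v * (2 - v)))
  have i2 := (intervalIntegrable_periodIntegrand (p := p) (by linarith) hv).const_mul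
    ((2 * p + 1) * (1 - v))
  have i3 := (intervalIntegrable_periodIntegrand (p := p + 1) (by simp; linarith) hv).const_mul
    (p + 1)
  have hX0 := Complex.slitPlane_ne_zero hv.2
  have hzero := intervalIntegral.integral_eq_sub_of_hasDerivAt_of_le (a := 0) (b := 1)
    (f := fun σ : ℝ => (2 - v) ^ (p + 1 / 2) * (σ : ℂ) ^ p * (1 - σ : ℂ) ^ (1 / 2 : ℂ) *
      (v + (2 - v) * σ) ^ (1 / 2 : ℂ)) zero_le_one ?_ ?_ ((i1.add i2).sub i3)
  · rw [intervalIntegral.integral_sub (i1.add i2) i3, intervalIntegral.integral_add i1 i2] at hzero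
    simp only [intervalIntegral.integral_const_mul] at hzero
    have h1 : p ≠ 0 := by
      rintro rfl; simp at hp
    unfold periodIntegral
    simp [h1] at hzero
    linear_combination hzero
  · refine ContinuousOn.mul (ContinuousOn.mul (ContinuousOn.mul continuousOn_const ?_) ?_) ?_
    · exact (Complex.continuous_ofReal_cpow_const hp).continuousOn
    · exact (continuous_one_sub_cpow (by norm_num)).continuousOn
    · exact continuousOn_add_mul_cpow hv.1
  · intro σ hσ
    have hY0 := Complex.slitPlane_ne_zero (add_mul_mem_slitPlane hv.1 (Set.Ioo_subset_Icc_self hσ))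
    have h10 := Complex.slitPlane_ne_zero (one_sub_mem_slitPlane hσ.2)
    have hσ0 : (σ : ℂ) ≠ 0 := Complex.ofReal_ne_zero.2 hσ.1.ne'
    have d := (((hasDerivAt_ofReal_cpow (p := p) hσ.1).const_mul ((2 - v) ^ (p + 1 / 2))).mul
      (hasDerivAt_one_sub_cpow (p := 1 / 2) hσ.2)).mul
      (hasDerivAt_add_mul_cpow (p := 1 / 2) hv.1 (Set.Ioo_subset_Icc_self hσ))
    refine d.congr_deriv ?_
    unfold periodIntegrand
    simp only [Pi.mul_apply]
    rw [show (1 / 2 - 1 : ℂ) = -(1 / 2) by norm_num]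
    have e1 : (1 - σ : ℂ) ^ (1 / 2 : ℂ) = (1 - σ : ℂ) ^ (-(1 / 2) : ℂ) * (1 - σ) := by
      rw [show (1 / 2 : ℂ) = -(1 / 2) + 1 by norm_num, Complex.cpow_add _ _ h10, Complex.cpow_one]
      norm_num
    have e2 : (v + (2 - v) * σ : ℂ) ^ (1 / 2 : ℂ) =
        (v + (2 - v) * σ : ℂ) ^ (-(1 / 2) : ℂ) * (v + (2 - v) * σ) := by
      rw [show (1 / 2 : ℂ) = -(1 / 2) + 1 by norm_num, Complex.cpow_add _ _ hY0, Complex.cpow_one]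
      norm_num
    have e3 : (2 - v) ^ (p + 1 / 2) = (2 - v) ^ (p - 1 + 1 / 2) * (2 - v) := by
      rw [show p + 1 / 2 = (p - 1 + 1 / 2) + 1 by ring, Complex.cpow_add _ _ hX0, Complex.cpow_one]
    have e4 : (2 - v) ^ (p + 1 + 1 / 2) = (2 - v) ^ (p - 1 + 1 / 2) * (2 - v) * (2 - v) := by
      rw [show p + 1 + 1 / 2 = (p + 1 / 2) + 1 by ring, Complex.cpow_add _ _ hX0, Complex.cpow_one,
        e3]
    have e5 : (σ : ℂ) ^ (p + 1) = (σ : ℂ) ^ (p - 1) * σ * σ := by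
      rw [show p + 1 = (p - 1) + 1 + 1 by ring, Complex.cpow_add _ _ hσ0,
        Complex.cpow_add _ _ hσ0, Complex.cpow_one]
    have e6 : (σ : ℂ) ^ p = (σ : ℂ) ^ (p - 1) * σ := by
      conv_lhs => rw [show p = (p - 1) + 1 by ring]
      rw [Complex.cpow_add _ _ hσ0, Complex.cpow_one]
    rw [e1, e2, e3, e4, e5, e6]
    ring

/-- Change of variables by an increasing bijection of `(0, 1)`. -/
theorem integral_comp_of_deriv_pos {f f' : ℝ → ℝ} (g : ℝ → ℂ) (hc : ContinuousOn f (Set.Icc 0 1))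
    (h0 : f 0 = 0) (h1 : f 1 = 1) (hf : ∀ σ ∈ Set.Ioo (0 : ℝ) 1, HasDerivAt f (f' σ) σ)
    (hpos : ∀ σ ∈ Set.Ioo (0 : ℝ) 1, 0 < f' σ) :
    ∫ x in (0 : ℝ)..1, g x = ∫ σ in (0 : ℝ)..1, (f' σ : ℂ) * g (f σ) := by
  have hmono : StrictMonoOn f (Set.Icc 0 1) := by
    refine strictMonoOn_of_deriv_pos (convex_Icc 0 1) hc fun σ hσ => ?_
    rw [interior_Icc] at hσ
    rw [(hf σ hσ).deriv]
    exact hpos σ hσ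
  have himage : f '' Set.Ioo 0 1 = Set.Ioo 0 1 := by
    refine Set.Subset.antisymm ?_ ?_
    · rintro _ ⟨σ, hσ, rfl⟩
      have hm := Set.Ioo_subset_Icc_self hσ
      constructor
      · rw [← h0]; exact hmono (Set.left_mem_Icc.2 zero_le_one) hm hσ.1
      · rw [← h1]; exact hmono hm (Set.right_mem_Icc.2 zero_le_one) hσ.2
    · have := intermediate_value_Ioo zero_le_one hc
      rwa [h0, h1] at this
  rw [intervalIntegral.integral_of_le zero_le_one, intervalIntegral.integral_of_le zero_le_one,
    integral_Ioc_eq_integral_Ioo, integral_Ioc_eq_integral_Ioo]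
  conv_lhs => rw [← himage]
  rw [integral_image_eq_integral_abs_deriv_smul measurableSet_Ioo
    (fun σ hσ => (hf σ hσ).hasDerivWithinAt) (hmono.injOn.mono Set.Ioo_subset_Icc_self)]
  refine setIntegral_congr_fun measurableSet_Ioo fun σ hσ => ?_
  simp only [abs_of_pos (hpos σ hσ), Complex.real_smul]

theorem integral_congr_Ioo {f g : ℝ → ℂ} (h : ∀ σ ∈ Set.Ioo (0 : ℝ) 1, f σ = g σ) :
    ∫ σ in (0 : ℝ)..1, f σ = ∫ σ in (0 : ℝ)..1, g σ := by
  rw [intervalIntegral.integral_of_le zero_le_one, intervalIntegral.integral_of_le zero_le_one,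
    integral_Ioc_eq_integral_Ioo, integral_Ioc_eq_integral_Ioo]
  exact setIntegral_congr_fun measurableSet_Ioo h

/-- At `v = 1` the radicand is `1 - z²`, so the substitution `x = z²` produces a beta integral. -/
theorem periodIntegral_one (p : ℂ) :
    periodIntegral p 1 = 1 / 2 * Complex.betaIntegral ((p + 1) / 2) (1 / 2) := by
  unfold Complex.betaIntegral periodIntegral
  rw [integral_comp_of_deriv_pos (f := fun σ => σ ^ 2) (f' := fun σ => 2 * σ)
    (fun x : ℝ => (x : ℂ) ^ ((p + 1) / 2 - 1) * (1 - x : ℂ) ^ (1 / 2 - 1 : ℂ)) (by fun_prop)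
    (by norm_num) (by norm_num) (fun σ _ => by simpa using hasDerivAt_pow 2 σ)
    (fun σ hσ => by have := hσ.1; positivity), ← intervalIntegral.integral_const_mul]
  refine integral_congr_Ioo fun σ hσ => ?_
  have hσ0 : (σ : ℂ) ≠ 0 := Complex.ofReal_ne_zero.2 hσ.1.ne'
  unfold periodIntegrand
  rw [show (2 - 1 : ℂ) = 1 by norm_num, Complex.one_cpow, one_mul, one_mul]
  have e1 : ((σ ^ 2 : ℝ) : ℂ) ^ ((p + 1) / 2 - 1) * σ = (σ : ℂ) ^ p := by
    push_cast
    rw [show ((σ : ℂ) ^ 2) = (σ : ℂ) ^ (2 : ℂ) by norm_cast, ← Complex.cpow_mul,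
      show (2 : ℂ) * ((p + 1) / 2 - 1) = p - 1 by ring, Complex.cpow_sub _ _ hσ0, Complex.cpow_one,
      div_mul_cancel₀ _ hσ0]
    · rw [← Complex.ofReal_log hσ.1.le]; simpa using Real.pi_pos
    · rw [← Complex.ofReal_log hσ.1.le]; simpa using Real.pi_pos.le
  have e2 : (1 - ((σ ^ 2 : ℝ) : ℂ)) ^ (1 / 2 - 1 : ℂ) =
      (1 - σ : ℂ) ^ (-(1 / 2) : ℂ) * (1 + σ : ℂ) ^ (-(1 / 2) : ℂ) := by
    have := Complex.mul_cpow_ofReal_nonneg (a := 1 - σ) (b := 1 + σ) (by linarith [hσ.2])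
      (by linarith [hσ.1]) (-(1 / 2) : ℂ)
    push_cast at this ⊢
    rw [← this, show (1 / 2 - 1 : ℂ) = -(1 / 2) by norm_num]
    congr 1
    ring
  rw [e2, ← e1]
  push_cast
  ring

/-! ### Normalized periods: derivative ladder, differential equation, values at `v = 1` -/

/-- `periodIntegral` with the normalization for which `∂_v y_{p+1} = -2 y_p`. -/
noncomputable def normPeriod (p v : ℂ) : ℂ :=
  2 * Real.pi * 2 ^ p * (Complex.Gamma (p + 1))⁻¹ * periodIntegral p v

/-- The duplication formula absorbs `Γ(p + 1)` into a square of a single reciprocal gamma factor;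
this square is what later splits by parity into the two terms of `swY`. -/
theorem normPeriod_one {p : ℂ} (hp : -1 < p.re) :
    normPeriod p 1 = Real.pi ^ 2 * ((Complex.Gamma (1 + p / 2))⁻¹) ^ 2 := by
  have h1 : 0 < ((p + 1) / 2).re := by simp; linarith
  have h2 : 0 < (1 + p / 2).re := by simp; linarith
  have g2 := Complex.Gamma_ne_zero_of_re_pos h2
  have g3 : Complex.Gamma (p + 1) ≠ 0 := Complex.Gamma_ne_zero_of_re_pos (by simp; linarith)
  have hB := Complex.Gamma_mul_Gamma_eq_betaIntegral h1 (t := 1 / 2) (by norm_num)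
  have hd := Complex.Gamma_mul_Gamma_add_half ((p + 1) / 2)
  rw [show (p + 1) / 2 + 1 / 2 = 1 + p / 2 by ring] at hB hd
  rw [show 2 * ((p + 1) / 2) = p + 1 by ring, show 1 - (p + 1) = -p by ring,
    Complex.cpow_neg] at hd
  have h2p : (2 : ℂ) ^ p ≠ 0 := by simp [Complex.cpow_eq_zero_iff]
  have hsq : ((√Real.pi : ℝ) : ℂ) ^ 2 = Real.pi := by
    norm_cast; rw [Real.sq_sqrt Real.pi_pos.le]
  have hg : Complex.Gamma (1 / 2) = ((√Real.pi : ℝ) : ℂ) := by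
    rw [Complex.Gamma_one_half_eq, Real.sqrt_eq_rpow, Complex.ofReal_cpow Real.pi_pos.le]
    norm_num
  rw [hg] at hB
  have hB' : Complex.betaIntegral ((p + 1) / 2) (1 / 2) =
      Complex.Gamma ((p + 1) / 2) * ((√Real.pi : ℝ) : ℂ) / Complex.Gamma (1 + p / 2) := by
    rw [hB, mul_div_cancel_left₀ _ g2]
  unfold normPeriod
  rw [periodIntegral_one, hB']
  generalize Complex.Gamma (1 + p / 2) = G₂ at *
  generalize Complex.Gamma ((p + 1) / 2) = G₁ at *
  field_simp at hd ⊢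
  linear_combination ((√Real.pi : ℝ) : ℂ) * hd + Complex.Gamma (p + 1) * hsq

theorem add_one_ne_zero_of_re {p : ℂ} (hp : -1 < p.re) : p + 1 ≠ 0 := by
  intro h
  have := congrArg Complex.re h
  simp at this
  linarith

theorem two_cpow_add_one (p : ℂ) : (2 : ℂ) ^ (p + 1) = 2 * 2 ^ p := by
  rw [Complex.cpow_add _ _ two_ne_zero, Complex.cpow_one, mul_comm]

theorem hasDerivAt_normPeriod {p v : ℂ} (hp : -1 < p.re) (hv : v ∈ doubleSlitPlane) :
    HasDerivAt (normPeriod (p + 1)) (-2 * normPeriod p v) v := by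
  have hp1 := add_one_ne_zero_of_re hp
  refine ((hasDerivAt_periodIntegral hp hv).const_mul
    (2 * Real.pi * 2 ^ (p + 1) * (Complex.Gamma (p + 1 + 1))⁻¹)).congr_deriv ?_
  unfold normPeriod
  rw [Complex.one_div_Gamma_eq_self_mul_one_div_Gamma_add_one (p + 1), two_cpow_add_one]
  ring

theorem hasDerivAt_normPeriod' {p v : ℂ} (hp : 0 < p.re) (hv : v ∈ doubleSlitPlane) :
    HasDerivAt (normPeriod p) (-2 * normPeriod (p - 1) v) v := by
  simpa using hasDerivAt_normPeriod (p := p - 1) (by simpa using hp) hv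

theorem normPeriod_recurrence {p v : ℂ} (hp : 0 < p.re) (hv : v ∈ doubleSlitPlane) :
    4 * (v * (2 - v)) * normPeriod (p - 1) v + 2 * (2 * p + 1) * (1 - v) * normPeriod p v -
      (p + 1) ^ 2 * normPeriod (p + 1) v = 0 := by
  have h := periodIntegral_recurrence hp hv
  have h2 : (2 : ℂ) ^ p = 2 * 2 ^ (p - 1) := by
    rw [← two_cpow_add_one, sub_add_cancel]
  have g1 := Complex.one_div_Gamma_eq_self_mul_one_div_Gamma_add_one (p + 1)
  have g2 := Complex.one_div_Gamma_eq_self_mul_one_div_Gamma_add_one p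
  unfold normPeriod
  rw [two_cpow_add_one, h2, show p - 1 + 1 = p by ring, g2, g1]
  linear_combination 8 * Real.pi * 2 ^ (p - 1) * (p + 1) * (Complex.Gamma (p + 1 + 1))⁻¹ * h

theorem DifferentiableOn.iteratedDeriv {f : ℂ → ℂ} {U : Set ℂ} (hf : DifferentiableOn ℂ f U)
    (hU : IsOpen U) (n : ℕ) : DifferentiableOn ℂ (iteratedDeriv n f) U := by
  induction n with
  | zero => simpa using hf
  | succ n ih => rw [iteratedDeriv_succ]; exact ih.deriv hU

theorem Set.EqOn.iteratedDeriv {f g : ℂ → ℂ} {U : Set ℂ} (h : Set.EqOn f g U)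
    (hU : IsOpen U) (n : ℕ) : Set.EqOn (iteratedDeriv n f) (iteratedDeriv n g) U := by
  induction n with
  | zero => simpa using h
  | succ n ih => rw [iteratedDeriv_succ, iteratedDeriv_succ]; exact ih.deriv hU

theorem differentiableOn_normPeriod {p : ℂ} (hp : 0 < p.re) :
    DifferentiableOn ℂ (normPeriod p) doubleSlitPlane := fun _ hv =>
  (hasDerivAt_normPeriod' hp hv).differentiableAt.differentiableWithinAt

theorem hasDerivAt_iteratedDeriv_normPeriod {p v : ℂ} (hp : 0 < p.re) (hv : v ∈ doubleSlitPlane)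
    (n : ℕ) : HasDerivAt (iteratedDeriv n (normPeriod p)) (iteratedDeriv (n + 1) (normPeriod p) v)
      v := by
  rw [iteratedDeriv_succ]
  exact (((differentiableOn_normPeriod hp).iteratedDeriv isOpen_doubleSlitPlane n).differentiableAt
    (isOpen_doubleSlitPlane.mem_nhds hv)).hasDerivAt

theorem iteratedDeriv_one_normPeriod {p v : ℂ} (hp : 0 < p.re) (hv : v ∈ doubleSlitPlane) :
    iteratedDeriv 1 (normPeriod p) v = -2 * normPeriod (p - 1) v := by
  rw [iteratedDeriv_one, (hasDerivAt_normPeriod' hp hv).deriv]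

theorem iteratedDeriv_succ_normPeriod {p v : ℂ} (hp : 0 < p.re) (hv : v ∈ doubleSlitPlane)
    (n : ℕ) : iteratedDeriv (n + 1) (normPeriod p) v =
      -2 * iteratedDeriv n (normPeriod (p - 1)) v := by
  rw [iteratedDeriv_succ']
  have h : Set.EqOn (deriv (normPeriod p)) (fun v => -2 * normPeriod (p - 1) v) doubleSlitPlane :=
    fun w hw => (hasDerivAt_normPeriod' hp hw).deriv
  rw [h.iteratedDeriv isOpen_doubleSlitPlane n hv, iteratedDeriv_const_mul_field]

/-- The differential equation of `normPeriod` and its derivatives. -/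
theorem iteratedDeriv_normPeriod_recurrence {p : ℂ} (hp : 1 < p.re) (n : ℕ) :
    ∀ v ∈ doubleSlitPlane, v * (2 - v) * iteratedDeriv (n + 2) (normPeriod p) v +
      (2 * n + 1 - 2 * p) * (1 - v) * iteratedDeriv (n + 1) (normPeriod p) v -
      (p - n) ^ 2 * iteratedDeriv n (normPeriod p) v = 0 := by
  have hp0 : 0 < p.re := by linarith
  induction n with
  | zero =>
    intro v hv
    have h1 : iteratedDeriv 2 (normPeriod p) v = 4 * normPeriod (p - 1 - 1) v := by
      rw [iteratedDeriv_succ_normPeriod hp0 hv 1,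
        iteratedDeriv_one_normPeriod (by simpa using hp) hv]
      ring
    have h := normPeriod_recurrence (p := p - 1) (by simpa using hp) hv
    rw [sub_add_cancel] at h
    simp only [zero_add, h1, iteratedDeriv_one_normPeriod hp0 hv, iteratedDeriv_zero]
    push_cast
    linear_combination h
  | succ n ih =>
    intro v hv
    have d := fun k => hasDerivAt_iteratedDeriv_normPeriod hp0 hv k
    have h1 := ((((hasDerivAt_id v).mul ((hasDerivAt_id v).const_sub 2)).mul (d (n + 2))).add
      ((((hasDerivAt_id v).const_sub 1).const_mul (2 * n + 1 - 2 * p)).mul (d (n + 1)))).sub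
      ((d n).const_mul ((p - n) ^ 2))
    have h2 : HasDerivAt (fun _ : ℂ => (0 : ℂ)) 0 v := hasDerivAt_const _ _
    have h3 := h1.unique (h2.congr_of_eventuallyEq (Filter.eventually_of_mem
      (isOpen_doubleSlitPlane.mem_nhds hv) fun w hw => ih w hw))
    simp only [id, Pi.mul_apply] at h3
    push_cast
    linear_combination h3

/-- At `v = 1` the middle term of the differential equation carries the factor `1 - v = 0`, so the
equation links orders `n` and `n + 2` directly; this is the functional equation of `1/Γ`, squared.
-/
theorem iteratedDeriv_normPeriod_one {p : ℂ} (hp : 1 < p.re) (n : ℕ) :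
    iteratedDeriv n (normPeriod p) 1 =
      (-2) ^ n * (Real.pi ^ 2 * ((Complex.Gamma (1 + p / 2 - n / 2))⁻¹) ^ 2) := by
  have hp0 : 0 < p.re := by linarith
  induction n using Nat.twoStepInduction with
  | zero => simp [normPeriod_one (p := p) (by linarith)]
  | one =>
    rw [iteratedDeriv_one_normPeriod hp0 one_mem_doubleSlitPlane,
      normPeriod_one (by simp; linarith)]
    push_cast
    rw [show 1 + (p - 1) / 2 = 1 + p / 2 - 1 / 2 by ring]
    ring
  | more n ih1 _ =>
    have h := iteratedDeriv_normPeriod_recurrence hp n 1 one_mem_doubleSlitPlane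
    have g := Complex.one_div_Gamma_eq_self_mul_one_div_Gamma_add_one (1 + p / 2 - (n + 2 : ℕ) / 2)
    rw [show 1 + p / 2 - ((n + 2 : ℕ) : ℂ) / 2 + 1 = 1 + p / 2 - n / 2 by push_cast; ring] at g
    rw [ih1] at h
    rw [g]
    push_cast
    linear_combination h

theorem continuousAt_normPeriod_left {p v : ℂ} (hp : -1 < p.re) (hv : v ∈ doubleSlitPlane) :
    ContinuousAt (fun p => normPeriod p v) p := by
  unfold normPeriod
  refine ContinuousAt.mul (ContinuousAt.mul (ContinuousAt.mul continuousAt_const ?_) ?_)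
    (continuousAt_periodIntegral_left hp hv)
  · exact continuousAt_const_cpow two_ne_zero
  · exact (Complex.differentiable_one_div_Gamma.continuous.comp
      (continuous_id.add continuous_const)).continuousAt

/-- The differential equation expresses each derivative of order at least two through the preceding
two orders, with `v (2 - v) ≠ 0` as divisor. Continuity in `p` thus reduces to that of the period
itself. This is what produces the limits at exceptional `α`. -/
theorem continuousAt_iteratedDeriv_normPeriod {v : ℂ} (hv : v ∈ doubleSlitPlane) (n : ℕ) :
    ∀ p : ℂ, 1 < p.re → ContinuousAt (fun p => iteratedDeriv n (normPeriod p) v) p := by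
  have hev : ∀ p : ℂ, 1 < p.re → ∀ᶠ q : ℂ in 𝓝 p, 1 < q.re := fun p hp =>
    Complex.continuous_re.continuousAt.eventually (lt_mem_nhds hp)
  have hv0 : v * (2 - v) ≠ 0 :=
    mul_ne_zero (Complex.slitPlane_ne_zero hv.1) (Complex.slitPlane_ne_zero hv.2)
  induction n using Nat.twoStepInduction with
  | zero =>
    intro p hp
    simpa using continuousAt_normPeriod_left (p := p) (by linarith) hv
  | one =>
    intro p hp
    have h1 : ContinuousAt (fun p => -2 * normPeriod (p - 1) v) p :=
      continuousAt_const.mul (ContinuousAt.comp (f := fun p : ℂ => p - 1)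
        (g := fun p => normPeriod p v) (continuousAt_normPeriod_left (by simp; linarith) hv)
        (by fun_prop))
    refine h1.congr ?_
    filter_upwards [hev p hp] with q hq
    rw [iteratedDeriv_one_normPeriod (by linarith) hv]
  | more n ih1 ih2 =>
    intro p hp
    have h1 : ContinuousAt (fun p : ℂ => ((p - n) ^ 2 * iteratedDeriv n (normPeriod p) v -
        (2 * n + 1 - 2 * p) * (1 - v) * iteratedDeriv (n + 1) (normPeriod p) v) /
        (v * (2 - v))) p := by
      refine ContinuousAt.div_const (ContinuousAt.sub (ContinuousAt.mul (by fun_prop) (ih1 p hp))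
        (ContinuousAt.mul (by fun_prop) (ih2 p hp))) _
    refine h1.congr ?_
    filter_upwards [hev p hp] with q hq
    rw [div_eq_iff hv0]
    linear_combination -iteratedDeriv_normPeriod_recurrence hq n v hv

/-! ### The Gauss hypergeometric function: derivative, differential equation, Euler integral -/

/-- The radius is exactly one unless some parameter is a nonpositive integer, when it is infinite;
for `c` this is due to the convention that the inverse of zero is zero. -/
theorem one_le_radius_ordinaryHypergeometricSeries (a b c : ℂ) :
    1 ≤ (ordinaryHypergeometricSeries ℂ a b c).radius := by
  by_cases h : ∀ kn : ℕ, ↑kn ≠ -a ∧ ↑kn ≠ -b ∧ ↑kn ≠ -c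
  · exact (ordinaryHypergeometricSeries_radius_eq_one ℂ a b c h).ge
  · push Not at h
    obtain ⟨k, hk⟩ := h
    by_cases h1 : (k : ℂ) = -a
    · rw [show a = -(k : ℂ) by rw [h1, neg_neg],
        ordinaryHypergeometric_radius_top_of_neg_nat₁]; simp
    by_cases h2 : (k : ℂ) = -b
    · rw [show b = -(k : ℂ) by rw [h2, neg_neg],
        ordinaryHypergeometric_radius_top_of_neg_nat₂]; simp
    · rw [show c = -(k : ℂ) by rw [hk h1 h2, neg_neg],
        ordinaryHypergeometric_radius_top_of_neg_nat₃]; simp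

theorem hasFPowerSeriesOnBall_ordinaryHypergeometric (a b c : ℂ) :
    HasFPowerSeriesOnBall (ordinaryHypergeometric a b c)
      (.ofScalars ℂ (ordinaryHypergeometricCoefficient a b c)) 0 1 := by
  have h := one_le_radius_ordinaryHypergeometricSeries a b c
  exact ((ordinaryHypergeometricSeries ℂ a b c).hasFPowerSeriesOnBall
    (lt_of_lt_of_le one_pos h)).mono one_pos h

theorem HasFPowerSeriesOnBall.hasSum_ofScalars {f : ℂ → ℂ} {h : ℕ → ℂ}
    (hf : HasFPowerSeriesOnBall f (.ofScalars ℂ h) 0 1) {x : ℂ} (hx : ‖x‖ < 1) :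
    HasSum (fun n => h n * x ^ n) (f x) := by
  have := hf.hasSum (y := x) (by simpa [Metric.mem_eball, edist_zero_right, enorm_eq_nnnorm]
    using (by exact_mod_cast hx : ‖x‖₊ < 1))
  simpa [FormalMultilinearSeries.ofScalars_apply_eq, mul_comm] using this

theorem HasFPowerSeriesOnBall.differentiableOn_ball {f : ℂ → ℂ} {h : ℕ → ℂ}
    (hf : HasFPowerSeriesOnBall f (.ofScalars ℂ h) 0 1) :
    DifferentiableOn ℂ f (Metric.ball 0 1) := by
  have := hf.differentiableOn
  rwa [← ENNReal.ofReal_one, Metric.eball_ofReal] at this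

theorem HasFPowerSeriesOnBall.iteratedDeriv_ofScalars {f : ℂ → ℂ} {h : ℕ → ℂ}
    (hf : HasFPowerSeriesOnBall f (.ofScalars ℂ h) 0 1) (n : ℕ) :
    iteratedDeriv n f 0 = n.factorial * h n := by
  have := hf.factorial_smul 1 n
  rw [iteratedDeriv_eq_iteratedFDeriv, ← this]
  simp

theorem HasFPowerSeriesOnBall.hasSum_deriv_ofScalars {f : ℂ → ℂ} {h : ℕ → ℂ}
    (hf : HasFPowerSeriesOnBall f (.ofScalars ℂ h) 0 1) {x : ℂ} (hx : ‖x‖ < 1) :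
    HasSum (fun n : ℕ => ((n : ℂ) + 1) * h (n + 1) * x ^ n) (deriv f x) := by
  have := Complex.hasSum_taylorSeries_on_ball (hf.differentiableOn_ball.deriv Metric.isOpen_ball)
    (z := x) (by simpa using hx)
  refine this.congr_fun fun n => ?_
  rw [← iteratedDeriv_succ', hf.iteratedDeriv_ofScalars, Nat.factorial_succ]
  have := Nat.cast_ne_zero (R := ℂ).2 n.factorial_ne_zero
  simp
  field_simp

theorem HasFPowerSeriesOnBall.hasSum_deriv_deriv_ofScalars {f : ℂ → ℂ} {h : ℕ → ℂ}
    (hf : HasFPowerSeriesOnBall f (.ofScalars ℂ h) 0 1) {x : ℂ} (hx : ‖x‖ < 1) :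
    HasSum (fun n : ℕ => ((n : ℂ) + 1) * (n + 2) * h (n + 2) * x ^ n) (deriv (deriv f) x) := by
  have := Complex.hasSum_taylorSeries_on_ball
    ((hf.differentiableOn_ball.deriv Metric.isOpen_ball).deriv Metric.isOpen_ball)
    (z := x) (by simpa using hx)
  refine this.congr_fun fun n => ?_
  rw [← iteratedDeriv_succ', ← iteratedDeriv_succ', hf.iteratedDeriv_ofScalars,
    Nat.factorial_succ, Nat.factorial_succ]
  have := Nat.cast_ne_zero (R := ℂ).2 n.factorial_ne_zero
  simp
  field_simp
  ring

theorem hasSum_mul_of_succ {g : ℕ → ℂ} {x s : ℂ} (h0 : g 0 = 0)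
    (h : HasSum (fun n => g (n + 1) * x ^ n) s) : HasSum (fun n => g n * x ^ n) (x * s) := by
  rw [← hasSum_nat_add_iff' 1]
  simp only [Finset.range_one, Finset.sum_singleton, h0, zero_mul, sub_zero]
  refine (h.mul_left x).congr_fun fun n => ?_
  ring

theorem ordinaryHypergeometricCoefficient_succ (a b : ℂ) {c : ℂ} {n : ℕ} (hc : c + n ≠ 0) :
    ((n : ℂ) + 1) * (c + n) * ordinaryHypergeometricCoefficient a b c (n + 1) =
      (a + n) * (b + n) * ordinaryHypergeometricCoefficient a b c n := by
  have h1 : ((n : ℂ) + 1) ≠ 0 := Nat.cast_add_one_ne_zero n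
  simp only [ordinaryHypergeometricCoefficient, ascPochhammer_succ_eval, Nat.factorial_succ,
    mul_inv, Nat.cast_mul, Nat.cast_succ]
  field_simp

theorem ascPochhammer_eval_add_one (a : ℂ) (n : ℕ) :
    a * (ascPochhammer ℂ n).eval (a + 1) = (a + n) * (ascPochhammer ℂ n).eval a := by
  have h1 := ascPochhammer_succ_eval (S := ℂ) n a
  have h2 : (ascPochhammer ℂ (n + 1)).eval a = a * (ascPochhammer ℂ n).eval (a + 1) := by
    rw [ascPochhammer_succ_left]; simp
  rw [← h2, h1, mul_comm]

theorem hasDerivAt_ordinaryHypergeometric (a b : ℂ) {c x : ℂ} (hc : ∀ n : ℕ, c + n ≠ 0)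
    (hx : ‖x‖ < 1) : HasDerivAt (ordinaryHypergeometric a b c)
      (a * b / c * ordinaryHypergeometric (a + 1) (b + 1) (c + 1) x) x := by
  have hf := hasFPowerSeriesOnBall_ordinaryHypergeometric a b c
  have h1 := (hf.differentiableOn_ball.differentiableAt
    (Metric.isOpen_ball.mem_nhds (by simpa using hx))).hasDerivAt
  refine h1.congr_deriv ((hf.hasSum_deriv_ofScalars hx).unique ?_)
  refine (((hasFPowerSeriesOnBall_ordinaryHypergeometric (a + 1) (b + 1)
    (c + 1)).hasSum_ofScalars hx).mul_left (a * b / c)).congr_fun fun n => ?_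
  have hc0 : c ≠ 0 := by simpa using hc 0
  have hp : (ascPochhammer ℂ n).eval c ≠ 0 := by
    rw [Ne, ascPochhammer_eval_eq_zero_iff]
    rintro ⟨k, -, hk⟩
    exact hc k (by rw [hk]; ring)
  have hp' : (ascPochhammer ℂ n).eval (c + 1) ≠ 0 := by
    rw [Ne, ascPochhammer_eval_eq_zero_iff]
    rintro ⟨k, -, hk⟩
    exact hc (k + 1) (by push_cast; linear_combination hk)
  have h2 : (n : ℂ) + 1 ≠ 0 := Nat.cast_add_one_ne_zero n
  have h3 := ordinaryHypergeometricCoefficient_succ a b (hc n)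
  have e1 := ascPochhammer_eval_add_one a n
  have e2 := ascPochhammer_eval_add_one b n
  have e3 := ascPochhammer_eval_add_one c n
  have h4 : ((n : ℂ) + 1) * ordinaryHypergeometricCoefficient a b c (n + 1) =
      a * b / c * ordinaryHypergeometricCoefficient (a + 1) (b + 1) (c + 1) n := by
    refine mul_left_cancel₀ (hc n) ?_
    rw [← mul_assoc, mul_comm (c + n), h3]
    simp only [ordinaryHypergeometricCoefficient]
    have hfac := Nat.cast_ne_zero (R := ℂ).2 n.factorial_ne_zero
    field_simp
    linear_combination ((a + n) * Polynomial.eval a (ascPochhammer ℂ n) * (b + n) *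
        Polynomial.eval b (ascPochhammer ℂ n)) * e3 +
      (-(c + n) * Polynomial.eval c (ascPochhammer ℂ n)) *
      (b * Polynomial.eval (b + 1) (ascPochhammer ℂ n) * e1 +
        (a + n) * Polynomial.eval a (ascPochhammer ℂ n) * e2)
  rw [h4]
  ring

/-- The hypergeometric differential equation. -/
theorem ordinaryHypergeometric_ode (a b : ℂ) {c x : ℂ} (hc : ∀ n : ℕ, c + n ≠ 0) (hx : ‖x‖ < 1) :
    x * (1 - x) * deriv (deriv (ordinaryHypergeometric a b c)) x +
      (c - (a + b + 1) * x) * deriv (ordinaryHypergeometric a b c) x -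
      a * b * ordinaryHypergeometric a b c x = 0 := by
  have hf := hasFPowerSeriesOnBall_ordinaryHypergeometric a b c
  set h := ordinaryHypergeometricCoefficient a b c
  have s0 := hf.hasSum_ofScalars hx
  have s1 := hf.hasSum_deriv_ofScalars hx
  have s2 := hf.hasSum_deriv_deriv_ofScalars hx
  have s1x := hasSum_mul_of_succ (g := fun n => n * h n) (by simp) (by simpa using s1)
  have s2x := hasSum_mul_of_succ (g := fun n => ((n : ℂ) * (n + 1) * h (n + 1))) (by simp)
    (s2.congr_fun fun n => by push_cast; ring)
  have s2xx := hasSum_mul_of_succ (g := fun n => ((n : ℂ) - 1) * n * h n) (by simp)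
    (s2x.congr_fun fun n => by push_cast; ring)
  have key := (((s2x.sub s2xx).add (s1.mul_left c)).sub (s1x.mul_left (a + b + 1))).sub
    (s0.mul_left (a * b))
  have hz : ∀ n : ℕ, ((n : ℂ) * (n + 1) * h (n + 1) * x ^ n - ((n : ℂ) - 1) * n * h n * x ^ n +
      c * (((n : ℂ) + 1) * h (n + 1) * x ^ n) - (a + b + 1) * (n * h n * x ^ n) -
      a * b * (h n * x ^ n)) = 0 := fun n => by
    linear_combination x ^ n * ordinaryHypergeometricCoefficient_succ a b (hc n)
  have := key.unique ((hasSum_zero).congr_fun hz)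
  linear_combination this

theorem hasSum_one_sub_cpow_neg (a : ℂ) {y : ℂ} (hy : ‖y‖ < 1) :
    HasSum (fun n : ℕ => (n.factorial : ℂ)⁻¹ * (ascPochhammer ℂ n).eval a * y ^ n)
      ((1 - y) ^ (-a)) := by
  have h := (Complex.one_add_cpow_hasFPowerSeriesOnBall_zero (a := -a)).hasSum (y := -y)
    (by simpa [Metric.mem_eball, edist_zero_right, enorm_eq_nnnorm]
      using (by exact_mod_cast hy : ‖y‖₊ < 1))
  have hb : ∀ k : ℕ, (k : ℂ) ≠ -1 := fun k hk => by
    have := congrArg Complex.re hk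
    simp at this
    have h0 : (0 : ℝ) ≤ k := k.cast_nonneg
    linarith
  rw [binomialSeries_eq_ordinaryHypergeometricSeries (b := 1) hb, neg_neg] at h
  rw [zero_add, ← sub_eq_add_neg] at h
  refine h.congr_fun fun n => ?_
  have hn : (ascPochhammer ℂ n).eval (1 : ℂ) ≠ 0 := by
    rw [ascPochhammer_eval_one]; exact Nat.cast_ne_zero.2 n.factorial_ne_zero
  have hco : (n.factorial : ℂ)⁻¹ * (ascPochhammer ℂ n).eval a =
      ordinaryHypergeometricCoefficient a 1 1 n := by
    rw [ordinaryHypergeometricCoefficient, mul_inv_cancel_right₀ hn]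
  rw [hco]
  simp [FormalMultilinearSeries.compContinuousLinearMap, ordinaryHypergeometricSeries, mul_comm]

theorem Gamma_add_nat_eq_ascPochhammer {s : ℂ} (hs : 0 < s.re) (n : ℕ) :
    Complex.Gamma (s + n) = (ascPochhammer ℂ n).eval s * Complex.Gamma s := by
  induction n with
  | zero => simp
  | succ n ih =>
    have h : s + n ≠ 0 := fun h => by
      have := congrArg Complex.re h
      simp at this
      have h0 : (0 : ℝ) ≤ n := n.cast_nonneg
      linarith
    rw [Nat.cast_succ, ← add_assoc, Complex.Gamma_add_one _ h, ih, ascPochhammer_succ_eval]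
    ring

/-- Euler's integral. -/
theorem integral_cpow_mul_eq_ordinaryHypergeometric (a : ℂ) {b c x : ℂ} (hb : 0 < b.re)
    (hcb : 0 < (c - b).re) (hx : ‖x‖ < 1) :
    ∫ t in (0 : ℝ)..1, (t : ℂ) ^ (b - 1) * (1 - t : ℂ) ^ (c - b - 1) * (1 - x * t) ^ (-a) =
      Complex.Gamma b * Complex.Gamma (c - b) / Complex.Gamma c *
        ordinaryHypergeometric a b c x := by
  have hc : 0 < c.re := by simp at hcb; linarith
  have hΓc := Complex.Gamma_ne_zero_of_re_pos hc
  have hres : volume.restrict (Set.uIoc (0 : ℝ) 1) = volume.restrict (Set.Ioo (0 : ℝ) 1) := by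
    rw [Set.uIoc_of_le zero_le_one]
    exact (Measure.restrict_congr_set Ioo_ae_eq_Ioc).symm
  have hae : ∀ {p : ℝ → Prop}, (∀ t ∈ Set.Ioo (0 : ℝ) 1, p t) →
      ∀ᵐ t ∂volume, t ∈ Set.uIoc (0 : ℝ) 1 → p t := by
    intro p hp
    rw [← ae_restrict_iff' measurableSet_uIoc, hres]
    exact (ae_restrict_mem measurableSet_Ioo).mono fun t ht => hp t ht
  set g : ℕ → ℂ := fun n => (n.factorial : ℂ)⁻¹ * (ascPochhammer ℂ n).eval a with hg
  -- The binomial series at the real point `‖x‖` converges absolutely and dominates the series at `x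
  -- t` for all `t`, which permits termwise integration.
  have hgs : Summable fun n => ‖g n‖ * ‖x‖ ^ n := by
    have := (hasSum_one_sub_cpow_neg a (y := (‖x‖ : ℂ)) (by simpa using hx)).summable.norm
    simpa [norm_mul, hg] using this
  set w : ℝ → ℂ := fun t => (t : ℂ) ^ (b - 1) * (1 - t : ℂ) ^ (c - b - 1) with hw
  have hwint : IntervalIntegrable w volume 0 1 := Complex.betaIntegral_convergent hb hcb
  have hsum := intervalIntegral.hasSum_integral_of_dominated_convergence (μ := volume) (a := 0)
    (b := 1) (F := fun n t => w t * (g n * (x * t) ^ n))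
    (f := fun t => w t * (1 - x * t) ^ (-a))
    (fun n t => ‖w t‖ * (‖g n‖ * ‖x‖ ^ n)) ?_ ?_ ?_ ?_ ?_
  · refine hsum.unique ?_
    have hF := ((hasFPowerSeriesOnBall_ordinaryHypergeometric a b c).hasSum_ofScalars hx).mul_left
      (Complex.Gamma b * Complex.Gamma (c - b) / Complex.Gamma c)
    refine hF.congr_fun fun n => ?_
    have hn0 : (0 : ℝ) ≤ n := n.cast_nonneg
    have hbeta := Complex.Gamma_mul_Gamma_eq_betaIntegral (s := b + n) (t := c - b)
      (by simp; linarith) hcb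
    rw [show b + n + (c - b) = c + n by ring, Gamma_add_nat_eq_ascPochhammer hb,
      Gamma_add_nat_eq_ascPochhammer hc] at hbeta
    have hp : (ascPochhammer ℂ n).eval c ≠ 0 := by
      rw [Ne, ascPochhammer_eval_eq_zero_iff]
      rintro ⟨k, -, hk⟩
      have := congrArg Complex.re hk
      simp at this
      have h0 : (0 : ℝ) ≤ k := k.cast_nonneg
      linarith
    have : ∫ t in (0 : ℝ)..1, w t * (g n * (x * t) ^ n) =
        g n * x ^ n * Complex.betaIntegral (b + n) (c - b) := by
      unfold Complex.betaIntegral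
      rw [← intervalIntegral.integral_const_mul]
      refine integral_congr_Ioo fun t ht => ?_
      have ht0 : (t : ℂ) ≠ 0 := Complex.ofReal_ne_zero.2 ht.1.ne'
      rw [hw, show b + n - 1 = (b - 1) + n by ring, Complex.cpow_add _ _ ht0, Complex.cpow_natCast]
      simp only []
      ring
    rw [this]
    simp only [ordinaryHypergeometricCoefficient, hg]
    have hfac := Nat.cast_ne_zero (R := ℂ).2 n.factorial_ne_zero
    field_simp
    linear_combination -(x ^ n * (ascPochhammer ℂ n).eval a) * hbeta
  · intro n
    have h1 : Continuous fun t : ℝ => g n * (x * (t : ℂ)) ^ n := by fun_prop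
    have := hwint.aestronglyMeasurable
    rw [← Set.uIoc_of_le (zero_le_one' ℝ)] at this
    exact this.mul h1.aestronglyMeasurable
  · intro n
    refine hae fun t ht => ?_
    rw [norm_mul (w t), norm_mul (g n), norm_pow]
    have h1 : ‖(t : ℂ)‖ ≤ 1 := by simp [abs_of_pos ht.1, ht.2.le]
    have h2 : ‖x‖ * ‖(t : ℂ)‖ ≤ ‖x‖ := mul_le_of_le_one_right (norm_nonneg _) h1
    rw [← norm_mul] at h2
    gcongr
  · exact hae fun t ht => hgs.mul_left _
  · simp only [tsum_mul_left]
    exact hwint.norm.mul_const _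
  · refine hae fun t ht => ?_
    refine (hasSum_one_sub_cpow_neg a (y := x * t) ?_).mul_left _
    rw [norm_mul]
    have h1 : ‖(t : ℂ)‖ ≤ 1 := by simp [abs_of_pos ht.1, ht.2.le]
    exact (mul_le_of_le_one_right (norm_nonneg _) h1).trans_lt hx

/-! ### The two components of the combination (1) -/

/-- The analytic component of `longComb`. -/
noncomputable def regularComponent (a v : ℂ) : ℂ :=
  2 * Real.pi ^ 2 * Complex.Gamma (1 / 2) * Complex.Gamma (1 / 2 - 2 * a) /
    (Complex.Gamma (1 - a) ^ 2 * Complex.Gamma (1 / 2 - a) ^ 2) * swF₂ a v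

/-- The component of `longComb` that is singular at `v = 0`. -/
noncomputable def singularComponent (a v : ℂ) : ℂ :=
  -(Complex.Gamma (1 / 2) * Complex.Gamma (1 / 2 + 2 * a)) * swF₁ a v

theorem longComb_eq_add (a v : ℂ) :
    longComb a v = singularComponent a v + regularComponent a v := rfl

/-- The form `cos (2πa) ≠ 0` of "not exceptional" is used from here on, since this cosine is also
the denominator that the reflection formula brings in. -/
theorem cos_two_pi_mul_eq_zero_iff (a : ℂ) :
    Complex.cos (2 * Real.pi * a) = 0 ↔ ∃ k : ℤ, 4 * a = 2 * k + 1 := by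
  rw [Complex.cos_eq_zero_iff]
  have hπ : (Real.pi : ℂ) ≠ 0 := Complex.ofReal_ne_zero.2 Real.pi_ne_zero
  refine exists_congr fun k => ⟨fun h => ?_, fun h => ?_⟩
  · refine mul_left_cancel₀ hπ ?_
    linear_combination 2 * h
  · linear_combination (Real.pi / 2 : ℂ) * h

theorem cos_two_pi_mul_add_half (a : ℂ) :
    Complex.cos (2 * Real.pi * (a + 1 / 2)) = -Complex.cos (2 * Real.pi * a) := by
  rw [show 2 * Real.pi * (a + 1 / 2) = 2 * Real.pi * a + Real.pi by ring, Complex.cos_add_pi]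

theorem two_mul_add_half_add_nat_ne_zero {a : ℂ} (ha : Complex.cos (2 * Real.pi * a) ≠ 0) (n : ℕ) :
    2 * a + 1 / 2 + n ≠ 0 := fun h => by
  refine ha ((cos_two_pi_mul_eq_zero_iff a).2 ⟨-(n : ℤ) - 1, ?_⟩)
  push_cast
  linear_combination 2 * h

theorem half_sub_ne_zero {a : ℂ} (ha : Complex.cos (2 * Real.pi * a) ≠ 0) :
    1 / 2 - 2 * a ≠ 0 := fun h => by
  refine ha ((cos_two_pi_mul_eq_zero_iff a).2 ⟨0, ?_⟩)
  push_cast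
  linear_combination -2 * h

/-- Matches the prefactors of the regular component at `a` and at `a + 1/2`. The relation for
`1/Γ(-a)` holds for every `a`, so nothing has to be excluded for the gamma factors in the
denominator. -/
theorem sq_mul_regularComponent_coeff {a : ℂ} (ha : Complex.cos (2 * Real.pi * a) ≠ 0) :
    a ^ 2 * (2 * Real.pi ^ 2 * Complex.Gamma (1 / 2) * Complex.Gamma (1 / 2 - 2 * a) /
      (Complex.Gamma (1 - a) ^ 2 * Complex.Gamma (1 / 2 - a) ^ 2)) =
    (-(1 / 2) - 2 * a) * (2 * Real.pi ^ 2 * Complex.Gamma (1 / 2) *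
      Complex.Gamma (1 / 2 - 2 * (a + 1 / 2)) /
      (Complex.Gamma (1 - (a + 1 / 2)) ^ 2 * Complex.Gamma (1 / 2 - (a + 1 / 2)) ^ 2)) := by
  have h0 : -(1 / 2) - 2 * a ≠ 0 := fun h => by
    have := two_mul_add_half_add_nat_ne_zero ha 0
    apply this
    push_cast
    linear_combination -h
  have h1 := Complex.Gamma_add_one _ h0
  have h2 := Complex.one_div_Gamma_eq_self_mul_one_div_Gamma_add_one (-a)
  rw [show -(1 / 2) - 2 * a + 1 = 1 / 2 - 2 * a by ring] at h1
  rw [show -a + 1 = 1 - a by ring] at h2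
  rw [show 1 / 2 - 2 * (a + 1 / 2) = -(1 / 2) - 2 * a by ring,
    show 1 - (a + 1 / 2) = 1 / 2 - a by ring, show 1 / 2 - (a + 1 / 2) = -a by ring, h1]
  simp only [div_eq_mul_inv, mul_inv, ← inv_pow]
  rw [h2]
  ring

theorem norm_div_two_lt_one {v : ℂ} (hv : ‖v‖ < 2) : ‖v / 2‖ < 1 := by
  rw [norm_div, Complex.norm_ofNat]; linarith

theorem hasDerivAt_swF₂ {a v : ℂ} (ha : Complex.cos (2 * Real.pi * a) ≠ 0) (hv : ‖v‖ < 2) :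
    HasDerivAt (swF₂ a) (2 * a ^ 2 / (2 * a + 1 / 2) * swF₂ (a + 1 / 2) v) v := by
  have h := (hasDerivAt_ordinaryHypergeometric (2 * a) (2 * a)
    (two_mul_add_half_add_nat_ne_zero ha) (norm_div_two_lt_one hv)).comp v
    ((hasDerivAt_id v).div_const 2)
  refine h.congr_deriv ?_
  unfold swF₂
  rw [show 2 * (a + 1 / 2) = 2 * a + 1 by ring, show 2 * a + 1 + 1 / 2 = 2 * a + 1 / 2 + 1 by ring]
  ring

/-- The same ladder as `hasDerivAt_normPeriod` under `p = -2a`: raising `a` by `1/2` lowers `p` by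
one. -/
theorem hasDerivAt_regularComponent {a v : ℂ} (ha : Complex.cos (2 * Real.pi * a) ≠ 0)
    (hv : ‖v‖ < 2) :
    HasDerivAt (regularComponent a) (-2 * regularComponent (a + 1 / 2) v) v := by
  refine ((hasDerivAt_swF₂ ha hv).const_mul _).congr_deriv ?_
  have h0 : 2 * a + 1 / 2 ≠ 0 := by simpa using two_mul_add_half_add_nat_ne_zero ha 0
  have h := sq_mul_regularComponent_coeff ha
  rw [regularComponent, show ∀ x y z : ℂ, x * (2 * a ^ 2 / y * z) = a ^ 2 * x * (2 / y * z) by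
    intros; ring, h]
  generalize 2 * Real.pi ^ 2 * Complex.Gamma (1 / 2) *
      Complex.Gamma (1 / 2 - 2 * (a + 1 / 2)) /
      (Complex.Gamma (1 - (a + 1 / 2)) ^ 2 * Complex.Gamma (1 / 2 - (a + 1 / 2)) ^ 2) = κ
  generalize swF₂ (a + 1 / 2) v = s
  have hq : 2 / (2 * a + 1 / 2) * (2 * a + 1 / 2) = 2 := div_mul_cancel₀ _ h0
  linear_combination -(κ * s) * hq

/-- This is the hypergeometric differential equation, with both derivatives rewritten through the
ladder. -/
theorem regularComponent_recurrence {a v : ℂ} (ha : Complex.cos (2 * Real.pi * a) ≠ 0)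
    (hv : ‖v‖ < 2) :
    4 * (v * (2 - v)) * regularComponent (a + 1) v =
      2 * (4 * a + 1) * (1 - v) * regularComponent (a + 1 / 2) v +
        4 * a ^ 2 * regularComponent a v := by
  have hx := norm_div_two_lt_one hv
  have ha' : Complex.cos (2 * Real.pi * (a + 1 / 2)) ≠ 0 := by
    rw [cos_two_pi_mul_add_half]; exact neg_ne_zero.2 ha
  have hode := ordinaryHypergeometric_ode (2 * a) (2 * a)
    (two_mul_add_half_add_nat_ne_zero ha) hx
  have hev : ∀ᶠ w in 𝓝 v, ‖w‖ < 2 := continuous_norm.continuousAt.eventually (gt_mem_nhds hv)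
  have hcomp : regularComponent a = fun w => 2 * Real.pi ^ 2 * Complex.Gamma (1 / 2) *
    Complex.Gamma (1 / 2 - 2 * a) / (Complex.Gamma (1 - a) ^ 2 * Complex.Gamma (1 / 2 - a) ^ 2) *
    ordinaryHypergeometric (2 * a) (2 * a) (2 * a + 1 / 2) (w / 2) := rfl
  set κ := 2 * Real.pi ^ 2 * Complex.Gamma (1 / 2) *
    Complex.Gamma (1 / 2 - 2 * a) / (Complex.Gamma (1 - a) ^ 2 * Complex.Gamma (1 / 2 - a) ^ 2)
  set F : ℂ → ℂ := ordinaryHypergeometric (2 * a) (2 * a) (2 * a + 1 / 2) with hF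
  have hd := (hasFPowerSeriesOnBall_ordinaryHypergeometric (2 * a) (2 * a)
    (2 * a + 1 / 2)).differentiableOn_ball
  have hmem : ∀ {w : ℂ}, ‖w‖ < 2 → Metric.ball (0 : ℂ) 1 ∈ 𝓝 (w / 2) := fun h =>
    Metric.isOpen_ball.mem_nhds (by simpa using norm_div_two_lt_one h)
  have d1 : ∀ w : ℂ, ‖w‖ < 2 →
      HasDerivAt (regularComponent a) (κ * (deriv F (w / 2) * (1 / 2))) w := fun w hw => by
    rw [hcomp]
    exact (HasDerivAt.comp (h₂ := F) (h := fun w => w / 2) w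
      (hd.differentiableAt (hmem hw)).hasDerivAt ((hasDerivAt_id w).div_const 2)).const_mul κ
  have d2 : HasDerivAt (fun w => κ * (deriv F (w / 2) * (1 / 2)))
      (κ * (deriv (deriv F) (v / 2) * (1 / 2) * (1 / 2))) v := by
    exact ((HasDerivAt.comp (h₂ := deriv F) (h := fun w => w / 2) v
      ((hd.deriv Metric.isOpen_ball).differentiableAt (hmem hv)).hasDerivAt
      ((hasDerivAt_id v).div_const 2)).mul_const _).const_mul κ
  have e1 : ∀ w : ℂ, ‖w‖ < 2 → κ * (deriv F (w / 2) * (1 / 2)) =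
      -2 * regularComponent (a + 1 / 2) w := fun w hw =>
    (d1 w hw).unique (hasDerivAt_regularComponent ha hw)
  have e2 : κ * (deriv (deriv F) (v / 2) * (1 / 2) * (1 / 2)) =
      -2 * (-2 * regularComponent (a + 1) v) := by
    have := (hasDerivAt_regularComponent ha' hv).const_mul (-2)
    rw [show a + 1 / 2 + 1 / 2 = a + 1 by ring] at this
    exact (d2.congr_of_eventuallyEq (hev.mono fun w hw => (e1 w hw).symm)).unique this
  have e3 : regularComponent a v = κ * F (v / 2) := rfl
  rw [e3]
  linear_combination (v * (v - 2)) * e2 - (4 * a + 1) * (1 - v) * e1 v hv + κ * hode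

theorem ofReal_cpow_eq_exp {x : ℝ} (hx : 0 < x) (p : ℂ) :
    (x : ℂ) ^ p = Complex.exp (Real.log x * p) := by
  rw [Complex.cpow_def_of_ne_zero (Complex.ofReal_ne_zero.2 hx.ne'), Complex.ofReal_log hx.le]

/-- The quadratic substitution `x = (t / (2 - t))²`, with `1 - x = 4 (1 - t) / (2 - t)²`, turns
Euler's integral at the argument `1/2` into a beta integral. This is the substance of Gauss's second
summation theorem. -/
theorem integral_cpow_mul_one_sub_half (a : ℂ) :
    ∫ t in (0 : ℝ)..1, (t : ℂ) ^ (2 * a - 1) * (1 - t : ℂ) ^ (2 * a + 1 / 2 - 2 * a - 1) *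
      (1 - 1 / 2 * t) ^ (-(2 * a)) = 2 ^ (2 * a - 1) * Complex.betaIntegral a (1 / 2) := by
  unfold Complex.betaIntegral
  rw [integral_comp_of_deriv_pos (f := fun t => (t / (2 - t)) ^ 2)
    (f' := fun t => 4 * t / (2 - t) ^ 3)
    (fun x : ℝ => (x : ℂ) ^ (a - 1) * (1 - x : ℂ) ^ (1 / 2 - 1 : ℂ)),
    ← intervalIntegral.integral_const_mul]
  · refine integral_congr_Ioo fun t ht => ?_
    have h0 := ht.1
    have h1 : 0 < 1 - t := by linarith [ht.2]
    have h2 : 0 < 2 - t := by linarith [ht.2]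
    have c1 : (1 - t : ℂ) = ((1 - t : ℝ) : ℂ) := by push_cast; ring
    have c2 : (1 - 1 / 2 * t : ℂ) = (((2 - t) / 2 : ℝ) : ℂ) := by push_cast; ring
    have c3 : (1 - (((t / (2 - t)) ^ 2 : ℝ) : ℂ)) = ((2 ^ 2 * (1 - t) / (2 - t) ^ 2 : ℝ) : ℂ) := by
      rw [← Complex.ofReal_one, ← Complex.ofReal_sub]
      congr 1
      field_simp
      ring
    have c4 : ((4 * t / (2 - t) ^ 3 : ℝ) : ℂ) = ((2 ^ 2 * t / (2 - t) ^ 3 : ℝ) : ℂ) ^ (1 : ℂ) := by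
      rw [Complex.cpow_one]; norm_num
    have c5 : (2 : ℂ) = ((2 : ℝ) : ℂ) := by norm_num
    rw [c1, c2, c3, c4]
    nth_rewrite 6 [c5]
    -- All bases are positive reals, so the identity of powers becomes a linear identity between
    -- logarithms.
    rw [ofReal_cpow_eq_exp h0, ofReal_cpow_eq_exp h1, ofReal_cpow_eq_exp (by positivity),
      ofReal_cpow_eq_exp (by positivity), ofReal_cpow_eq_exp (by positivity),
      ofReal_cpow_eq_exp (by positivity), ofReal_cpow_eq_exp (by positivity)]
    simp only [← Complex.exp_add]
    congr 1
    have l1 : Real.log ((2 - t) / 2) = Real.log (2 - t) - Real.log 2 :=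
      Real.log_div h2.ne' two_ne_zero
    have l2 : Real.log ((t / (2 - t)) ^ 2) = 2 * (Real.log t - Real.log (2 - t)) := by
      rw [Real.log_pow, Real.log_div h0.ne' h2.ne']; norm_num
    have l3 : Real.log (2 ^ 2 * (1 - t) / (2 - t) ^ 2) =
        2 * Real.log 2 + Real.log (1 - t) - 2 * Real.log (2 - t) := by
      rw [Real.log_div (by positivity) (by positivity), Real.log_mul (by norm_num) h1.ne',
        Real.log_pow, Real.log_pow]
      norm_num
    have l4 : Real.log (2 ^ 2 * t / (2 - t) ^ 3) =
        2 * Real.log 2 + Real.log t - 3 * Real.log (2 - t) := by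
      rw [Real.log_div (by positivity) (by positivity), Real.log_mul (by norm_num) h0.ne',
        Real.log_pow, Real.log_pow]
      norm_num
    rw [l1, l2, l3, l4]
    push_cast
    ring
  · refine ContinuousOn.pow (ContinuousOn.div (by fun_prop) (by fun_prop) fun t ht => ?_) 2
    have := ht.2
    linarith
  · norm_num
  · norm_num
  · intro t ht
    have h2 : 2 - t ≠ 0 := by linarith [ht.2]
    have := (((hasDerivAt_id t).div ((hasDerivAt_id t).const_sub 2) h2).pow 2)
    refine this.congr_deriv ?_
    simp
    field_simp
    ring
  · intro t ht
    have h0 := ht.1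
    have h2 : 0 < 2 - t := by linarith [ht.2]
    positivity

theorem sin_mul_eq_inv_Gamma {z : ℂ} :
    (Complex.Gamma z)⁻¹ * (Complex.Gamma (1 - z))⁻¹ = Complex.sin (Real.pi * z) / Real.pi := by
  rw [← mul_inv, Complex.Gamma_mul_Gamma_one_sub, inv_div]

theorem sqrt_pi_sq : Complex.Gamma (1 / 2) ^ 2 = Real.pi := by
  have h := Complex.Gamma_mul_Gamma_one_sub (1 / 2)
  rw [show (1 - 1 / 2 : ℂ) = 1 / 2 by norm_num, show Real.pi * (1 / 2 : ℂ) = Real.pi / 2 by ring,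
    Complex.sin_pi_div_two, div_one] at h
  rw [sq, h]

theorem Gamma_half_eq_sqrt : Complex.Gamma (1 / 2) = ((√Real.pi : ℝ) : ℂ) := by
  rw [Complex.Gamma_one_half_eq, Real.sqrt_eq_rpow, Complex.ofReal_cpow Real.pi_pos.le]
  norm_num

theorem Gamma_half_sub_mul_Gamma_half_add (a : ℂ) :
    Complex.Gamma (1 / 2 - a) * Complex.Gamma (1 / 2 + a) =
      Real.pi / Complex.cos (Real.pi * a) := by
  have h := Complex.Gamma_mul_Gamma_one_sub (1 / 2 + a)
  rw [show Real.pi * (1 / 2 + a) = Real.pi * a + Real.pi / 2 by ring,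
    Complex.sin_add_pi_div_two, show 1 - (1 / 2 + a) = 1 / 2 - a by ring] at h
  rw [mul_comm, h]

/-- At `v = 1` the argument `v / 2` is `1/2`, where Gauss's second theorem applies; reflection
formulas then convert the gamma factors. -/
theorem regularComponent_one_of_re_pos {a : ℂ} (h : 0 < a.re)
    (ha : Complex.cos (2 * Real.pi * a) ≠ 0) :
    regularComponent a 1 = (1 + (Complex.cos (2 * Real.pi * a))⁻¹) *
      (Real.pi ^ 2 * ((Complex.Gamma (1 - a))⁻¹) ^ 2) := by
  have hE := integral_cpow_mul_eq_ordinaryHypergeometric (2 * a) (b := 2 * a)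
    (c := 2 * a + 1 / 2) (x := 1 / 2) (by simpa using h) (by simp) (by norm_num)
  rw [integral_cpow_mul_one_sub_half] at hE
  have hB := Complex.Gamma_mul_Gamma_eq_betaIntegral h (t := 1 / 2) (by norm_num)
  have hd := Complex.Gamma_mul_Gamma_add_half a
  have g1 : Complex.Gamma (2 * a) ≠ 0 := Complex.Gamma_ne_zero_of_re_pos (by simpa using h)
  have g2 : Complex.Gamma (2 * a + 1 / 2) ≠ 0 :=
    Complex.Gamma_ne_zero_of_re_pos (by simp; linarith)
  have g3 : Complex.Gamma (a + 1 / 2) ≠ 0 :=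
    Complex.Gamma_ne_zero_of_re_pos (by simp; linarith)
  have g4 : Complex.Gamma (1 / 2) ≠ 0 := Complex.Gamma_ne_zero_of_re_pos (by norm_num)
  rw [← Gamma_half_eq_sqrt] at hd
  have r1 := Gamma_half_sub_mul_Gamma_half_add (2 * a)
  have r2 := congrArg (·⁻¹) (Gamma_half_sub_mul_Gamma_half_add a)
  simp only [mul_inv, inv_div] at r2
  have hc : Complex.cos (2 * Real.pi * a) = 2 * Complex.cos (Real.pi * a) ^ 2 - 1 := by
    rw [mul_assoc, Complex.cos_two_mul]
  rw [show Real.pi * (2 * a) = 2 * Real.pi * a by ring, add_comm (1 / 2)] at r1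
  rw [add_comm (1 / 2)] at r2
  have hπ : (Real.pi : ℂ) ≠ 0 := Complex.ofReal_ne_zero.2 Real.pi_ne_zero
  have h2 : (2 : ℂ) ^ (1 - 2 * a) * 2 ^ (2 * a - 1) = 1 := by
    rw [← Complex.cpow_add _ _ two_ne_zero]; simp
  have hsq := sqrt_pi_sq
  have hF : swF₂ a 1 = Complex.Gamma (1 / 2) * Complex.Gamma (2 * a + 1 / 2) *
      ((Complex.Gamma (a + 1 / 2))⁻¹) ^ 2 := by
    unfold swF₂
    rw [show 2 * a + 1 / 2 - 2 * a = 1 / 2 by ring] at hE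
    generalize ordinaryHypergeometric (2 * a) (2 * a) (2 * a + 1 / 2) (1 / 2 : ℂ) = F at *
    generalize Complex.betaIntegral a (1 / 2) = B at *
    generalize Complex.Gamma (2 * a) = G₁ at *
    generalize Complex.Gamma (2 * a + 1 / 2) = G₂ at *
    generalize Complex.Gamma (a + 1 / 2) = G₃ at *
    generalize Complex.Gamma (1 / 2) = G₄ at *
    generalize Complex.Gamma a = G at *
    generalize (2 : ℂ) ^ (2 * a - 1) = P at *
    generalize (2 : ℂ) ^ (1 - 2 * a) = P' at *
    field_simp at hE ⊢
    refine mul_left_cancel₀ (mul_ne_zero g1 g4) ?_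
    linear_combination -G₃ ^ 2 * hE - P * G₂ * G₃ * hB + G₂ * P * G₄ * hd + G₂ * G₁ * G₄ ^ 2 * h2
  unfold regularComponent
  rw [hF]
  rw [div_eq_mul_inv, mul_inv, ← inv_pow, ← inv_pow]
  generalize (Complex.Gamma (1 - a))⁻¹ = I₁ at *
  generalize Complex.Gamma (1 / 2 - 2 * a) = G₁ at *
  generalize Complex.Gamma (2 * a + 1 / 2) = G₂ at *
  generalize (Complex.Gamma (1 / 2 - a))⁻¹ = I₂ at *
  generalize (Complex.Gamma (a + 1 / 2))⁻¹ = I₃ at *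
  generalize Complex.Gamma (1 / 2) = G₄ at *
  have e : 2 * Real.pi ^ 2 * G₄ * G₁ * (I₁ ^ 2 * I₂ ^ 2) * (G₄ * G₂ * I₃ ^ 2) =
      2 * Real.pi ^ 2 * G₄ ^ 2 * (G₁ * G₂) * I₁ ^ 2 * (I₂ * I₃) ^ 2 := by ring
  rw [e, r1, r2, hsq]
  field_simp
  linear_combination -(I₁ ^ 2) * hc

theorem ordinaryHypergeometric_zero_left (b c x : ℂ) : ordinaryHypergeometric 0 b c x = 1 := by
  rw [ordinaryHypergeometric_eq_tsum]
  refine (tsum_eq_single 0 fun n hn => ?_).trans (by simp)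
  obtain ⟨k, rfl⟩ := Nat.exists_eq_succ_of_ne_zero hn
  simp [ascPochhammer_succ_left]

/-- Euler's integral needs `Re a > 0`. The recurrence at `v = 1`, where its middle term vanishes,
carries the value from `a + 1` to `a`; this divides by `a²`, so `a = 0` is computed directly. -/
theorem regularComponent_one {a : ℂ} (ha : Complex.cos (2 * Real.pi * a) ≠ 0) :
    regularComponent a 1 = (1 + (Complex.cos (2 * Real.pi * a))⁻¹) *
      (Real.pi ^ 2 * ((Complex.Gamma (1 - a))⁻¹) ^ 2) := by
  obtain ⟨n, hn⟩ := exists_nat_gt (-a.re)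
  induction n generalizing a with
  | zero => exact regularComponent_one_of_re_pos (by simpa using hn) ha
  | succ n ih =>
    have hc : Complex.cos (2 * Real.pi * (a + 1)) = Complex.cos (2 * Real.pi * a) := by
      rw [show 2 * Real.pi * (a + 1) = 2 * Real.pi * a + 2 * Real.pi by ring, Complex.cos_add_two_pi]
    rcases eq_or_ne a 0 with rfl | h0
    · have g : Complex.Gamma (1 / 2) ≠ 0 := Complex.Gamma_ne_zero_of_re_pos (by norm_num)
      unfold regularComponent swF₂
      rw [mul_zero, ordinaryHypergeometric_zero_left]
      simp only [mul_zero, sub_zero, Complex.Gamma_one, Complex.cos_zero]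
      field_simp
      norm_num
    · have h1 := ih (a := a + 1) (by rwa [hc]) (by simp; push_cast at hn; linarith)
      have h2 := regularComponent_recurrence (v := 1) ha (by simp)
      have h3 := Complex.one_div_Gamma_eq_self_mul_one_div_Gamma_add_one (-a)
      rw [show -a + 1 = 1 - a by ring] at h3
      rw [hc, show 1 - (a + 1) = -a by ring, h3] at h1
      refine mul_left_cancel₀ (pow_ne_zero 2 h0) ?_
      linear_combination -(1 / 4) * h2 + h1

theorem three_half_sub_eq (a : ℂ) : 3 / 2 - 2 * a = 1 / 2 - 2 * a + 1 := by ring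

/-- Termwise `(c + n) / (c + 1)_n = c / (c)_n`. It says that `x^c F(a, b; c + 1; x)` has derivative
`c x^(c-1) F(a, b; c; x)`, which gives the ladder for the singular component. -/
theorem ordinaryHypergeometric_contiguous (a b : ℂ) {c x : ℂ} (hc : ∀ n : ℕ, c + n ≠ 0)
    (hx : ‖x‖ < 1) :
    c * ordinaryHypergeometric a b (c + 1) x + x * deriv (ordinaryHypergeometric a b (c + 1)) x =
      c * ordinaryHypergeometric a b c x := by
  have F1 := hasFPowerSeriesOnBall_ordinaryHypergeometric a b (c + 1)
  have F0 := hasFPowerSeriesOnBall_ordinaryHypergeometric a b c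
  have h1 := (F1.hasSum_ofScalars hx).mul_left c
  have h2 := hasSum_mul_of_succ (g := fun n => (n : ℂ) * ordinaryHypergeometricCoefficient a b (c + 1) n)
    (x := x) (by simp) (by simpa using F1.hasSum_deriv_ofScalars hx)
  have h0 := (F0.hasSum_ofScalars hx).mul_left c
  refine (h1.add h2).unique ?_
  refine h0.congr_fun fun n => ?_
  have hp : (ascPochhammer ℂ n).eval c ≠ 0 := by
    rw [Ne, ascPochhammer_eval_eq_zero_iff]
    rintro ⟨k, -, hk⟩
    exact hc k (by rw [hk]; ring)
  have hp' : (ascPochhammer ℂ n).eval (c + 1) ≠ 0 := by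
    rw [Ne, ascPochhammer_eval_eq_zero_iff]
    rintro ⟨k, -, hk⟩
    exact hc (k + 1) (by push_cast; linear_combination hk)
  have e := ascPochhammer_eval_add_one c n
  have hfac := Nat.cast_ne_zero (R := ℂ).2 n.factorial_ne_zero
  simp only [ordinaryHypergeometricCoefficient]
  field_simp
  linear_combination -((ascPochhammer ℂ n).eval a * (ascPochhammer ℂ n).eval b * x ^ n) * e

theorem hasDerivAt_singularComponent {a v : ℂ} (ha : Complex.cos (2 * Real.pi * a) ≠ 0)
    (hv : v ∈ Complex.slitPlane) (hv2 : ‖v‖ < 2) :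
    HasDerivAt (singularComponent a) (-2 * singularComponent (a + 1 / 2) v) v := by
  have hc : ∀ n : ℕ, 1 / 2 - 2 * a + n ≠ 0 := fun n h => by
    refine ha ((cos_two_pi_mul_eq_zero_iff a).2 ⟨n, ?_⟩)
    push_cast
    linear_combination -2 * h
  have hx := norm_div_two_lt_one hv2
  have hcont := ordinaryHypergeometric_contiguous (1 / 2) (1 / 2) hc hx
  have h0 : 1 / 2 - 2 * a ≠ 0 := half_sub_ne_zero ha
  have hm : 2 * v ∈ Complex.slitPlane := by
    rw [Complex.mem_slitPlane_iff] at hv ⊢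
    simpa using hv
  have d1 : HasDerivAt (fun v : ℂ => (2 * v) ^ (1 / 2 - 2 * a))
      ((1 / 2 - 2 * a) * (2 * v) ^ (1 / 2 - 2 * a - 1) * 2) v := by
    simpa using HasDerivAt.cpow_const (c := 1 / 2 - 2 * a) ((hasDerivAt_id v).const_mul 2) hm
  have d2 := HasDerivAt.comp (h₂ := ordinaryHypergeometric (1 / 2 : ℂ) (1 / 2) (1 / 2 - 2 * a + 1))
    (h := fun w => w / 2) v
    (((hasFPowerSeriesOnBall_ordinaryHypergeometric (1 / 2 : ℂ) (1 / 2)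
      (1 / 2 - 2 * a + 1)).differentiableOn_ball).differentiableAt
      (Metric.isOpen_ball.mem_nhds (by simpa using hx))).hasDerivAt ((hasDerivAt_id v).div_const 2)
  have hG : Complex.Gamma (1 / 2 + 2 * (a + 1 / 2)) =
      (1 / 2 + 2 * a) * Complex.Gamma (1 / 2 + 2 * a) := by
    rw [← Complex.Gamma_add_one _ (by
      have := two_mul_add_half_add_nat_ne_zero ha 0; simpa [add_comm] using this)]
    congr 1; ring
  have h00 : 2 * a + 1 / 2 ≠ 0 := by simpa using two_mul_add_half_add_nat_ne_zero ha 0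
  have hfun : singularComponent a = fun w => -(Complex.Gamma (1 / 2) * Complex.Gamma (1 / 2 + 2 * a)) *
      ((2 / (1 - 4 * a)) * ((2 * w) ^ (1 / 2 - 2 * a) *
        ordinaryHypergeometric (1 / 2 : ℂ) (1 / 2) (1 / 2 - 2 * a + 1) (w / 2))) := by
    funext w
    rw [singularComponent, swF₁, three_half_sub_eq]
    ring
  rw [hfun]
  refine (((d1.mul d2).const_mul _).const_mul _).congr_deriv ?_
  have hp : (2 * v) ^ (1 / 2 - 2 * a) = (2 * v) ^ (1 / 2 - 2 * a - 1) * (2 * v) := by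
    rw [Complex.cpow_sub _ 1 (Complex.slitPlane_ne_zero hm), Complex.cpow_one,
      div_mul_cancel₀ _ (Complex.slitPlane_ne_zero hm)]
  rw [singularComponent, swF₁, hG, show 1 / 2 - 2 * (a + 1 / 2) = 1 / 2 - 2 * a - 1 by ring,
    show 3 / 2 - 2 * (a + 1 / 2) = 1 / 2 - 2 * a by ring]
  simp only [Function.comp]
  rw [hp]
  rw [show 1 - 4 * (a + 1 / 2) = -(2 * (2 * a + 1 / 2)) by ring,
    show 1 - 4 * a = 2 * (1 / 2 - 2 * a) by ring, show 1 / 2 + 2 * a = 2 * a + 1 / 2 by ring]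
  generalize ordinaryHypergeometric (1 / 2 : ℂ) (1 / 2) (1 / 2 - 2 * a) (v / 2) = F₀ at *
  generalize ordinaryHypergeometric (1 / 2 : ℂ) (1 / 2) (1 / 2 - 2 * a + 1) (v / 2) = F₁ at *
  generalize (2 * v) ^ (1 / 2 - 2 * a - 1) = X at *
  generalize 1 / 2 - 2 * a = c at *
  generalize 2 * a + 1 / 2 = d at *
  field_simp
  linear_combination -2 * (Complex.Gamma (1 / 2) * Complex.Gamma d * X) * hcont

theorem ofReal_mul_cpow {r : ℝ} (hr : 0 < r) {z : ℂ} (hz : z ≠ 0) (p : ℂ) :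
    ((r : ℂ) * z) ^ p = (r : ℂ) ^ p * z ^ p := by
  have h : (r : ℂ) ≠ 0 := Complex.ofReal_ne_zero.2 hr.ne'
  rw [Complex.cpow_def_of_ne_zero (mul_ne_zero h hz), Complex.cpow_def_of_ne_zero h,
    Complex.cpow_def_of_ne_zero hz, Complex.log_ofReal_mul hr hz, Complex.ofReal_log hr.le, add_mul,
    Complex.exp_add]

theorem two_mul_cpow {z : ℂ} (hz : z ≠ 0) (p : ℂ) : (2 * z) ^ p = 2 ^ p * z ^ p := by
  have := ofReal_mul_cpow two_pos hz p
  simpa using this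

/-- Replacing `σ` by `1 - σ` puts the integral, now over a path of length `v`, into Euler's form
with argument `v / 2`. -/
theorem periodIntegral_two_sub {p v : ℂ} (hp : -1 < p.re)
    (hv2 : ‖v‖ < 2) :
    periodIntegral p (2 - v) = v ^ (p + 1 / 2) * 2 ^ (-(1 / 2) : ℂ) *
      (Complex.Gamma (1 / 2) * Complex.Gamma (p + 1) / Complex.Gamma (p + 3 / 2) *
        ordinaryHypergeometric (1 / 2 : ℂ) (1 / 2) (p + 3 / 2) (v / 2)) := by
  have hE := integral_cpow_mul_eq_ordinaryHypergeometric (1 / 2) (b := 1 / 2) (c := p + 3 / 2)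
    (x := v / 2) (by norm_num) (by simp; linarith) (norm_div_two_lt_one hv2)
  rw [show p + 3 / 2 - 1 / 2 = p + 1 by ring] at hE
  rw [← hE, periodIntegral, ← intervalIntegral.integral_const_mul]
  have := intervalIntegral.integral_comp_sub_left (a := 0) (b := 1) (periodIntegrand p (2 - v)) 1
  simp only [sub_self, sub_zero] at this
  rw [← this]
  refine integral_congr_Ioo fun t ht => ?_
  unfold periodIntegrand
  have h1 : (2 - v + (2 - (2 - v)) * ((1 - t : ℝ) : ℂ)) = 2 * (1 - v / 2 * t) := by
    push_cast; ring
  have h2 : 1 - v / 2 * t ≠ 0 := fun h => by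
    have : ‖v / 2 * t‖ < 1 := by
      rw [norm_mul, Complex.norm_real, Real.norm_of_nonneg ht.1.le]
      have := norm_div_two_lt_one hv2
      nlinarith [ht.1, ht.2, norm_nonneg (v / 2)]
    rw [← sub_eq_zero.1 h] at this
    simp at this
  rw [h1, two_mul_cpow h2, show (1 - ((1 - t : ℝ) : ℂ)) = t by push_cast; ring,
    show p + 1 - 1 = p by ring, show (1 / 2 - 1 : ℂ) = -(1 / 2) by norm_num,
    show 2 - (2 - v) = v by ring]
  push_cast
  ring

/-- Up to the factor `-1 / cos (2πa)` from the reflection formula, the singular component is the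
period at the mirrored point `2 - v`. -/
theorem singularComponent_eq {a v : ℂ} (ha : Complex.cos (2 * Real.pi * a) ≠ 0) (h : a.re < 1 / 2)
    (hv : v ∈ Complex.slitPlane) (hv2 : ‖v‖ < 2) :
    singularComponent a v =
      -(normPeriod (-2 * a) (2 - v) * (Complex.cos (2 * Real.pi * a))⁻¹) := by
  have hp : -1 < (-2 * a).re := by simp; linarith
  have g1 : Complex.Gamma (-2 * a + 1) ≠ 0 := Complex.Gamma_ne_zero_of_re_pos (by simp; linarith)
  have hh : 1 / 2 - 2 * a ≠ 0 := half_sub_ne_zero ha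
  have g2 : Complex.Gamma (-2 * a + 3 / 2) = (1 / 2 - 2 * a) * Complex.Gamma (1 / 2 - 2 * a) := by
    rw [← Complex.Gamma_add_one _ hh]; congr 1; ring
  have g3 : Complex.Gamma (-2 * a + 3 / 2) ≠ 0 :=
    Complex.Gamma_ne_zero_of_re_pos (by simp; linarith)
  have g4 : Complex.Gamma (1 / 2 - 2 * a) ≠ 0 := fun h => g3 (by rw [g2, h, mul_zero])
  have r1 := Gamma_half_sub_mul_Gamma_half_add (2 * a)
  rw [show Real.pi * (2 * a) = 2 * Real.pi * a by ring] at r1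
  rw [normPeriod, periodIntegral_two_sub hp hv2, g2, singularComponent, swF₁,
    two_mul_cpow (Complex.slitPlane_ne_zero hv), show 3 / 2 - 2 * a = -2 * a + 3 / 2 by ring,
    show -2 * a + 1 / 2 = 1 / 2 - 2 * a by ring]
  have h2 : (2 : ℂ) ^ (1 / 2 - 2 * a) = 2 ^ (-2 * a) * 2 ^ (-(1 / 2) : ℂ) * 2 := by
    rw [← Complex.cpow_add _ _ two_ne_zero, mul_comm _ (2 : ℂ), ← two_cpow_add_one]
    congr 1; ring
  have hG : Complex.Gamma (1 / 2 + 2 * a) = Real.pi * (Complex.cos (2 * Real.pi * a))⁻¹ *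
      (Complex.Gamma (1 / 2 - 2 * a))⁻¹ := by
    rw [eq_mul_inv_iff_mul_eq₀ g4, mul_comm, r1, div_eq_mul_inv]
  have h4 : 1 - 4 * a ≠ 0 := fun h => hh (by linear_combination h / 2)
  rw [h2, hG, show 1 - 4 * a = 2 * (1 / 2 - 2 * a) by ring]
  generalize ordinaryHypergeometric (1 / 2 : ℂ) (1 / 2) (-2 * a + 3 / 2) (v / 2) = F₀ at *
  generalize 1 / 2 - 2 * a = c at *
  generalize Complex.Gamma (-2 * a + 1) = G₁ at *
  generalize Complex.Gamma c = G at *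
  generalize (2 : ℂ) ^ (-2 * a) = P at *
  field_simp

/-! ### The combination (1) as a period, and its continuation in `α` -/

theorem eqOn_of_iteratedDeriv_eq {f g : ℂ → ℂ} {U : Set ℂ} {c : ℂ} (hU : IsOpen U)
    (hU' : IsPreconnected U) (hc : c ∈ U) (hf : DifferentiableOn ℂ f U)
    (hg : DifferentiableOn ℂ g U) (h : ∀ n, iteratedDeriv n f c = iteratedDeriv n g c) :
    Set.EqOn f g U := by
  obtain ⟨r, hr, hrU⟩ := Metric.isOpen_iff.1 hU c hc
  refine (hf.analyticOnNhd hU).eqOn_of_preconnected_of_eventuallyEq (hg.analyticOnNhd hU) hU' hc ?_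
  filter_upwards [Metric.ball_mem_nhds c hr] with z hz
  have h1 := Complex.hasSum_taylorSeries_on_ball (hf.mono hrU) hz
  have h2 := Complex.hasSum_taylorSeries_on_ball (hg.mono hrU) hz
  simp only [h] at h1
  exact h1.unique h2

/-- The slit disc of convergence of the expansions around `v = 0`. -/
def slitDisc : Set ℂ := {v | v ∈ Complex.slitPlane ∧ ‖v‖ < 2}

theorem isOpen_slitDisc : IsOpen slitDisc :=
  Complex.isOpen_slitPlane.inter (isOpen_lt continuous_norm continuous_const)

theorem one_mem_slitDisc : (1 : ℂ) ∈ slitDisc := ⟨Complex.ofReal_mem_slitPlane.2 one_pos, by simp⟩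

theorem isPreconnected_slitDisc : IsPreconnected slitDisc := by
  have h : slitDisc = Complex.slitPlane ∩ Metric.ball 0 2 := by
    ext; simp [slitDisc]
  have : StarConvex ℝ 1 slitDisc := by
    rw [h]
    exact Complex.starConvex_one_slitPlane.inter ((convex_ball _ _).starConvex (by simp))
  exact (this.isPathConnected one_mem_slitDisc).isConnected.isPreconnected

theorem slitDisc_subset : slitDisc ⊆ doubleSlitPlane := fun _ h =>
  mem_doubleSlitPlane_of_norm_lt h.1 h.2

theorem cos_two_pi_mul_add_nat_half (a : ℂ) (n : ℕ) :
    Complex.cos (2 * Real.pi * (a + n / 2)) = (-1) ^ n * Complex.cos (2 * Real.pi * a) := by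
  induction n with
  | zero => simp
  | succ n ih =>
    rw [show a + ((n + 1 : ℕ) : ℂ) / 2 = a + n / 2 + 1 / 2 by push_cast; ring,
      cos_two_pi_mul_add_half, ih, pow_succ]
    ring

theorem iteratedDeriv_eq_of_hasDerivAt_add_half {G : ℂ → ℂ → ℂ} {U : Set ℂ} (hU : IsOpen U)
    (hG : ∀ a, Complex.cos (2 * Real.pi * a) ≠ 0 → ∀ v ∈ U,
      HasDerivAt (G a) (-2 * G (a + 1 / 2) v) v)
    {a : ℂ} (ha : Complex.cos (2 * Real.pi * a) ≠ 0) (n : ℕ) :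
    ∀ v ∈ U, iteratedDeriv n (G a) v = (-2) ^ n * G (a + n / 2) v := by
  induction n with
  | zero => intro v _; simp
  | succ n ih =>
    intro v hv
    have h : iteratedDeriv n (G a) =ᶠ[𝓝 v] fun v => (-2) ^ n * G (a + n / 2) v := by
      filter_upwards [hU.mem_nhds hv] with w hw using ih w hw
    have ha' : Complex.cos (2 * Real.pi * (a + n / 2)) ≠ 0 := by
      rw [cos_two_pi_mul_add_nat_half]
      exact mul_ne_zero (pow_ne_zero _ (by norm_num)) ha
    rw [iteratedDeriv_succ, h.deriv_eq, ((hG _ ha' v hv).const_mul _).deriv,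
      show a + ((n + 1 : ℕ) : ℂ) / 2 = a + n / 2 + 1 / 2 by push_cast; ring]
    ring

/-- Both sides have the same derivatives of every order at `v = 1`, the fixed point of `v ↦ 2 - v`.
The sign `(-1)^n` of the mirrored term is matched by `cos (2π(a + n/2)) = (-1)^n cos (2πa)`. The
condition on `Re a` is what makes the formula for the derivatives of the period at `1` available. -/
theorem regularComponent_eq {a v : ℂ} (ha : Complex.cos (2 * Real.pi * a) ≠ 0)
    (h : a.re < -(1 / 2)) (hv : v ∈ slitDisc) :
    regularComponent a v = normPeriod (-2 * a) v +
      normPeriod (-2 * a) (2 - v) * (Complex.cos (2 * Real.pi * a))⁻¹ := by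
  have hp : 1 < (-2 * a).re := by simp; linarith
  have hE := differentiableOn_normPeriod (p := -2 * a) (by linarith)
  have hE' : DifferentiableOn ℂ (fun v => normPeriod (-2 * a) (2 - v)) doubleSlitPlane :=
    hE.comp (by fun_prop) fun v hv => two_sub_mem_doubleSlitPlane hv
  have hR : DifferentiableOn ℂ (regularComponent a) slitDisc := fun v hv =>
    (hasDerivAt_regularComponent ha hv.2).differentiableAt.differentiableWithinAt
  refine eqOn_of_iteratedDeriv_eq (f := regularComponent a) (g := fun v => normPeriod (-2 * a) v +
    normPeriod (-2 * a) (2 - v) * (Complex.cos (2 * Real.pi * a))⁻¹)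
    isOpen_slitDisc isPreconnected_slitDisc one_mem_slitDisc hR
    ((hE.add (hE'.mul_const _)).mono slitDisc_subset) (fun n => ?_) hv
  have ha' : Complex.cos (2 * Real.pi * (a + n / 2)) ≠ 0 := by
    rw [cos_two_pi_mul_add_nat_half]
    exact mul_ne_zero (pow_ne_zero _ (by norm_num)) ha
  rw [iteratedDeriv_eq_of_hasDerivAt_add_half (G := regularComponent) isOpen_slitDisc
    (fun a ha v hv => hasDerivAt_regularComponent ha hv.2) ha n 1 one_mem_slitDisc,
    regularComponent_one ha', cos_two_pi_mul_add_nat_half]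
  have c1 := (hE.contDiffOn isOpen_doubleSlitPlane (n := n)).contDiffAt
    (isOpen_doubleSlitPlane.mem_nhds one_mem_doubleSlitPlane)
  have c2 := (hE'.contDiffOn isOpen_doubleSlitPlane (n := n)).contDiffAt
    (isOpen_doubleSlitPlane.mem_nhds one_mem_doubleSlitPlane)
  have e : (fun v => normPeriod (-2 * a) v +
      normPeriod (-2 * a) (2 - v) * (Complex.cos (2 * Real.pi * a))⁻¹) =
      normPeriod (-2 * a) + fun v =>
        (Complex.cos (2 * Real.pi * a))⁻¹ * normPeriod (-2 * a) (2 - v) := by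
    funext v; simp [mul_comm]
  rw [e, iteratedDeriv_add c1 (contDiffAt_const.mul c2), iteratedDeriv_const_mul_field,
    iteratedDeriv_comp_const_sub]
  simp only
  rw [show (2 - 1 : ℂ) = 1 by norm_num, iteratedDeriv_normPeriod_one hp,
    show 1 + -2 * a / 2 - n / 2 = 1 - (a + n / 2) by ring, mul_inv, inv_pow, smul_eq_mul]
  have : ((-1 : ℂ)⁻¹) = -1 := by norm_num
  rw [← inv_pow, this]
  ring

/-- The mirrored periods cancel between the two components, and with them the factor `1 / cos (2πa)`
that is singular at exceptional `a`. -/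
theorem longComb_eq_normPeriod {a v : ℂ} (ha : Complex.cos (2 * Real.pi * a) ≠ 0)
    (h : a.re < -(1 / 2)) (hv : v ∈ slitDisc) : longComb a v = normPeriod (-2 * a) v := by
  rw [longComb_eq_add, singularComponent_eq ha (by linarith) hv.1 hv.2, regularComponent_eq ha h hv]
  ring

theorem hasDerivAt_longComb {a v : ℂ} (ha : Complex.cos (2 * Real.pi * a) ≠ 0)
    (hv : v ∈ slitDisc) : HasDerivAt (longComb a) (-2 * longComb (a + 1 / 2) v) v := by
  have h := (hasDerivAt_singularComponent ha hv.1 hv.2).add (hasDerivAt_regularComponent ha hv.2)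
  refine h.congr_deriv ?_
  rw [longComb_eq_add]
  ring

/-- Lowering `a` by `n/2` reaches the range of `longComb_eq_normPeriod`; differentiating `n` times
returns to `a`. The right side makes sense at exceptional `a` as well. -/
theorem longComb_eq_iteratedDeriv {a v : ℂ} (ha : Complex.cos (2 * Real.pi * a) ≠ 0)
    (hv : v ∈ slitDisc) {n : ℕ} (h : a.re - (n : ℝ) / 2 < -(1 / 2)) :
    longComb a v = (-(1 / 2)) ^ n * iteratedDeriv n (normPeriod (n - 2 * a)) v := by
  have hb : Complex.cos (2 * Real.pi * (a - n / 2)) ≠ 0 := fun h => ha (by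
    have := cos_two_pi_mul_add_nat_half (a - n / 2) n
    rwa [h, mul_zero, sub_add_cancel] at this)
  have h1 := iteratedDeriv_eq_of_hasDerivAt_add_half (G := longComb) isOpen_slitDisc
    (fun _ ha _ hv => hasDerivAt_longComb ha hv) hb n v hv
  have h2 : Set.EqOn (longComb (a - n / 2)) (normPeriod (-2 * (a - n / 2))) slitDisc :=
    fun w hw => longComb_eq_normPeriod hb (by simpa using h) hw
  rw [h2.iteratedDeriv isOpen_slitDisc n hv, sub_add_cancel,
    show -2 * (a - n / 2) = n - 2 * a by ring] at h1
  rw [h1, ← mul_assoc, ← mul_pow]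
  norm_num

theorem tendsto_longComb (α : ℂ) {v : ℂ} (hv : v ∈ slitDisc) {n : ℕ}
    (h : α.re - (n : ℝ) / 2 < -(1 / 2)) :
    Tendsto (fun a => longComb a v) (𝓝[≠] α)
      (𝓝 ((-(1 / 2)) ^ n * iteratedDeriv n (normPeriod (n - 2 * α)) v)) := by
  have hp : 1 < (n - 2 * α).re := by simp; linarith
  have hc : ContinuousAt (fun a => (-(1 / 2) : ℂ) ^ n * iteratedDeriv n (normPeriod (n - 2 * a)) v)
      α := by
    have h1 := continuousAt_iteratedDeriv_normPeriod (slitDisc_subset hv) n _ hp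
    exact continuousAt_const.mul
      (ContinuousAt.comp (f := fun a : ℂ => n - 2 * a) h1 (by fun_prop))
  refine (hc.tendsto.mono_left nhdsWithin_le_nhds).congr' ?_
  -- Exceptional values are isolated, because the zeros of the cosine are simple.
  have e1 : ∀ᶠ a in 𝓝[≠] α, Complex.cos (2 * Real.pi * a) ≠ 0 := by
    by_cases h0 : Complex.cos (2 * Real.pi * α) = 0
    · have hd : HasDerivAt (fun a => Complex.cos (2 * Real.pi * a))
          (-Complex.sin (2 * Real.pi * α) * (2 * Real.pi)) α := by
        simpa using (((hasDerivAt_id α).const_mul (2 * Real.pi : ℂ)).ccos)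
      refine hd.eventually_ne (mul_ne_zero (neg_ne_zero.2 fun hs => ?_) ?_)
      · have := Complex.sin_sq_add_cos_sq (2 * Real.pi * α)
        rw [h0, hs] at this
        norm_num at this
      · exact mul_ne_zero two_ne_zero (Complex.ofReal_ne_zero.2 Real.pi_ne_zero)
    · have : ContinuousAt (fun a => Complex.cos (2 * Real.pi * a)) α := by fun_prop
      exact (this.eventually_ne h0).filter_mono nhdsWithin_le_nhds
  have e2 : ∀ᶠ a in 𝓝[≠] α, a.re - (n : ℝ) / 2 < -(1 / 2) := by
    have : ContinuousAt (fun a : ℂ => a.re - n / 2) α := by fun_prop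
    exact (this.eventually (gt_mem_nhds h)).filter_mono nhdsWithin_le_nhds
  filter_upwards [e1, e2] with a h1 h2 using (longComb_eq_iteratedDeriv h1 hv h2).symm

theorem longY_eq_iteratedDeriv {α v : ℂ} (hv : v ∈ slitDisc) {n : ℕ}
    (h : α.re - (n : ℝ) / 2 < -(1 / 2)) :
    longY α v = (-(1 / 2)) ^ n * iteratedDeriv n (normPeriod (n - 2 * α)) v := by
  unfold longY
  split_ifs with hk
  · exact (tendsto_longComb α hv h).limUnder_eq
  · exact longComb_eq_iteratedDeriv (fun h0 => hk ((cos_two_pi_mul_eq_zero_iff α).1 h0)) hv h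

theorem tendsto_longComb_longY (α : ℂ) {v : ℂ} (hv : v ∈ slitDisc) :
    Tendsto (fun a => longComb a v) (𝓝[≠] α) (𝓝 (longY α v)) := by
  obtain ⟨n, hn⟩ := exists_nat_gt (2 * α.re + 1)
  have h : α.re - (n : ℝ) / 2 < -(1 / 2) := by linarith
  rw [longY_eq_iteratedDeriv hv h]
  exact tendsto_longComb α hv h

/-- For `s = L/N` and order `M` the parameter `(M - s)/2` is `α`: this is how the coefficient
functions enter the expansion. -/
theorem iteratedDeriv_normPeriod_eq_longY {s : ℂ} (hs : 0 < s.re) (M : ℕ) {v : ℂ}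
    (hv : v ∈ slitDisc) :
    iteratedDeriv M (normPeriod s) v = (-2) ^ M * longY ((M - s) / 2) v := by
  have hE := slitDisc_subset hv
  -- The formula for `longY` needs a period exponent of real part above `1`; two additional
  -- derivatives achieve this from any `s` with positive real part.
  rw [longY_eq_iteratedDeriv (n := M + 2) hv (by simp; linarith),
    show ((M + 2 : ℕ) : ℂ) - 2 * ((M - s) / 2) = s + 2 by push_cast; ring,
    iteratedDeriv_succ_normPeriod (by simp; linarith) hE,
    iteratedDeriv_succ_normPeriod (by simp; linarith) hE,
    show s + 2 - 1 - 1 = s by ring, pow_add, ← mul_assoc, ← mul_assoc, ← mul_assoc, ← mul_assoc,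
    ← mul_pow]
  norm_num

/-! ### Comparison with the expansion around the symmetric point -/

/-- The Taylor expansion at `v = 1`, that is `u = 0`, with the derivatives of the period known
there. It holds for all `α`, since `1/Γ` is entire. -/
theorem hasSum_longY (α : ℂ) {u : ℂ} (hu : ‖u‖ < 1) :
    HasSum (fun k : ℕ => (2 * u) ^ k / (k.factorial : ℂ) *
      (Real.pi ^ 2 * ((Complex.Gamma (1 - α - k / 2))⁻¹) ^ 2)) (longY α (1 - u)) := by
  have hball : Metric.ball (1 : ℂ) 1 ⊆ slitDisc := fun w hw => by
    rw [mem_ball_iff_norm] at hw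
    refine ⟨?_, ?_⟩
    · rw [Complex.mem_slitPlane_iff]
      left
      have := (Complex.abs_re_le_norm (w - 1)).trans_lt hw
      rw [Complex.sub_re, Complex.one_re, abs_lt] at this
      linarith [this.1]
    · calc ‖w‖ = ‖w - 1 + 1‖ := by rw [sub_add_cancel]
        _ ≤ ‖w - 1‖ + ‖(1 : ℂ)‖ := norm_add_le _ _
        _ < 2 := by rw [norm_one]; linarith
  obtain ⟨n, hn⟩ := exists_nat_gt (2 * α.re + 1)
  have h : α.re - (n : ℝ) / 2 < -(1 / 2) := by linarith
  have hp : 1 < (n - 2 * α).re := by simp; linarith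
  have hu' : 1 - u ∈ Metric.ball (1 : ℂ) 1 := by simpa [mem_ball_iff_norm] using hu
  rw [longY_eq_iteratedDeriv (hball hu') h]
  have hd : DifferentiableOn ℂ (iteratedDeriv n (normPeriod (n - 2 * α))) (Metric.ball 1 1) :=
    ((differentiableOn_normPeriod (by linarith)).iteratedDeriv isOpen_doubleSlitPlane n).mono
      (hball.trans slitDisc_subset)
  refine ((Complex.hasSum_taylorSeries_on_ball hd hu').mul_left _).congr_fun fun k => ?_
  have e : iteratedDeriv k (iteratedDeriv n (normPeriod (n - 2 * α))) 1 =
      iteratedDeriv (k + n) (normPeriod (n - 2 * α)) 1 := by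
    simp only [iteratedDeriv_eq_iterate, Function.iterate_add_apply]
  rw [e, iteratedDeriv_normPeriod_one hp,
    show 1 + ((n : ℂ) - 2 * α) / 2 - ((k + n : ℕ) : ℂ) / 2 = 1 - α - k / 2 by push_cast; ring,
    smul_eq_mul, smul_eq_mul, pow_add, show 1 - u - 1 = -1 * u by ring, mul_pow, mul_pow,
    show (-2 : ℂ) ^ k = (-1) ^ k * 2 ^ k by rw [← mul_pow]; norm_num]
  have e1 : (-(1 / 2) : ℂ) ^ n * (-2) ^ n = 1 := by rw [← mul_pow]; norm_num
  have e2 : (-1 : ℂ) ^ k * (-1) ^ k = 1 := by rw [← mul_pow]; norm_num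
  rw [div_eq_mul_inv]
  generalize (Real.pi : ℂ) ^ 2 * (Complex.Gamma (1 - α - k / 2))⁻¹ ^ 2 = g
  linear_combination (-((2 : ℂ) ^ k * u ^ k * ((k.factorial : ℂ))⁻¹ * g)) * e1 -
    ((2 : ℂ) ^ k * u ^ k * ((k.factorial : ℂ))⁻¹ * g) * (-(1 / 2) : ℂ) ^ n * (-2) ^ n * e2

theorem Gamma_add_nat {s : ℂ} (hs : ∀ n : ℕ, s + n ≠ 0) (n : ℕ) :
    Complex.Gamma (s + n) = (ascPochhammer ℂ n).eval s * Complex.Gamma s := by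
  induction n with
  | zero => simp
  | succ n ih =>
    rw [Nat.cast_succ, ← add_assoc, Complex.Gamma_add_one _ (hs n), ih, ascPochhammer_succ_eval]
    ring

/-- The reflection formula, squared so that the sign from shifting the sine by `m` half-periods is
lost, turns the Taylor coefficients into hypergeometric ones. -/
theorem inv_Gamma_one_sub_sub_nat {z : ℂ} (hz : ∀ n : ℕ, z + n ≠ 0) (m : ℕ) :
    (Real.pi : ℂ) ^ 2 * ((Complex.Gamma (1 - z - m))⁻¹) ^ 2 =
      Complex.sin (Real.pi * z) ^ 2 * Complex.Gamma z ^ 2 * (ascPochhammer ℂ m).eval z ^ 2 := by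
  have h := sin_mul_eq_inv_Gamma (z := z + m)
  have hg : Complex.Gamma (z + m) ≠ 0 := by
    refine Complex.Gamma_ne_zero fun k hk => hz (m + k) ?_
    push_cast
    linear_combination hk
  have hsin : Complex.sin (Real.pi * (z + m)) ^ 2 = Complex.sin (Real.pi * z) ^ 2 := by
    clear h hg
    induction m with
    | zero => simp
    | succ m ih =>
      rw [← ih, Nat.cast_succ, show Real.pi * (z + (m + 1)) = Real.pi * (z + m) + Real.pi by ring,
        Complex.sin_add_pi, neg_sq]
  have hπ : (Real.pi : ℂ) ≠ 0 := Complex.ofReal_ne_zero.2 Real.pi_ne_zero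
  rw [show 1 - (z + m) = 1 - z - m by ring] at h
  have h2 : Real.pi * (Complex.Gamma (1 - z - m))⁻¹ =
      Complex.sin (Real.pi * (z + m)) * Complex.Gamma (z + m) := by
    field_simp at h ⊢
    linear_combination h
  rw [← mul_pow, h2, mul_pow, hsin, Gamma_add_nat hz]
  ring

theorem four_pow_mul_factorial_mul_ascPochhammer_half (m : ℕ) :
    4 ^ m * (m.factorial : ℂ) * (ascPochhammer ℂ m).eval (1 / 2) = (2 * m).factorial := by
  induction m with
  | zero => simp
  | succ m ih =>
    rw [ascPochhammer_succ_eval, show 2 * (m + 1) = 2 * m + 1 + 1 by ring, Nat.factorial_succ,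
      Nat.factorial_succ, Nat.factorial_succ]
    push_cast
    linear_combination (2 * (m : ℂ) + 1) * (2 * m + 2) * ih

theorem four_pow_mul_factorial_mul_ascPochhammer_three_half (m : ℕ) :
    4 ^ m * (m.factorial : ℂ) * (ascPochhammer ℂ m).eval (3 / 2) = (2 * m + 1).factorial := by
  induction m with
  | zero => simp
  | succ m ih =>
    rw [ascPochhammer_succ_eval, show 2 * (m + 1) + 1 = 2 * m + 1 + 1 + 1 by ring,
      Nat.factorial_succ (2 * m + 1 + 1), Nat.factorial_succ (2 * m + 1), Nat.factorial_succ m]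
    push_cast
    linear_combination (2 * (m : ℂ) + 3) * (2 * m + 2) * ih

theorem norm_sq_lt_one {u : ℂ} (hu : ‖u‖ < 1) : ‖u ^ 2‖ < 1 := by
  rw [norm_pow]; exact pow_lt_one₀ (norm_nonneg _) hu two_ne_zero

/-- Even orders of the Taylor series give the `sin²` term and odd orders the `cos²` term. The
hypotheses keep `Γ(α)` and `Γ(α + 1/2)` away from their poles. -/
theorem swY_eq_longY {α u : ℂ} (h0 : ∀ n : ℕ, α + n ≠ 0) (h1 : ∀ n : ℕ, α + 1 / 2 + n ≠ 0)
    (hu : ‖u‖ < 1) : swY 1 α u = longY α (1 - u) := by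
  have hE := ((hasFPowerSeriesOnBall_ordinaryHypergeometric α α (1 / 2 : ℂ)).hasSum_ofScalars
    (norm_sq_lt_one hu)).mul_left (Complex.sin (Real.pi * α) ^ 2 * Complex.Gamma α ^ 2)
  have hO := ((hasFPowerSeriesOnBall_ordinaryHypergeometric (α + 1 / 2) (α + 1 / 2)
    (3 / 2 : ℂ)).hasSum_ofScalars (norm_sq_lt_one hu)).mul_left
    (2 * u * 1 * Complex.cos (Real.pi * α) ^ 2 * Complex.Gamma (α + 1 / 2) ^ 2)
  rw [swY, add_comm]
  refine HasSum.unique (f := fun k : ℕ => (2 * u) ^ k / (k.factorial : ℂ) *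
      (Real.pi ^ 2 * ((Complex.Gamma (1 - α - k / 2))⁻¹) ^ 2))
    (HasSum.even_add_odd (hE.congr_fun fun m => ?_) (hO.congr_fun fun m => ?_)) (hasSum_longY α hu)
  · have hf := four_pow_mul_factorial_mul_ascPochhammer_half m
    have hne : (4 : ℂ) ^ m * (m.factorial : ℂ) * (ascPochhammer ℂ m).eval (1 / 2) ≠ 0 := by
      rw [hf]; exact Nat.cast_ne_zero.2 (Nat.factorial_ne_zero _)
    rw [show 1 - α - ((2 * m : ℕ) : ℂ) / 2 = 1 - α - m by push_cast; ring,
      inv_Gamma_one_sub_sub_nat h0, ← hf, mul_pow, pow_mul, pow_mul]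
    have n1 := left_ne_zero_of_mul (left_ne_zero_of_mul hne)
    have n2 := right_ne_zero_of_mul (left_ne_zero_of_mul hne)
    have n3 := right_ne_zero_of_mul hne
    simp only [ordinaryHypergeometricCoefficient]
    rw [show (2 : ℂ) ^ 2 = 4 by norm_num]
    generalize (ascPochhammer ℂ m).eval (1 / 2) = X at *
    field_simp
  · have hf := four_pow_mul_factorial_mul_ascPochhammer_three_half m
    have hne : (4 : ℂ) ^ m * (m.factorial : ℂ) * (ascPochhammer ℂ m).eval (3 / 2) ≠ 0 := by
      rw [hf]; exact Nat.cast_ne_zero.2 (Nat.factorial_ne_zero _)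
    rw [show 1 - α - ((2 * m + 1 : ℕ) : ℂ) / 2 = 1 - (α + 1 / 2) - m by push_cast; ring,
      inv_Gamma_one_sub_sub_nat h1, ← hf, pow_succ, mul_pow, pow_mul, pow_mul,
      show Real.pi * (α + 1 / 2) = Real.pi * α + Real.pi / 2 by ring, Complex.sin_add_pi_div_two]
    have n1 := left_ne_zero_of_mul (left_ne_zero_of_mul hne)
    have n2 := right_ne_zero_of_mul (left_ne_zero_of_mul hne)
    have n3 := right_ne_zero_of_mul hne
    simp only [ordinaryHypergeometricCoefficient]
    rw [show (2 : ℂ) ^ 2 = 4 by norm_num]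
    generalize (ascPochhammer ℂ m).eval (3 / 2) = X at *
    field_simp

theorem wtL_le {N : ℕ} (l : Fin (N - 2) → ℕ) : wtL l ≤ 1 + (N - 2) * wtM l := by
  unfold wtL wtM
  rw [Finset.mul_sum]
  gcongr with j _
  have := j.2
  omega

/-- For `M = 0` one has `L = 1`, not a multiple of `N`; for `M ≥ 1` one has `L ≤ 1 + (N - 2) M < N
M`. Hence `α + k/2` never vanishes, and `swY` has no pole at the values of `α` that occur. -/
theorem wtL_ne {N : ℕ} (hN : 3 ≤ N) (l : Fin (N - 2) → ℕ) (k : ℕ) : wtL l ≠ N * (wtM l + k) := by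
  intro h
  have hle := wtL_le l
  rcases Nat.eq_zero_or_pos (wtM l) with h0 | h0
  · have h1 : wtL l = 1 := by
      rw [h0] at hle
      unfold wtL at hle ⊢
      omega
    rw [h1] at h
    have := Nat.eq_one_of_mul_eq_one_right h.symm
    omega
  · obtain ⟨m, rfl⟩ : ∃ m, N = m + 3 := ⟨N - 3, by omega⟩
    have h2 : m + 3 - 2 = m + 1 := by omega
    rw [h2] at hle
    nlinarith [Nat.zero_le ((m + 3) * k)]

theorem wtAlpha_add_ne_zero {N : ℕ} (hN : 3 ≤ N) (l : Fin (N - 2) → ℕ) (k : ℕ) :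
    wtAlpha l + k / 2 ≠ 0 := by
  intro h
  refine wtL_ne hN l k ?_
  have hN0 : (N : ℂ) ≠ 0 := Nat.cast_ne_zero.2 (by omega)
  unfold wtAlpha at h
  field_simp at h
  have : (wtL l : ℂ) = ((N * (wtM l + k) : ℕ) : ℂ) := by
    push_cast
    linear_combination -h
  exact_mod_cast this

theorem swY_wtAlpha_eq_longY {N : ℕ} (hN : 3 ≤ N) (l : Fin (N - 2) → ℕ) {v : ℂ}
    (hv : ‖1 - v‖ < 1) : swY 1 (wtAlpha l) (1 - v) = longY (wtAlpha l) v := by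
  rw [swY_eq_longY (fun n => ?_) (fun n => ?_) hv, sub_sub_cancel]
  · have := wtAlpha_add_ne_zero hN l (2 * n)
    push_cast at this
    rwa [mul_div_cancel_left₀ _ two_ne_zero] at this
  · have := wtAlpha_add_ne_zero hN l (2 * n + 1)
    push_cast at this
    rw [show wtAlpha l + 1 / 2 + n = wtAlpha l + (2 * n + 1) / 2 by ring]
    exact this

/-! ### A branch of the inverse cosine -/

theorem cpow_half_sq (z : ℂ) : (z ^ (1 / 2 : ℂ)) ^ 2 = z := by
  have := Complex.cpow_nat_inv_pow z two_ne_zero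
  rwa [Nat.cast_ofNat, ← one_div] at this

theorem cpow_half_re_pos {z : ℂ} (hz : z ∈ Complex.slitPlane) : 0 < (z ^ (1 / 2 : ℂ)).re := by
  rw [one_div, Complex.cpow_inv_two_re]
  refine Real.sqrt_pos.2 (half_pos ?_)
  rcases Complex.mem_slitPlane_iff.1 hz with h | h
  · have := norm_nonneg z
    linarith
  · have := Complex.abs_re_lt_norm.2 h
    have := neg_abs_le z.re
    linarith

/-- A branch of the inverse cosine. -/
noncomputable def arccosBranch (A : ℂ) : ℂ :=
  -2 * Complex.I * Complex.log ((1 + A) ^ (1 / 2 : ℂ) + Complex.I * (1 - A) ^ (1 / 2 : ℂ)) +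
    Complex.I * Complex.log 2

/-- With `A = cos φ` the two factors stand for `√2 e^{iφ/2}` and `√2 e^{-iφ/2}`, which explains the
half angles and the `log 2` in `arccosBranch`. -/
theorem add_I_mul_sqrt_mul_sub (A : ℂ) :
    ((1 + A) ^ (1 / 2 : ℂ) + Complex.I * (1 - A) ^ (1 / 2 : ℂ)) *
      ((1 + A) ^ (1 / 2 : ℂ) - Complex.I * (1 - A) ^ (1 / 2 : ℂ)) = 2 := by
  linear_combination cpow_half_sq (1 + A) + cpow_half_sq (1 - A) -
    ((1 - A) ^ (1 / 2 : ℂ)) ^ 2 * Complex.I_sq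

/-- If `w = p + i q` were real and nonpositive, `w (2p - w) = 2` would have nonpositive real part,
because `Re p > 0`. -/
theorem add_I_mul_sqrt_mem_slitPlane {A : ℂ} (hA : 1 + A ∈ Complex.slitPlane) :
    (1 + A) ^ (1 / 2 : ℂ) + Complex.I * (1 - A) ^ (1 / 2 : ℂ) ∈ Complex.slitPlane := by
  have hp := cpow_half_re_pos hA
  have hm := add_I_mul_sqrt_mul_sub A
  set p := (1 + A) ^ (1 / 2 : ℂ)
  set q := (1 - A) ^ (1 / 2 : ℂ)
  by_contra h
  rw [Complex.mem_slitPlane_iff, not_or, not_lt, not_not] at h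
  have h1 := congrArg Complex.re hm
  rw [Complex.mul_re, h.2, zero_mul, sub_zero, show p - Complex.I * q = 2 * p - (p + Complex.I * q) by
    ring, Complex.sub_re, Complex.mul_re] at h1
  norm_num at h1
  simp only [Complex.add_re, Complex.mul_re, Complex.I_re, Complex.I_im] at h h1
  nlinarith [h.1]

theorem hasDerivAt_arccosBranch {A : ℂ} (h1 : 1 + A ∈ Complex.slitPlane)
    (h2 : 1 - A ∈ Complex.slitPlane) :
    HasDerivAt arccosBranch (-((1 - A) ^ (1 / 2 : ℂ) * (1 + A) ^ (1 / 2 : ℂ))⁻¹) A := by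
  have d1 := ((hasDerivAt_id A).const_add 1).cpow_const (c := 1 / 2) h1
  have d2 := ((hasDerivAt_id A).const_sub 1).cpow_const (c := 1 / 2) h2
  have hs := add_I_mul_sqrt_mem_slitPlane h1
  have h := (((d1.add (d2.const_mul Complex.I)).clog hs).const_mul (-2 * Complex.I)).add_const
    (Complex.I * Complex.log 2)
  refine h.congr_deriv ?_
  have hne := Complex.slitPlane_ne_zero hs
  have e1 : (1 + A) ^ (1 / 2 - 1 : ℂ) = ((1 + A) ^ (1 / 2 : ℂ))⁻¹ := by
    rw [show (1 / 2 - 1 : ℂ) = -(1 / 2) by norm_num, Complex.cpow_neg]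
  have e2 : (1 - A) ^ (1 / 2 - 1 : ℂ) = ((1 - A) ^ (1 / 2 : ℂ))⁻¹ := by
    rw [show (1 / 2 - 1 : ℂ) = -(1 / 2) by norm_num, Complex.cpow_neg]
  have n1 : (1 + A) ^ (1 / 2 : ℂ) ≠ 0 := by
    rw [Complex.cpow_ne_zero_iff_of_exponent_ne_zero (by norm_num)]
    exact Complex.slitPlane_ne_zero h1
  have n2 : (1 - A) ^ (1 / 2 : ℂ) ≠ 0 := by
    rw [Complex.cpow_ne_zero_iff_of_exponent_ne_zero (by norm_num)]
    exact Complex.slitPlane_ne_zero h2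
  simp only [id, Pi.add_apply] at hne ⊢
  rw [e1, e2]
  generalize (1 + A) ^ (1 / 2 : ℂ) = p at *
  generalize (1 - A) ^ (1 / 2 : ℂ) = q at *
  field_simp
  linear_combination (p : ℂ) * Complex.I_sq

/-- The argument of the logarithm and its conjugate factor are bounded and have product `2`, so the
argument is also bounded away from `0`. This uniform bound dominates all later integrals. -/
theorem norm_arccosBranch_le {A : ℂ} (hA : ‖A‖ ≤ 10) : ‖arccosBranch A‖ ≤ 25 := by
  have hm := add_I_mul_sqrt_mul_sub A
  have b1 : ‖(1 + A) ^ (1 / 2 : ℂ)‖ ≤ 4 := by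
    refine (sq_le_sq₀ (norm_nonneg _) (by norm_num)).1 ?_
    rw [← norm_pow, cpow_half_sq]
    refine (norm_add_le _ _).trans ?_
    rw [norm_one]; linarith
  have b2 : ‖(1 - A) ^ (1 / 2 : ℂ)‖ ≤ 4 := by
    refine (sq_le_sq₀ (norm_nonneg _) (by norm_num)).1 ?_
    rw [← norm_pow, cpow_half_sq]
    refine (norm_sub_le _ _).trans ?_
    rw [norm_one]; linarith
  unfold arccosBranch
  set p := (1 + A) ^ (1 / 2 : ℂ)
  set q := (1 - A) ^ (1 / 2 : ℂ)
  have c1 : ‖p + Complex.I * q‖ ≤ 8 := by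
    refine (norm_add_le _ _).trans ?_
    rw [norm_mul, Complex.norm_I]; linarith
  have c2 : ‖p - Complex.I * q‖ ≤ 8 := by
    refine (norm_sub_le _ _).trans ?_
    rw [norm_mul, Complex.norm_I]; linarith
  have c3 : ‖p + Complex.I * q‖ * ‖p - Complex.I * q‖ = 2 := by
    rw [← norm_mul, hm, Complex.norm_ofNat]
  have c4 : 0 < ‖p + Complex.I * q‖ := by
    refine lt_of_le_of_ne (norm_nonneg _) fun h => ?_
    rw [← h, zero_mul] at c3
    norm_num at c3
  have c5 : ‖p + Complex.I * q‖⁻¹ ≤ 4 := by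
    rw [inv_le_comm₀ c4 (by norm_num)]
    nlinarith
  have l1 := Real.log_le_sub_one_of_pos c4
  have l2 := Real.log_le_sub_one_of_pos (inv_pos.2 c4)
  rw [Real.log_inv] at l2
  have l3 : |Real.log ‖p + Complex.I * q‖| ≤ 7 := abs_le.2 ⟨by linarith, by linarith⟩
  have l4 : ‖Complex.log (p + Complex.I * q)‖ ≤ 7 + Real.pi := by
    refine (Complex.norm_le_abs_re_add_abs_im _).trans ?_
    rw [Complex.log_re, Complex.log_im]
    exact add_le_add l3 (Complex.abs_arg_le_pi _)
  have l5 : ‖Complex.log 2‖ ≤ 1 := by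
    rw [show (2 : ℂ) = ((2 : ℝ) : ℂ) by norm_num, ← Complex.ofReal_log (by norm_num),
      Complex.norm_real, Real.norm_of_nonneg (Real.log_nonneg (by norm_num))]
    have := Real.log_two_lt_d9
    linarith
  have hπ := Real.pi_lt_d2
  calc _ ≤ ‖-2 * Complex.I * Complex.log (p + Complex.I * q)‖ + ‖Complex.I * Complex.log 2‖ :=
        norm_add_le _ _
    _ = 2 * ‖Complex.log (p + Complex.I * q)‖ + ‖Complex.log 2‖ := by simp
    _ ≤ 25 := by linarith

/-- Includes `A = 1`, the value at the branch point, where the derivative does not exist. -/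
theorem continuousAt_arccosBranch {A : ℂ} (h1 : 1 + A ∈ Complex.slitPlane) (h2 : 0 ≤ (1 - A).re) :
    ContinuousAt arccosBranch A := by
  have c1 : ContinuousAt (fun A : ℂ => (1 + A) ^ (1 / 2 : ℂ)) A :=
    (((hasDerivAt_id A).const_add 1).cpow_const h1).continuousAt
  have c2 : ContinuousAt (fun A : ℂ => (1 - A) ^ (1 / 2 : ℂ)) A :=
    ContinuousAt.comp (f := fun A : ℂ => 1 - A)
      (Complex.continuousAt_cpow_const_of_re_pos (Or.inl h2) (by norm_num)) (by fun_prop)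
  have hs := add_I_mul_sqrt_mem_slitPlane h1
  exact (((c1.add (c2.const_mul Complex.I)).clog hs).const_mul (-2 * Complex.I)).add
    continuousAt_const

theorem arccosBranch_one : arccosBranch 1 = 0 := by
  unfold arccosBranch
  rw [sub_self, Complex.zero_cpow (by norm_num), mul_zero, add_zero, one_add_one_eq_two]
  have : Complex.log ((2 : ℂ) ^ (1 / 2 : ℂ)) = 1 / 2 * Complex.log 2 := by
    have h2 : (2 : ℂ) = ((2 : ℝ) : ℂ) := by norm_num
    rw [h2, ofReal_cpow_eq_exp two_pos, ← Complex.ofReal_log two_pos.le,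
      show (Real.log 2 : ℂ) * (1 / ((2 : ℝ) : ℂ)) = ((Real.log 2 * (1 / 2) : ℝ) : ℂ) by push_cast; ring,
      Complex.log_exp (by rw [Complex.ofReal_im]; linarith [Real.pi_pos])
        (by rw [Complex.ofReal_im]; exact Real.pi_pos.le)]
    push_cast
    ring
  rw [this]
  ring

/-! ### The perturbed root and the position of `A` along the ray to it -/

/-- Implicit differentiation along a one-parameter family. Continuity of the solution suffices: the
difference quotient of `P` along `z` tends to `P'`, and the fixed point equation can be solved for
the quotient of `z`. -/
theorem hasDerivAt_fixedPoint {P c τ z : ℂ → ℂ} {c' τ' μ : ℂ} (hP : DifferentiableAt ℂ P (z μ))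
    (hc : HasDerivAt c c' μ) (hτ : HasDerivAt τ τ' μ) (hz : ContinuousAt z μ)
    (hfix : ∀ᶠ x in 𝓝 μ, z x = c x + τ x * P (z x)) (hne : 1 - τ μ * deriv P (z μ) ≠ 0) :
    HasDerivAt z ((c' + τ' * P (z μ)) / (1 - τ μ * deriv P (z μ))) μ := by
  rw [hasDerivAt_iff_tendsto_slope] at *
  have hz' : Tendsto z (𝓝[≠] μ) (𝓝 (z μ)) := hz.tendsto.mono_left nhdsWithin_le_nhds
  have t1 : Tendsto (fun x => P (z x)) (𝓝[≠] μ) (𝓝 (P (z μ))) :=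
    hP.continuousAt.tendsto.comp hz'
  have t2 : Tendsto (fun x => dslope P (z μ) (z x)) (𝓝[≠] μ) (𝓝 (deriv P (z μ))) := by
    have := (continuousAt_dslope_same.2 hP).tendsto.comp hz'
    rwa [dslope_same] at this
  have t3 : Tendsto (fun x => 1 - τ μ * dslope P (z μ) (z x)) (𝓝[≠] μ)
      (𝓝 (1 - τ μ * deriv P (z μ))) := (t2.const_mul _).const_sub 1
  refine ((hc.add (hτ.mul t1)).div t3 hne).congr' ?_
  filter_upwards [t3.eventually_ne hne, hfix.filter_mono nhdsWithin_le_nhds,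
    self_mem_nhdsWithin] with x hx h1 h2
  have h0 := hfix.self_of_nhds
  have h3 := sub_smul_dslope P (z μ) (z x)
  have h4 : x - μ ≠ 0 := sub_ne_zero.2 h2
  simp only [Pi.div_apply, slope_def_field, smul_eq_mul] at h3 ⊢
  rw [div_eq_iff hx]
  field_simp
  linear_combination (1 : ℂ) * h0 - h1 + τ μ * h3

/-- The open sector of opening `π / 2` around the positive real axis. -/
def rightSector : Set ℂ := {z | |z.im| < z.re}

theorem isOpen_rightSector : IsOpen rightSector :=
  isOpen_lt (by fun_prop) (by fun_prop)

theorem mul_ofReal_mem_rightSector {z : ℂ} (hz : z ∈ rightSector) {t : ℝ} (ht : 0 < t) :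
    z * t ∈ rightSector := by
  simp only [rightSector, Set.mem_ofPred_eq, Complex.mul_re, Complex.mul_im, Complex.ofReal_re,
    Complex.ofReal_im, mul_zero, sub_zero, zero_add, abs_mul, abs_of_pos ht] at hz ⊢
  nlinarith

theorem rightSector_subset_slitPlane : rightSector ⊆ Complex.slitPlane := fun z hz => by
  rw [Complex.mem_slitPlane_iff]
  exact Or.inl ((abs_nonneg z.im).trans_lt hz)

/-- The distance from `2` to the boundary of the sector is `√2 > 5/4`. -/
theorem mem_rightSector_of_norm_sub_two_le {z : ℂ} (hz : ‖z - 2‖ ≤ 5 / 4) : z ∈ rightSector := by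
  have h1 : ‖z - 2‖ ^ 2 ≤ (5 / 4) ^ 2 := pow_le_pow_left₀ (norm_nonneg _) hz 2
  rw [← Complex.normSq_eq_norm_sq, Complex.normSq_apply] at h1
  simp only [Complex.sub_re, Complex.sub_im, Complex.re_ofNat, Complex.im_ofNat, sub_zero] at h1
  change |z.im| < z.re
  rw [abs_lt]
  constructor <;> nlinarith [sq_nonneg (z.re - 2 - z.im), sq_nonneg (z.re - 2 + z.im)]

/-- `P` is holomorphic and small relative to `‖v₀‖ + ‖z‖`, and `v₀` is away from the cut. -/
structure IsSmallPerturbation (κ : ℝ) (v₀ : ℂ) (P : ℂ → ℂ) : Prop where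
  pos : 0 < κ
  le_one : κ ≤ 1
  ne_zero : v₀ ≠ 0
  norm_lt : ‖v₀‖ < 1 / 4
  angle : v₀.re < 0 → κ * ‖v₀‖ ≤ |v₀.im|
  diff : DifferentiableOn ℂ P rightSector
  norm_le : ∀ z ∈ rightSector, ‖P z‖ ≤ κ / 200 * (‖v₀‖ + ‖z‖)

/-- For `t ≥ 3|v₀|/4` the term `2t` makes the real part positive. For smaller `t` the error is a
small multiple of `κ|v₀|`: either `|Im v₀|` is at least `κ|v₀|/2` and the imaginary part survives,
or `Re v₀ > |v₀|/2` and the real part does. The error may grow like `|v₀| + t`, which is the growth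
allowed for `P`. -/
theorem mem_slitPlane_of_angle {κ : ℝ} {v₀ e : ℂ} {t : ℝ} (hκ : 0 < κ) (hκ1 : κ ≤ 1)
    (h0 : v₀ ≠ 0) (hv : ‖v₀‖ < 1 / 4) (ha : v₀.re < 0 → κ * ‖v₀‖ ≤ |v₀.im|) (ht : 0 ≤ t)
    (he : ‖e‖ ≤ κ / 10 * (‖v₀‖ + t)) : (1 - t) * v₀ + 2 * t + e ∈ Complex.slitPlane := by
  have hp : 0 < ‖v₀‖ := norm_pos_iff.2 h0
  have e1 := abs_le.1 ((Complex.abs_re_le_norm e).trans he)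
  have e2 := abs_le.1 ((Complex.abs_im_le_norm e).trans he)
  have r1 := abs_le.1 (Complex.abs_re_le_norm v₀)
  have hre : ((1 - t) * v₀ + 2 * t + e).re = (1 - t) * v₀.re + 2 * t + e.re := by simp
  have him : ((1 - t) * v₀ + 2 * t + e).im = (1 - t) * v₀.im + e.im := by simp
  rw [Complex.mem_slitPlane_iff, hre, him]
  rcases le_or_gt (3 / 4 * ‖v₀‖) t with h | h
  · left
    have : κ / 10 * (‖v₀‖ + t) ≤ 1 / 10 * (‖v₀‖ + t) := by gcongr
    have h2 : -(1 * ‖v₀‖) - t * ‖v₀‖ ≤ (1 - t) * v₀.re := by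
      rcases le_or_gt t 1 with h3 | h3 <;> nlinarith [r1.1, r1.2]
    nlinarith
  · have ht2 : 13 / 16 < 1 - t := by linarith
    have hb : κ / 10 * (‖v₀‖ + t) ≤ κ / 10 * (7 / 4 * ‖v₀‖) := by gcongr; linarith
    have hbκ : κ / 10 * (7 / 4 * ‖v₀‖) ≤ 1 / 10 * (7 / 4 * ‖v₀‖) := by gcongr
    have key : κ * ‖v₀‖ / 2 ≤ |v₀.im| → (1 - t) * v₀.im + e.im ≠ 0 := fun hi h3 => by
      have h4 : |(1 - t) * v₀.im| = |e.im| := by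
        rw [show (1 - t) * v₀.im = -e.im by linarith, abs_neg]
      rw [abs_mul, abs_of_pos (by linarith)] at h4
      have h5 := (Complex.abs_im_le_norm e).trans he
      have h6 : 0 < κ * ‖v₀‖ := mul_pos hκ hp
      nlinarith
    rcases lt_or_ge v₀.re 0 with h1 | h1
    · exact Or.inr (key (by linarith [ha h1, mul_pos hκ hp]))
    · rcases le_or_gt (‖v₀‖ / 2) |v₀.im| with h2 | h2
      · refine Or.inr (key (le_trans ?_ h2))
        nlinarith
      · left
        have h3 := Complex.norm_le_abs_re_add_abs_im v₀
        rw [abs_of_nonneg h1] at h3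
        nlinarith

/-- The root near `2` of the perturbed equation `z = 2 - v + τ P(z)`. -/
noncomputable def perturbedRoot (P : ℂ → ℂ) (τ v : ℂ) : ℂ :=
  Classical.epsilon fun z => ‖z - 2‖ ≤ 1 / 2 ∧ z = 2 - v + τ * P z

/-- The perturbed polynomial in the coordinate `z = x ^ N`. -/
def perturbedA (P : ℂ → ℂ) (τ v z : ℂ) : ℂ := z - 1 + v - τ * P z

namespace IsSmallPerturbation

variable {κ : ℝ} {v₀ : ℂ} {P : ℂ → ℂ}

theorem norm_le_of_mem (h : IsSmallPerturbation κ v₀ P) {z : ℂ} (hz : ‖z - 2‖ ≤ 5 / 4) :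
    ‖P z‖ ≤ 7 * κ / 400 := by
  have h2 : ‖z‖ ≤ 13 / 4 := by
    calc ‖z‖ = ‖z - 2 + 2‖ := by rw [sub_add_cancel]
      _ ≤ ‖z - 2‖ + ‖(2 : ℂ)‖ := norm_add_le _ _
      _ ≤ 13 / 4 := by rw [Complex.norm_ofNat]; linarith
  have := h.norm_le z (mem_rightSector_of_norm_sub_two_le hz)
  nlinarith [h.pos, h.norm_lt]

/-- Cauchy's estimate on discs of radius `1/4`, which stay within distance `5/4` of `2`. -/
theorem norm_deriv_le (h : IsSmallPerturbation κ v₀ P) {z : ℂ} (hz : ‖z - 2‖ ≤ 1) :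
    ‖deriv P z‖ ≤ 7 * κ / 100 := by
  have hsub : ∀ w ∈ Metric.closedBall z (1 / 4), ‖w - 2‖ ≤ 5 / 4 := fun w hw => by
    rw [mem_closedBall_iff_norm] at hw
    calc ‖w - 2‖ = ‖(w - z) + (z - 2)‖ := by rw [sub_add_sub_cancel]
      _ ≤ ‖w - z‖ + ‖z - 2‖ := norm_add_le _ _
      _ ≤ 5 / 4 := by linarith
  have hd : DiffContOnCl ℂ P (Metric.ball z (1 / 4)) := by
    refine DifferentiableOn.diffContOnCl ?_
    rw [closure_ball z (by norm_num)]
    exact h.diff.mono fun w hw => mem_rightSector_of_norm_sub_two_le (hsub w hw)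
  have := Complex.norm_deriv_le_of_forall_mem_sphere_norm_le (by norm_num) hd
    (C := 7 * κ / 400) fun w hw => h.norm_le_of_mem (hsub w (Metric.sphere_subset_closedBall hw))
  linarith

theorem differentiableAt (h : IsSmallPerturbation κ v₀ P) {z : ℂ} (hz : z ∈ rightSector) :
    DifferentiableAt ℂ P z := h.diff.differentiableAt (isOpen_rightSector.mem_nhds hz)

theorem norm_sub_le (h : IsSmallPerturbation κ v₀ P) {x y : ℂ} (hx : ‖x - 2‖ ≤ 1)
    (hy : ‖y - 2‖ ≤ 1) : ‖P x - P y‖ ≤ 7 * κ / 100 * ‖x - y‖ := by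
  refine (convex_closedBall (2 : ℂ) 1).norm_image_sub_le_of_norm_deriv_le (𝕜 := ℂ) (fun z hz => ?_)
    (fun z hz => ?_) (mem_closedBall_iff_norm.2 hy)
    (mem_closedBall_iff_norm.2 hx)
  all_goals rw [mem_closedBall_iff_norm] at hz
  · exact h.differentiableAt (mem_rightSector_of_norm_sub_two_le (by linarith))
  · exact h.norm_deriv_le hz

theorem norm_lt_of_sub_lt (h : IsSmallPerturbation κ v₀ P) {v : ℂ}
    (hv : ‖v - v₀‖ < κ / 200 * ‖v₀‖) : ‖v‖ < 3 / 10 := by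
  have h1 := h.norm_lt
  have h2 := h.le_one
  have h3 := h.pos
  have h4 : 0 ≤ ‖v₀‖ := norm_nonneg _
  calc ‖v‖ = ‖v - v₀ + v₀‖ := by rw [sub_add_cancel]
    _ ≤ ‖v - v₀‖ + ‖v₀‖ := norm_add_le _ _
    _ < 3 / 10 := by nlinarith

/-- Banach's fixed point theorem on the disc of radius `1/2` about `2`. Allowing `|τ| < 2` leaves
room for Taylor expansion at `0` with value at `1`. -/
theorem exists_root (h : IsSmallPerturbation κ v₀ P) {τ v : ℂ} (hτ : ‖τ‖ < 2)
    (hv : ‖v - v₀‖ < κ / 200 * ‖v₀‖) : ∃ z, ‖z - 2‖ ≤ 1 / 2 ∧ z = 2 - v + τ * P z := by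
  have hv' := h.norm_lt_of_sub_lt hv
  have hκ := h.pos
  have hκ1 := h.le_one
  have hmaps : Set.MapsTo (fun z => 2 - v + τ * P z) (Metric.closedBall (2 : ℂ) (1 / 2))
      (Metric.closedBall 2 (1 / 2)) := fun z hz => by
    rw [mem_closedBall_iff_norm] at hz ⊢
    have h1 := h.norm_le_of_mem (z := z) (by linarith)
    calc ‖2 - v + τ * P z - 2‖ = ‖τ * P z - v‖ := by congr 1; ring
      _ ≤ ‖τ * P z‖ + ‖v‖ := _root_.norm_sub_le _ _
      _ ≤ 1 / 2 := by rw [norm_mul]; nlinarith [norm_nonneg τ, norm_nonneg (P z)]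
  have hlip : LipschitzOnWith (1 / 2) (fun z => 2 - v + τ * P z)
      (Metric.closedBall (2 : ℂ) (1 / 2)) := by
    refine LipschitzOnWith.of_dist_le_mul fun x hx y hy => ?_
    rw [mem_closedBall_iff_norm] at hx hy
    have h1 := h.norm_sub_le (x := x) (y := y) (by linarith) (by linarith)
    rw [dist_eq_norm, dist_eq_norm, show 2 - v + τ * P x - (2 - v + τ * P y) = τ * (P x - P y) by
      ring, norm_mul]
    have h2 := norm_nonneg (x - y)
    have h3 : ‖τ‖ * ‖P x - P y‖ ≤ 2 * (7 * κ / 100 * ‖x - y‖) := by gcongr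
    have h4 : κ * ‖x - y‖ ≤ 1 * ‖x - y‖ := by gcongr
    push_cast
    linarith
  obtain ⟨z, hz, hfix, -⟩ := ContractingWith.exists_fixedPoint'
    (Metric.isClosed_closedBall.isComplete) hmaps
    ⟨by norm_num, hlip.mapsToRestrict hmaps⟩ (x := 2) (by simp) (edist_ne_top _ _)
  rw [mem_closedBall_iff_norm] at hz
  exact ⟨z, hz, hfix.symm⟩

theorem root_spec (h : IsSmallPerturbation κ v₀ P) {τ v : ℂ} (hτ : ‖τ‖ < 2)
    (hv : ‖v - v₀‖ < κ / 200 * ‖v₀‖) : ‖perturbedRoot P τ v - 2‖ ≤ 1 / 2 ∧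
      perturbedRoot P τ v = 2 - v + τ * P (perturbedRoot P τ v) :=
  Classical.epsilon_spec (h.exists_root hτ hv)

/-- The contraction also controls how the root chosen by `Classical.epsilon` moves; this continuity
is all that the implicit differentiation requires. -/
theorem norm_root_sub_le (h : IsSmallPerturbation κ v₀ P) {τ v τ' v' : ℂ} (hτ : ‖τ‖ < 2)
    (hv : ‖v - v₀‖ < κ / 200 * ‖v₀‖) (hτ' : ‖τ'‖ < 2) (hv' : ‖v' - v₀‖ < κ / 200 * ‖v₀‖) :
    ‖perturbedRoot P τ v - perturbedRoot P τ' v'‖ ≤ 2 * (‖v - v'‖ + ‖τ - τ'‖) := by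
  obtain ⟨a1, a2⟩ := h.root_spec hτ hv
  obtain ⟨b1, b2⟩ := h.root_spec hτ' hv'
  set z := perturbedRoot P τ v
  set w := perturbedRoot P τ' v'
  have h1 := h.norm_sub_le (x := z) (y := w) (by linarith) (by linarith)
  have h2 := h.norm_le_of_mem (z := z) (by linarith)
  have hκ1 := h.le_one
  have h3 : ‖z - w‖ ≤ ‖v - v'‖ + ‖τ - τ'‖ * ‖P z‖ + ‖τ'‖ * ‖P z - P w‖ := by
    calc ‖z - w‖ = ‖(τ - τ') * P z - (v - v') + τ' * (P z - P w)‖ := by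
          congr 1; linear_combination a2 - b2
      _ ≤ ‖(τ - τ') * P z - (v - v')‖ + ‖τ' * (P z - P w)‖ := norm_add_le _ _
      _ ≤ ‖(τ - τ') * P z‖ + ‖v - v'‖ + ‖τ' * (P z - P w)‖ := by
          gcongr; exact _root_.norm_sub_le _ _
      _ = _ := by rw [norm_mul, norm_mul]; ring
  have h4 : ‖τ'‖ * ‖P z - P w‖ ≤ 2 * (7 * κ / 100 * ‖z - w‖) := by gcongr
  have h5 : κ * ‖z - w‖ ≤ 1 * ‖z - w‖ := by gcongr
  have h6 : ‖τ - τ'‖ * ‖P z‖ ≤ ‖τ - τ'‖ * 1 := by gcongr; linarith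
  have h7 := norm_nonneg (v - v')
  have h8 := norm_nonneg (τ - τ')
  linarith

theorem one_sub_mul_deriv_ne_zero (h : IsSmallPerturbation κ v₀ P) {τ z : ℂ} (hτ : ‖τ‖ < 2)
    (hz : ‖z - 2‖ ≤ 1) : 1 - τ * deriv P z ≠ 0 := fun h0 => by
  have h1 := h.norm_deriv_le hz
  have h2 : ‖τ * deriv P z‖ = 1 := by rw [← sub_eq_zero.1 h0, norm_one]
  rw [norm_mul] at h2
  nlinarith [h.le_one, norm_nonneg τ, norm_nonneg (deriv P z)]

theorem hasDerivAt_root (h : IsSmallPerturbation κ v₀ P) {τ v : ℂ → ℂ} {τ' v' μ : ℂ}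
    (hτ : ‖τ μ‖ < 2) (hv : ‖v μ - v₀‖ < κ / 200 * ‖v₀‖) (dτ : HasDerivAt τ τ' μ)
    (dv : HasDerivAt v v' μ) :
    HasDerivAt (fun x => perturbedRoot P (τ x) (v x))
      ((-v' + τ' * P (perturbedRoot P (τ μ) (v μ))) /
        (1 - τ μ * deriv P (perturbedRoot P (τ μ) (v μ)))) μ := by
  have hs := (h.root_spec hτ hv).1
  have ev : ∀ᶠ x in 𝓝 μ, ‖τ x‖ < 2 ∧ ‖v x - v₀‖ < κ / 200 * ‖v₀‖ :=
    (dτ.continuousAt.norm.eventually (gt_mem_nhds hτ)).and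
      ((dv.continuousAt.sub_const v₀).norm.eventually (gt_mem_nhds hv))
  refine hasDerivAt_fixedPoint (c := fun x => 2 - v x)
    (h.differentiableAt (mem_rightSector_of_norm_sub_two_le (by linarith))) (dv.const_sub 2) dτ ?_
    (ev.mono fun x hx => (h.root_spec hx.1 hx.2).2) (h.one_sub_mul_deriv_ne_zero hτ (by linarith))
  have hg : Tendsto (fun x => 2 * (‖v x - v μ‖ + ‖τ x - τ μ‖)) (𝓝 μ) (𝓝 0) := by
    have : ContinuousAt (fun x => 2 * (‖v x - v μ‖ + ‖τ x - τ μ‖)) μ :=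
      (((dv.continuousAt.sub_const _).norm).add ((dτ.continuousAt.sub_const _).norm)).const_mul 2
    simpa [ContinuousAt] using this
  rw [ContinuousAt, tendsto_iff_norm_sub_tendsto_zero]
  exact squeeze_zero' (Eventually.of_forall fun x => norm_nonneg _)
    (ev.mono fun x hx => h.norm_root_sub_le hx.1 hx.2 hτ hv) hg

theorem norm_root_mem (h : IsSmallPerturbation κ v₀ P) {τ v : ℂ} (hτ : ‖τ‖ < 2)
    (hv : ‖v - v₀‖ < κ / 200 * ‖v₀‖) :
    3 / 2 ≤ (perturbedRoot P τ v).re ∧ 3 / 2 ≤ ‖perturbedRoot P τ v‖ ∧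
      ‖perturbedRoot P τ v‖ ≤ 5 / 2 := by
  have h1 := (h.root_spec hτ hv).1
  have h2 := abs_le.1 ((Complex.abs_re_le_norm _).trans h1)
  simp only [Complex.sub_re, Complex.re_ofNat] at h2
  refine ⟨by linarith, (by linarith : 3 / 2 ≤ (perturbedRoot P τ v).re).trans
    (Complex.re_le_norm _), ?_⟩
  calc ‖perturbedRoot P τ v‖ = ‖perturbedRoot P τ v - 2 + 2‖ := by rw [sub_add_cancel]
    _ ≤ ‖perturbedRoot P τ v - 2‖ + ‖(2 : ℂ)‖ := norm_add_le _ _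
    _ ≤ 5 / 2 := by rw [Complex.norm_ofNat]; linarith

theorem root_mul_mem (h : IsSmallPerturbation κ v₀ P) {τ v : ℂ} (hτ : ‖τ‖ < 2)
    (hv : ‖v - v₀‖ < κ / 200 * ‖v₀‖) {t : ℝ} (ht : 0 < t) :
    perturbedRoot P τ v * t ∈ rightSector :=
  mul_ofReal_mem_rightSector (mem_rightSector_of_norm_sub_two_le
    ((h.root_spec hτ hv).1.trans (by norm_num))) ht

theorem norm_root_mul_le (h : IsSmallPerturbation κ v₀ P) {τ v : ℂ} (hτ : ‖τ‖ < 2)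
    (hv : ‖v - v₀‖ < κ / 200 * ‖v₀‖) {t : ℝ} (ht : 0 < t) :
    ‖P (perturbedRoot P τ v * t)‖ ≤ κ / 200 * (‖v₀‖ + 5 / 2 * t) := by
  refine (h.norm_le _ (h.root_mul_mem hτ hv ht)).trans ?_
  have := h.pos
  rw [norm_mul, Complex.norm_real, Real.norm_of_nonneg ht.le]
  have := (h.norm_root_mem hτ hv).2.2
  gcongr

/-- Inserting the equation of the root `z` gives `1 + A(zt) = (1 - t) v + 2t + τ (t P(z) - P(zt))`:
apart from a small error this is the segment from `v₀` to `2`. -/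
theorem one_add_A_eq (h : IsSmallPerturbation κ v₀ P) {τ v : ℂ} (hτ : ‖τ‖ < 2)
    (hv : ‖v - v₀‖ < κ / 200 * ‖v₀‖) {t : ℝ} (ht : 0 < t) (ht1 : t ≤ 1) :
    ∃ e : ℂ, ‖e‖ ≤ κ / 10 * (‖v₀‖ + t) ∧
      1 + perturbedA P τ v (perturbedRoot P τ v * t) = (1 - t) * v₀ + 2 * t + e := by
  have hz := (h.root_spec hτ hv).2
  have b1 := h.norm_root_mul_le hτ hv ht
  have b2 := h.norm_root_mul_le hτ hv one_pos
  rw [Complex.ofReal_one, mul_one] at b2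
  have hκ := h.pos
  set z := perturbedRoot P τ v
  refine ⟨(1 - t) * (v - v₀) + τ * (t * P z - P (z * t)), ?_, ?_⟩
  · have n0 := norm_nonneg v₀
    have n1 : ‖(1 - t : ℂ) * (v - v₀)‖ ≤ 1 * (κ / 200 * ‖v₀‖) := by
      rw [norm_mul, show (1 - t : ℂ) = ((1 - t : ℝ) : ℂ) by push_cast; ring, Complex.norm_real,
        Real.norm_of_nonneg (by linarith)]
      gcongr
      linarith
    have n2 : ‖τ * (t * P z - P (z * t))‖ ≤
        2 * (t * (κ / 200 * (‖v₀‖ + 5 / 2 * 1)) + κ / 200 * (‖v₀‖ + 5 / 2 * t)) := by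
      rw [norm_mul]
      gcongr
      refine (_root_.norm_sub_le _ _).trans ?_
      rw [norm_mul, Complex.norm_real, Real.norm_of_nonneg ht.le]
      gcongr
    refine (norm_add_le _ _).trans ((add_le_add n1 n2).trans ?_)
    have : t * (κ * ‖v₀‖) ≤ 1 * (κ * ‖v₀‖) := by gcongr
    nlinarith [mul_pos hκ ht]
  · unfold perturbedA
    linear_combination t * hz

theorem one_add_A_mem (h : IsSmallPerturbation κ v₀ P) {τ v : ℂ} (hτ : ‖τ‖ < 2)
    (hv : ‖v - v₀‖ < κ / 200 * ‖v₀‖) {t : ℝ} (ht : 0 < t) (ht1 : t ≤ 1) :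
    1 + perturbedA P τ v (perturbedRoot P τ v * t) ∈ Complex.slitPlane := by
  obtain ⟨e, he, h1⟩ := h.one_add_A_eq hτ hv ht ht1
  rw [h1]
  exact mem_slitPlane_of_angle h.pos h.le_one h.ne_zero h.norm_lt h.angle ht.le he

theorem norm_A_le (h : IsSmallPerturbation κ v₀ P) {τ v : ℂ} (hτ : ‖τ‖ < 2)
    (hv : ‖v - v₀‖ < κ / 200 * ‖v₀‖) {t : ℝ} (ht : 0 < t) (ht1 : t ≤ 1) :
    ‖perturbedA P τ v (perturbedRoot P τ v * t)‖ ≤ 10 := by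
  obtain ⟨e, he, h1⟩ := h.one_add_A_eq hτ hv ht ht1
  have h2 := h.norm_lt
  have h3 := h.le_one
  have h4 := h.pos
  have h5 := norm_nonneg v₀
  have h6 : κ / 10 * (‖v₀‖ + t) ≤ 1 / 10 * (1 / 4 + 1) := by gcongr
  rw [show perturbedA P τ v (perturbedRoot P τ v * t) = ((1 - t : ℝ) : ℂ) * v₀ + ((2 * t - 1 : ℝ) : ℂ) + e by
    push_cast; linear_combination h1]
  have h7 : ‖((1 - t : ℝ) : ℂ) * v₀‖ ≤ 1 * (1 / 4) := by
    rw [norm_mul, Complex.norm_real, Real.norm_of_nonneg (by linarith)]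
    gcongr
    linarith
  have h8 : ‖((2 * t - 1 : ℝ) : ℂ)‖ ≤ 1 := by
    rw [Complex.norm_real, Real.norm_eq_abs, abs_le]
    constructor <;> linarith
  refine (norm_add_le _ _).trans ?_
  have := norm_add_le (((1 - t : ℝ) : ℂ) * v₀) ((2 * t - 1 : ℝ) : ℂ)
  linarith

/-- Here `1 - A(zt) = (1 - t) z - τ (P(z) - P(zt))` with `Re z ≥ 3/2`. The perturbation must vanish
linearly as `t → 1`, whence the Lipschitz bound for `t ≥ 3/4`; below that a crude bound is enough.
-/
theorem one_sub_le_re (h : IsSmallPerturbation κ v₀ P) {τ v : ℂ} (hτ : ‖τ‖ < 2)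
    (hv : ‖v - v₀‖ < κ / 200 * ‖v₀‖) {t : ℝ} (ht : 0 < t) (ht1 : t ≤ 1) :
    1 - t ≤ (1 - perturbedA P τ v (perturbedRoot P τ v * t)).re := by
  obtain ⟨hz1, hz⟩ := h.root_spec hτ hv
  have b1 := h.norm_root_mul_le hτ hv ht
  have b2 := h.norm_root_mul_le hτ hv one_pos
  rw [Complex.ofReal_one, mul_one] at b2
  obtain ⟨c1, c2, c3⟩ := h.norm_root_mem hτ hv
  have hκ := h.pos
  have hκ1 := h.le_one
  set z := perturbedRoot P τ v
  have e : 1 - perturbedA P τ v (z * t) = ((1 - t : ℝ) : ℂ) * z - τ * (P z - P (z * t)) := by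
    unfold perturbedA
    push_cast
    linear_combination -hz
  have key : ‖P z - P (z * t)‖ ≤ 1 / 5 * (1 - t) := by
    rcases le_or_gt (3 / 4) t with h1 | h1
    · have hzt : ‖z * t - 2‖ ≤ 1 := by
        calc ‖z * t - 2‖ = ‖(z - 2) * t - ((2 * (1 - t) : ℝ) : ℂ)‖ := by
              congr 1; push_cast; ring
          _ ≤ ‖(z - 2) * t‖ + ‖((2 * (1 - t) : ℝ) : ℂ)‖ := _root_.norm_sub_le _ _
          _ ≤ 1 := by
              rw [norm_mul, Complex.norm_real, Complex.norm_real, Real.norm_of_nonneg ht.le,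
                Real.norm_of_nonneg (by linarith)]
              nlinarith
      refine (h.norm_sub_le (by linarith) hzt).trans ?_
      rw [show z - z * t = z * ((1 - t : ℝ) : ℂ) by push_cast; ring, norm_mul, Complex.norm_real,
        Real.norm_of_nonneg (by linarith)]
      have : κ * (‖z‖ * (1 - t)) ≤ 1 * (5 / 2 * (1 - t)) := by
        have : 0 ≤ 1 - t := by linarith
        gcongr
      linarith
    · refine (_root_.norm_sub_le _ _).trans ?_
      have := h.norm_lt
      have h5 := norm_nonneg v₀
      have h6 : κ / 200 * (‖v₀‖ + 5 / 2 * t) ≤ 1 / 200 * (1 / 4 + 5 / 2 * 1) := by gcongr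
      have h7 : κ / 200 * (‖v₀‖ + 5 / 2 * 1) ≤ 1 / 200 * (1 / 4 + 5 / 2 * 1) := by gcongr
      linarith
  have k2 : ‖τ * (P z - P (z * t))‖ ≤ 2 * (1 / 5 * (1 - t)) := by
    rw [norm_mul]; gcongr
  have k3 := (abs_le.1 ((Complex.abs_re_le_norm _).trans k2)).2
  rw [e, Complex.sub_re, Complex.re_ofReal_mul]
  nlinarith

theorem one_sub_A_mem (h : IsSmallPerturbation κ v₀ P) {τ v : ℂ} (hτ : ‖τ‖ < 2)
    (hv : ‖v - v₀‖ < κ / 200 * ‖v₀‖) {t : ℝ} (ht : 0 < t) (ht1 : t < 1) :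
    1 - perturbedA P τ v (perturbedRoot P τ v * t) ∈ Complex.slitPlane := by
  rw [Complex.mem_slitPlane_iff]
  have := h.one_sub_le_re hτ hv ht ht1.le
  exact Or.inl (by linarith)

theorem A_root (h : IsSmallPerturbation κ v₀ P) {τ v : ℂ} (hτ : ‖τ‖ < 2)
    (hv : ‖v - v₀‖ < κ / 200 * ‖v₀‖) : perturbedA P τ v (perturbedRoot P τ v) = 1 := by
  have := (h.root_spec hτ hv).2
  unfold perturbedA
  linear_combination this

end IsSmallPerturbation

/-! ### The weighted integrals and the exchange of `τ`- and `v`-derivatives -/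

/-- The integrand `arccos(A(z t)) P(z t)^k (z t)^(s-1) z`, where `z` is the perturbed root. -/
noncomputable def abelianIntegrand (P : ℂ → ℂ) (s : ℝ) (k : ℕ) (τ v : ℂ) (t : ℝ) : ℂ :=
  arccosBranch (perturbedA P τ v (perturbedRoot P τ v * t)) *
    (P (perturbedRoot P τ v * t) ^ k * (perturbedRoot P τ v * t) ^ ((s : ℂ) - 1)) *
    perturbedRoot P τ v

/-- This is `∫ arccos(A) P^k z^(s-1) dz` from `0` to the root. The weights `P^k` close the family
under `∂_τ`; `P` does not change with the argument `v`. -/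
noncomputable def abelianIntegral (P : ℂ → ℂ) (s : ℝ) (k : ℕ) (τ v : ℂ) : ℂ :=
  ∫ t in (0 : ℝ)..1, abelianIntegrand P s k τ v t

namespace IsSmallPerturbation

variable {κ : ℝ} {v₀ : ℂ} {P : ℂ → ℂ} {s : ℝ}

theorem norm_P_root_mul_le_one (h : IsSmallPerturbation κ v₀ P) {τ v : ℂ} (hτ : ‖τ‖ < 2)
    (hv : ‖v - v₀‖ < κ / 200 * ‖v₀‖) {t : ℝ} (ht : 0 < t) (ht1 : t ≤ 1) :
    ‖P (perturbedRoot P τ v * t)‖ ≤ 1 := by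
  refine (h.norm_root_mul_le hτ hv ht).trans ?_
  have h1 := h.norm_lt
  have h2 := h.le_one
  have h3 := h.pos
  have h4 := norm_nonneg v₀
  calc κ / 200 * (‖v₀‖ + 5 / 2 * t) ≤ 1 / 200 * (1 / 4 + 5 / 2 * 1) := by gcongr
    _ ≤ 1 := by norm_num

theorem norm_weight_le (h : IsSmallPerturbation κ v₀ P) (hs1 : s ≤ 1) {τ v : ℂ}
    (hτ : ‖τ‖ < 2) (hv : ‖v - v₀‖ < κ / 200 * ‖v₀‖) {t : ℝ} (ht : 0 < t) :
    ‖(perturbedRoot P τ v * t) ^ ((s : ℂ) - 1)‖ ≤ t ^ (s - 1) := by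
  have h1 := (h.norm_root_mem hτ hv).2.1
  rw [show (s : ℂ) - 1 = ((s - 1 : ℝ) : ℂ) by push_cast; ring, Complex.norm_cpow_real, norm_mul,
    Complex.norm_real, Real.norm_of_nonneg ht.le]
  exact Real.rpow_le_rpow_of_nonpos ht (by nlinarith) (by linarith)

theorem norm_integrand_le (h : IsSmallPerturbation κ v₀ P) (hs1 : s ≤ 1) (k : ℕ) {τ v : ℂ}
    (hτ : ‖τ‖ < 2) (hv : ‖v - v₀‖ < κ / 200 * ‖v₀‖) {t : ℝ} (ht : 0 < t) (ht1 : t ≤ 1) :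
    ‖abelianIntegrand P s k τ v t‖ ≤ 63 * t ^ (s - 1) := by
  have h1 := norm_arccosBranch_le (h.norm_A_le hτ hv ht ht1)
  have h2 := h.norm_P_root_mul_le_one hτ hv ht ht1
  have h3 := h.norm_weight_le hs1 hτ hv ht
  have h4 := (h.norm_root_mem hτ hv).2.2
  have h5 : 0 ≤ t ^ (s - 1) := Real.rpow_nonneg ht.le _
  unfold abelianIntegrand
  rw [norm_mul, norm_mul, norm_mul, norm_pow]
  calc _ ≤ 25 * (1 ^ k * t ^ (s - 1)) * (5 / 2) := by gcongr
    _ ≤ 63 * t ^ (s - 1) := by rw [one_pow]; linarith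

theorem intervalIntegrable_bound (hs : 0 < s) :
    IntervalIntegrable (fun t : ℝ => 63 * t ^ (s - 1)) volume 0 1 :=
  (intervalIntegral.intervalIntegrable_rpow' (by linarith)).const_mul _

theorem norm_abelianIntegral_le (h : IsSmallPerturbation κ v₀ P) (hs : 0 < s) (hs1 : s ≤ 1)
    (k : ℕ) {τ v : ℂ} (hτ : ‖τ‖ < 2) (hv : ‖v - v₀‖ < κ / 200 * ‖v₀‖) :
    ‖abelianIntegral P s k τ v‖ ≤ 63 / s := by
  have e : ∫ t in (0 : ℝ)..1, 63 * t ^ (s - 1) = 63 / s := by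
    rw [intervalIntegral.integral_const_mul, integral_rpow (Or.inl (by linarith)), sub_add_cancel,
      Real.one_rpow, Real.zero_rpow hs.ne']
    ring
  rw [← e]
  refine intervalIntegral.norm_integral_le_of_norm_le zero_le_one ?_ (intervalIntegrable_bound hs)
  exact Eventually.of_forall fun t ht => h.norm_integrand_le hs1 k hτ hv ht.1 ht.2

theorem hasDerivAt_weight (h : IsSmallPerturbation κ v₀ P) (k : ℕ) {x : ℂ}
    (hx : x ∈ rightSector) :
    HasDerivAt (fun x => P x ^ k * x ^ ((s : ℂ) - 1))
      (deriv (fun x => P x ^ k * x ^ ((s : ℂ) - 1)) x) x :=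
  (((h.differentiableAt hx).pow k).mul ((hasDerivAt_id x).cpow_const
    (rightSector_subset_slitPlane hx)).differentiableAt).hasDerivAt

theorem deriv_weight_succ (h : IsSmallPerturbation κ v₀ P) (k : ℕ) {x : ℂ}
    (hx : x ∈ rightSector) :
    deriv (fun x => P x ^ (k + 1) * x ^ ((s : ℂ) - 1)) x =
      deriv P x * (P x ^ k * x ^ ((s : ℂ) - 1)) +
        P x * deriv (fun x => P x ^ k * x ^ ((s : ℂ) - 1)) x := by
  have h1 := (h.differentiableAt hx).hasDerivAt.mul (h.hasDerivAt_weight (s := s) k hx)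
  have h2 : (fun x => P x ^ (k + 1) * x ^ ((s : ℂ) - 1)) =
      P * fun x => P x ^ k * x ^ ((s : ℂ) - 1) := by
    funext x; simp only [Pi.mul_apply]; ring
  rw [h2, h1.deriv]

/-- Stated along an arbitrary curve in `(τ, v)`, so that it yields both partial derivatives. -/
theorem hasDerivAt_integrand (h : IsSmallPerturbation κ v₀ P) (k : ℕ) {τ v : ℂ → ℂ}
    {τ' v' z' μ : ℂ} (hτ : ‖τ μ‖ < 2) (hv : ‖v μ - v₀‖ < κ / 200 * ‖v₀‖)
    (dτ : HasDerivAt τ τ' μ) (dv : HasDerivAt v v' μ)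
    (dz : HasDerivAt (fun x => perturbedRoot P (τ x) (v x)) z' μ)
    {t : ℝ} (ht : 0 < t) (ht1 : t < 1) {z x A : ℂ} (hz : z = perturbedRoot P (τ μ) (v μ))
    (hx : x = z * t) (hA : A = perturbedA P (τ μ) (v μ) x) :
    HasDerivAt (fun y => abelianIntegrand P s k (τ y) (v y) t)
      ((-((1 - A) ^ (1 / 2 : ℂ) * (1 + A) ^ (1 / 2 : ℂ))⁻¹ *
            (z' * t + v' - (τ' * P x + τ μ * (deriv P x * (z' * t)))) *
            (P x ^ k * x ^ ((s : ℂ) - 1)) +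
          arccosBranch A * (deriv (fun x => P x ^ k * x ^ ((s : ℂ) - 1)) x * (z' * t))) * z +
        arccosBranch A * (P x ^ k * x ^ ((s : ℂ) - 1)) * z') μ := by
  subst hz hx hA
  have hmem := h.root_mul_mem hτ hv ht
  have dx := dz.mul_const (t : ℂ)
  have dP := HasDerivAt.comp μ (h.differentiableAt hmem).hasDerivAt dx
  have dF := HasDerivAt.comp μ (h.hasDerivAt_weight (s := s) k hmem) dx
  have dA := ((dx.sub_const 1).add dv).sub (dτ.mul dP)
  have dφ := HasDerivAt.comp μ (hasDerivAt_arccosBranch (h.one_add_A_mem hτ hv ht ht1.le)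
    (h.one_sub_A_mem hτ hv ht ht1)) dA
  exact (dφ.mul dF).mul dz

theorem continuousOn_integrand (h : IsSmallPerturbation κ v₀ P) (k : ℕ) {τ v : ℂ}
    (hτ : ‖τ‖ < 2) (hv : ‖v - v₀‖ < κ / 200 * ‖v₀‖) :
    ContinuousOn (abelianIntegrand P s k τ v) (Set.Ioo 0 1) := by
  intro t ht
  refine ContinuousAt.continuousWithinAt ?_
  have hmem := h.root_mul_mem hτ hv ht.1
  have dx : ContinuousAt (fun t : ℝ => perturbedRoot P τ v * t) t := by fun_prop
  have c1 : ContinuousAt (fun t : ℝ => P (perturbedRoot P τ v * t)) t :=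
    ContinuousAt.comp (f := fun t : ℝ => perturbedRoot P τ v * t)
      (h.differentiableAt hmem).continuousAt dx
  have c2 : ContinuousAt (fun t : ℝ => (perturbedRoot P τ v * t) ^ ((s : ℂ) - 1)) t :=
    ContinuousAt.comp (f := fun t : ℝ => perturbedRoot P τ v * t)
      ((hasDerivAt_id _).cpow_const (rightSector_subset_slitPlane hmem)).continuousAt dx
  have c3 : ContinuousAt (fun t : ℝ => arccosBranch (perturbedA P τ v (perturbedRoot P τ v * t))) t :=
    ContinuousAt.comp (f := fun t : ℝ => perturbedA P τ v (perturbedRoot P τ v * t))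
      (hasDerivAt_arccosBranch (h.one_add_A_mem hτ hv ht.1 ht.2.le)
        (h.one_sub_A_mem hτ hv ht.1 ht.2)).continuousAt
      (((dx.sub_const 1).add continuousAt_const).sub (continuousAt_const.mul c1))
  exact (c3.mul ((c1.pow k).mul c2)).mul continuousAt_const

theorem hasDerivAt_abelianIntegral_left (h : IsSmallPerturbation κ v₀ P) (hs : 0 < s)
    (hs1 : s ≤ 1) (k : ℕ) {τ v : ℂ} (hτ : ‖τ‖ < 2) (hv : ‖v - v₀‖ < κ / 200 * ‖v₀‖) :
    IntervalIntegrable (fun t => deriv (fun τ => abelianIntegrand P s k τ v t) τ) volume 0 1 ∧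
    HasDerivAt (fun τ => abelianIntegral P s k τ v)
      (∫ t in (0 : ℝ)..1, deriv (fun τ => abelianIntegrand P s k τ v t) τ) τ := by
  have hb : ∀ x ∈ Metric.ball τ (2 - ‖τ‖), ‖x‖ < 2 := fun x hx => by
    rw [mem_ball_iff_norm] at hx
    have := norm_add_le (x - τ) τ
    rw [sub_add_cancel] at this
    linarith
  refine hasDerivAt_integral_of_differentiableOn_of_norm_le (Θ := fun τ => abelianIntegrand P s k τ v)
    (sub_pos.2 hτ)
    (intervalIntegrable_bound hs) (fun x hx => h.continuousOn_integrand k (hb x hx) hv)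
    (fun t ht x hx => ?_) fun x hx t ht => h.norm_integrand_le hs1 k (hb x hx) hv ht.1 ht.2.le
  exact (h.hasDerivAt_integrand k (τ := id) (v := fun _ => v) (hb x hx) hv (hasDerivAt_id x)
    (hasDerivAt_const x v) (h.hasDerivAt_root (τ := id) (v := fun _ => v) (hb x hx) hv
      (hasDerivAt_id x) (hasDerivAt_const x v)) ht.1 ht.2 rfl rfl
      rfl).differentiableAt.differentiableWithinAt

theorem hasDerivAt_abelianIntegral_right (h : IsSmallPerturbation κ v₀ P) (hs : 0 < s)
    (hs1 : s ≤ 1) (k : ℕ) {τ v : ℂ} (hτ : ‖τ‖ < 2) (hv : ‖v - v₀‖ < κ / 200 * ‖v₀‖) :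
    IntervalIntegrable (fun t => deriv (fun v => abelianIntegrand P s k τ v t) v) volume 0 1 ∧
    HasDerivAt (abelianIntegral P s k τ)
      (∫ t in (0 : ℝ)..1, deriv (fun v => abelianIntegrand P s k τ v t) v) v := by
  have hb : ∀ x ∈ Metric.ball v (κ / 200 * ‖v₀‖ - ‖v - v₀‖), ‖x - v₀‖ < κ / 200 * ‖v₀‖ :=
    fun x hx => by
      rw [mem_ball_iff_norm] at hx
      have := norm_add_le (x - v) (v - v₀)
      rw [sub_add_sub_cancel] at this
      linarith
  refine hasDerivAt_integral_of_differentiableOn_of_norm_le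
    (Θ := fun v => abelianIntegrand P s k τ v) (sub_pos.2 hv)
    (intervalIntegrable_bound hs) (fun x hx => h.continuousOn_integrand k hτ (hb x hx))
    (fun t ht x hx => ?_) fun x hx t ht => h.norm_integrand_le hs1 k hτ (hb x hx) ht.1 ht.2.le
  exact (h.hasDerivAt_integrand k (τ := fun _ => τ) (v := id) hτ (hb x hx) (hasDerivAt_const x τ)
    (hasDerivAt_id x) (h.hasDerivAt_root (τ := fun _ => τ) (v := id) hτ (hb x hx)
      (hasDerivAt_const x τ) (hasDerivAt_id x)) ht.1 ht.2 rfl rfl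
      rfl).differentiableAt.differentiableWithinAt

/-- Since `A` contains the parameters as `v - τ P`, one has `∂_τ A = -P ∂_v A` at fixed argument,
and the two derivatives cancel up to the motion of the path. On the scaled path this motion
contributes the `t`-derivative of the velocity `t (z_τ + P(zt) z_v)` times the weighted inverse
cosine, with `z_τ = β P(z)` and `z_v = -β`. That function tends to `0` at both ends. -/
theorem integral_deriv_add_integral_deriv (h : IsSmallPerturbation κ v₀ P) (hs : 0 < s)
    (hs1 : s ≤ 1) (k : ℕ) {τ v : ℂ} (hτ : ‖τ‖ < 2) (hv : ‖v - v₀‖ < κ / 200 * ‖v₀‖) :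
    (∫ t in (0 : ℝ)..1, deriv (fun τ => abelianIntegrand P s k τ v t) τ) +
      ∫ t in (0 : ℝ)..1, deriv (fun v => abelianIntegrand P s (k + 1) τ v t) v = 0 := by
  have i1 := (h.hasDerivAt_abelianIntegral_left hs hs1 k hτ hv).1
  have i2 := (h.hasDerivAt_abelianIntegral_right hs hs1 (k + 1) hτ hv).1
  have dz1 := h.hasDerivAt_root (τ := id) (v := fun _ => v) (μ := τ) hτ hv
      (hasDerivAt_id τ) (hasDerivAt_const τ v)
  have dz2 := h.hasDerivAt_root (τ := fun _ => τ) (v := id) (μ := v) hτ hv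
      (hasDerivAt_const v τ) (hasDerivAt_id v)
  rw [← intervalIntegral.integral_add i1 i2]
  set z := perturbedRoot P τ v with hz
  set β := (1 - τ * deriv P z)⁻¹ with hβ
  have e1 : (-0 + 1 * P (perturbedRoot P (id τ) v)) / (1 - id τ * deriv P (perturbedRoot P (id τ) v))
      = P z * β := by
    simp only [id, ← hz]; rw [hβ]; ring
  have e2 : (-1 + 0 * P (perturbedRoot P τ (id v))) / (1 - τ * deriv P (perturbedRoot P τ (id v)))
      = -β := by
    simp only [id, ← hz]; rw [hβ]; ring
  rw [e1] at dz1
  rw [e2] at dz2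
  -- One bound serves both ends: the factor `t` improves the weight `t^(s-1)` to `t^s`, which
  -- disposes of `t = 0`, and the difference of the `P` terms disposes of `t = 1`.
  have hlim : ∀ {l : Filter ℝ}, (∀ᶠ t in l, t ∈ Set.Ioo (0 : ℝ) 1) →
      Tendsto (fun t : ℝ => 25 * (t ^ s * ‖P z * β - β * P (z * t)‖)) l (𝓝 0) →
      Tendsto (fun t : ℝ => t * (P z * β - β * P (z * t)) * (P (z * t) ^ k *
        (z * t) ^ ((s : ℂ) - 1)) * arccosBranch (perturbedA P τ v (z * t))) l (𝓝 0) := by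
    intro l hl hl0
    rw [tendsto_zero_iff_norm_tendsto_zero]
    refine squeeze_zero' (Eventually.of_forall fun _ => norm_nonneg _) (hl.mono fun t ht => ?_) hl0
    have b1 := norm_arccosBranch_le (h.norm_A_le hτ hv ht.1 ht.2.le)
    have b2 := h.norm_P_root_mul_le_one hτ hv ht.1 ht.2.le
    have b3 := h.norm_weight_le hs1 hτ hv ht.1
    have b4 : t ^ s = t * t ^ (s - 1) := by
      rw [Real.rpow_sub_one ht.1.ne', mul_div_cancel₀ _ ht.1.ne']
    have b5 : 0 ≤ t ^ (s - 1) := Real.rpow_nonneg ht.1.le _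
    have b6 := ht.1.le
    rw [norm_mul, norm_mul, norm_mul, norm_mul, norm_pow, Complex.norm_real,
      Real.norm_of_nonneg ht.1.le, b4]
    calc _ ≤ t * ‖P z * β - β * P (z * t)‖ * (1 ^ k * t ^ (s - 1)) * 25 := by gcongr
      _ = _ := by rw [one_pow]; ring
  have hI0 : ∀ᶠ t : ℝ in 𝓝[>] 0, t ∈ Set.Ioo (0 : ℝ) 1 := Ioo_mem_nhdsGT zero_lt_one
  have hI1 : ∀ᶠ t : ℝ in 𝓝[<] 1, t ∈ Set.Ioo (0 : ℝ) 1 := Ioo_mem_nhdsLT zero_lt_one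
  have hts : ContinuousAt (fun t : ℝ => t ^ s) 0 := Real.continuousAt_rpow_const _ _ (Or.inr hs.le)
  have l0 := hlim hI0 (by
    have hg : Tendsto (fun t : ℝ => 25 * (t ^ s * (‖P z * β‖ + ‖β‖))) (𝓝[>] 0) (𝓝 0) := by
      have : ContinuousAt (fun t : ℝ => 25 * (t ^ s * (‖P z * β‖ + ‖β‖))) 0 :=
        (hts.mul_const _).const_mul _
      have h2 := this.tendsto
      simp only [Real.zero_rpow hs.ne', zero_mul, mul_zero] at h2
      exact h2.mono_left nhdsWithin_le_nhds
    refine squeeze_zero' (hI0.mono fun t ht => ?_) (hI0.mono fun t ht => ?_) hg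
    · have := Real.rpow_nonneg ht.1.le s
      positivity
    · have := Real.rpow_nonneg ht.1.le s
      have b2 := h.norm_P_root_mul_le_one hτ hv ht.1 ht.2.le
      gcongr
      refine (_root_.norm_sub_le _ _).trans ?_
      rw [norm_mul β]
      gcongr
      exact mul_le_of_le_one_right (norm_nonneg _) b2)
  have l1 := hlim hI1 (by
    have hmem := h.root_mul_mem hτ hv one_pos
    have c1 : ContinuousAt (fun t : ℝ => P (z * t)) 1 :=
      ContinuousAt.comp (f := fun t : ℝ => z * t) (h.differentiableAt hmem).continuousAt
        (by fun_prop)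
    have c2 : ContinuousAt (fun t : ℝ => t ^ s) 1 := Real.continuousAt_rpow_const _ _ (Or.inl one_ne_zero)
    have : ContinuousAt (fun t : ℝ => 25 * (t ^ s * ‖P z * β - β * P (z * t)‖)) 1 :=
      (c2.mul ((c1.const_mul β).const_sub (P z * β)).norm).const_mul _
    have h2 := this.tendsto
    simp only [Complex.ofReal_one, mul_one] at h2
    rw [mul_comm β, sub_self, norm_zero, mul_zero, mul_zero] at h2
    exact h2.mono_left nhdsWithin_le_nhds)
  have key := intervalIntegral.integral_eq_sub_of_hasDerivAt_of_tendsto zero_lt_one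
    (f := fun t : ℝ => t * (P z * β - β * P (z * t)) * (P (z * t) ^ k *
        (z * t) ^ ((s : ℂ) - 1)) * arccosBranch (perturbedA P τ v (z * t)))
    (fun t ht => ?_) (i1.add i2) l0 l1
  · rw [sub_zero] at key
    exact key
  · have hmem := h.root_mul_mem hτ hv ht.1
    have D1 := (h.hasDerivAt_integrand (s := s) k (τ := id) (v := fun _ => v) (μ := τ) hτ hv
      (hasDerivAt_id τ) (hasDerivAt_const τ v) dz1 ht.1 ht.2 hz rfl rfl).deriv
    have D2 := (h.hasDerivAt_integrand (s := s) (k + 1) (τ := fun _ => τ) (v := id) (μ := v) hτ hv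
      (hasDerivAt_const v τ) (hasDerivAt_id v) dz2 ht.1 ht.2 hz rfl rfl).deriv
    have dx : HasDerivAt (fun t : ℝ => z * t) z t := by
      simpa using (hasDerivAt_id t).ofReal_comp.const_mul z
    have dt : HasDerivAt (fun t : ℝ => (t : ℂ)) 1 t := by
      simpa using (hasDerivAt_id t).ofReal_comp
    have dP := HasDerivAt.comp t (h.differentiableAt hmem).hasDerivAt dx
    have dF := HasDerivAt.comp t (h.hasDerivAt_weight (s := s) k hmem) dx
    have dA := ((dx.sub_const 1).add_const v).sub (dP.const_mul τ)
    have dφ : HasDerivAt (fun t : ℝ => arccosBranch (perturbedA P τ v (z * t)))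
        (-((1 - perturbedA P τ v (z * t)) ^ (1 / 2 : ℂ) *
          (1 + perturbedA P τ v (z * t)) ^ (1 / 2 : ℂ))⁻¹ * (z - τ * (deriv P (z * t) * z))) t :=
      HasDerivAt.comp t (hasDerivAt_arccosBranch (h.one_add_A_mem hτ hv ht.1 ht.2.le)
        (h.one_sub_A_mem hτ hv ht.1 ht.2)) dA
    refine (((dt.mul ((dP.const_mul β).const_sub (P z * β))).mul dF).mul dφ).congr_deriv ?_
    simp only [id] at D1 D2
    rw [D1, D2, h.deriv_weight_succ k hmem]
    simp only [Function.comp, Pi.mul_apply, ← hz]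
    generalize deriv (fun x => P x ^ k * x ^ ((s : ℂ) - 1)) (z * t) = F'
    generalize (z * t) ^ ((s : ℂ) - 1) = g
    generalize hAA : perturbedA P τ v (z * t) = A
    generalize ((1 - A) ^ (1 / 2 : ℂ) * (1 + A) ^ (1 / 2 : ℂ))⁻¹ = r
    generalize arccosBranch A = φ
    rw [pow_succ]
    ring

theorem norm_sub_self_lt (h : IsSmallPerturbation κ v₀ P) :
    ‖v₀ - v₀‖ < κ / 200 * ‖v₀‖ := by
  have h1 := h.pos
  have h2 := norm_pos_iff.2 h.ne_zero
  rw [sub_self, norm_zero]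
  positivity

theorem iteratedDeriv_abelianIntegral (h : IsSmallPerturbation κ v₀ P) (hs : 0 < s) (hs1 : s ≤ 1)
    (n : ℕ) : iteratedDeriv n (fun τ => abelianIntegral P s 0 τ v₀) 0 =
      (-1) ^ n * iteratedDeriv n (abelianIntegral P s n 0) v₀ := by
  have h0 := h.norm_sub_self_lt
  rw [sub_self, norm_zero] at h0
  have := iteratedDeriv_eq_of_hasDerivAt_neg_deriv (f := abelianIntegral P s) (R := 2) (v₀ := v₀)
    (C := 63 / s) h0
    (fun k τ hτ v hv => (h.hasDerivAt_abelianIntegral_right hs hs1 k (by simpa using hτ)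
      (mem_ball_iff_norm.1 hv)).2.differentiableAt.differentiableWithinAt)
    (fun k τ hτ v hv => by
      have hτ' : ‖τ‖ < 2 := by simpa using hτ
      have hv' := mem_ball_iff_norm.1 hv
      refine (h.hasDerivAt_abelianIntegral_left hs hs1 k hτ' hv').2.congr_deriv ?_
      rw [(h.hasDerivAt_abelianIntegral_right hs hs1 (k + 1) hτ' hv').2.deriv]
      linear_combination h.integral_deriv_add_integral_deriv hs hs1 k hτ' hv')
    (fun k τ hτ v hv => h.norm_abelianIntegral_le hs hs1 k (by simpa using hτ)
      (mem_ball_iff_norm.1 hv)) n 0 0 (by simp)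
  rwa [zero_add] at this

theorem differentiableOn_abelianIntegral (h : IsSmallPerturbation κ v₀ P) (hs : 0 < s)
    (hs1 : s ≤ 1) :
    DifferentiableOn ℂ (fun τ => abelianIntegral P s 0 τ v₀) (Metric.ball 0 2) := fun τ hτ =>
  (h.hasDerivAt_abelianIntegral_left hs hs1 0 (by simpa using hτ)
    h.norm_sub_self_lt).2.differentiableAt.differentiableWithinAt

/-- The Taylor series at `τ = 0`, evaluated at `τ = 1` inside the disc of radius `2`, with all
`τ`-derivatives traded for `v`-derivatives at `τ = 0`. -/
theorem hasSum_abelianIntegral (h : IsSmallPerturbation κ v₀ P) (hs : 0 < s) (hs1 : s ≤ 1) :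
    HasSum (fun n : ℕ => (n.factorial : ℂ)⁻¹ *
      ((-1) ^ n * iteratedDeriv n (abelianIntegral P s n 0) v₀)) (abelianIntegral P s 0 1 v₀) := by
  have := Complex.hasSum_taylorSeries_on_ball (h.differentiableOn_abelianIntegral hs hs1) (z := 1)
    (by simp)
  refine this.congr_fun fun n => ?_
  rw [h.iteratedDeriv_abelianIntegral hs hs1, sub_zero, one_pow, one_smul, smul_eq_mul]

/-- Read back as a `τ`-derivative, the quantity obeys Cauchy's estimate on the unit circle, with a
bound that does not depend on `v₀` or `P`. -/
theorem norm_iteratedDeriv_abelianIntegral_le (h : IsSmallPerturbation κ v₀ P) (hs : 0 < s)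
    (hs1 : s ≤ 1) (n : ℕ) :
    ‖iteratedDeriv n (abelianIntegral P s n 0) v₀‖ ≤ n.factorial * (63 / s) := by
  have hd : DiffContOnCl ℂ (fun τ => abelianIntegral P s 0 τ v₀) (Metric.ball 0 1) := by
    refine DifferentiableOn.diffContOnCl ?_
    rw [closure_ball _ one_ne_zero]
    exact (h.differentiableOn_abelianIntegral hs hs1).mono (Metric.closedBall_subset_ball one_lt_two)
  have := Complex.norm_iteratedDeriv_le_of_forall_mem_sphere_norm_le n one_pos hd (C := 63 / s)
    fun τ hτ => h.norm_abelianIntegral_le hs hs1 0 (by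
      rw [mem_sphere_iff_norm, sub_zero] at hτ
      rw [hτ]; norm_num) h.norm_sub_self_lt
  rwa [h.iteratedDeriv_abelianIntegral hs hs1, norm_mul, norm_pow, norm_neg, norm_one, one_pow,
    one_mul, div_one] at this

end IsSmallPerturbation

/-! ### Evaluation at `τ = 0` in terms of periods -/

theorem intervalIntegrable_of_continuousOn_Ioo_of_norm_le {f : ℝ → ℂ} {bd : ℝ → ℝ}
    (hbd : IntervalIntegrable bd volume 0 1) (hf : ContinuousOn f (Set.Ioo 0 1))
    (hle : ∀ t ∈ Set.Ioo (0 : ℝ) 1, ‖f t‖ ≤ bd t) : IntervalIntegrable f volume 0 1 := by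
  have hres : volume.restrict (Set.uIoc (0 : ℝ) 1) = volume.restrict (Set.Ioo (0 : ℝ) 1) := by
    rw [Set.uIoc_of_le zero_le_one]
    exact (Measure.restrict_congr_set Ioo_ae_eq_Ioc).symm
  refine hbd.mono_fun' ?_ ?_
  · rw [hres]
    exact hf.aestronglyMeasurable measurableSet_Ioo
  · rw [hres]
    exact (ae_restrict_mem measurableSet_Ioo).mono hle

theorem norm_mul_ofReal_cpow (c : ℂ) (p : ℝ) {t : ℝ} (ht : 0 ≤ t) :
    ‖(c * t) ^ (p : ℂ)‖ = ‖c‖ ^ p * t ^ p := by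
  rw [Complex.norm_cpow_real, norm_mul, Complex.norm_real, Real.norm_of_nonneg ht,
    Real.mul_rpow (norm_nonneg _) ht]

/-- Integration by parts: the end terms vanish at `0` because of the positive power and at the other
end because `arccos 1 = 0`. -/
theorem integral_arccosBranch_mul_cpow {p : ℝ} (hp : 0 < p) {v : ℂ} (hv : v ∈ Complex.slitPlane)
    (hv1 : ‖v‖ < 1) :
    IntervalIntegrable (fun t : ℝ => arccosBranch ((2 - v) * t - 1 + v) *
      ((2 - v) * t) ^ ((p : ℂ) - 1) * (2 - v)) volume 0 1 ∧
    ∫ t in (0 : ℝ)..1, arccosBranch ((2 - v) * t - 1 + v) * ((2 - v) * t) ^ ((p : ℂ) - 1) * (2 - v) =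
      periodIntegral p v / p := by
  have hE : v ∈ doubleSlitPlane := mem_doubleSlitPlane_of_norm_lt hv (by linarith)
  have hcre : 0 < (2 - v).re := by
    have := Complex.re_le_norm v
    rw [Complex.sub_re, Complex.re_ofNat]; linarith
  have hcn : ‖2 - v‖ ≤ 3 := by
    refine (norm_sub_le _ _).trans ?_
    rw [Complex.norm_ofNat]; linarith
  have hc : 2 - v ≠ 0 := Complex.slitPlane_ne_zero hE.2
  have hA1 : ∀ t : ℝ, 1 + ((2 - v) * t - 1 + v) = v + (2 - v) * t := fun t => by ring
  have hA2 : ∀ t : ℝ, 1 - ((2 - v) * t - 1 + v) = ((1 - t : ℝ) : ℂ) * (2 - v) := fun t => by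
    push_cast; ring
  have h1 : ∀ t ∈ Set.Icc (0 : ℝ) 1, 1 + ((2 - v) * t - 1 + v) ∈ Complex.slitPlane := fun t ht => by
    rw [hA1]; exact add_mul_mem_slitPlane hv ht
  have h2 : ∀ t ∈ Set.Icc (0 : ℝ) 1, 0 ≤ (1 - ((2 - v) * t - 1 + v)).re := fun t ht => by
    rw [hA2, Complex.re_ofReal_mul]
    exact mul_nonneg (by linarith [ht.2]) hcre.le
  have h3 : ∀ t ∈ Set.Ioo (0 : ℝ) 1, 1 - ((2 - v) * t - 1 + v) ∈ Complex.slitPlane := fun t ht => by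
    rw [hA2, Complex.mem_slitPlane_iff, Complex.re_ofReal_mul]
    exact Or.inl (mul_pos (by linarith [ht.2]) hcre)
  have hmem : ∀ t ∈ Set.Ioo (0 : ℝ) 1, (2 - v) * t ∈ Complex.slitPlane := fun t ht => by
    rw [Complex.mem_slitPlane_iff, Complex.re_mul_ofReal]
    exact Or.inl (mul_pos hcre ht.1)
  have hφ : ∀ t ∈ Set.Icc (0 : ℝ) 1, ContinuousAt (fun t : ℝ => arccosBranch ((2 - v) * t - 1 + v)) t :=
    fun t ht => ContinuousAt.comp (f := fun t : ℝ => (2 - v) * t - 1 + v)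
      (continuousAt_arccosBranch (h1 t ht) (h2 t ht)) (by fun_prop)
  have hφb : ∀ t ∈ Set.Icc (0 : ℝ) 1, ‖arccosBranch ((2 - v) * t - 1 + v)‖ ≤ 25 := fun t ht => by
    refine norm_arccosBranch_le ?_
    calc ‖(2 - v) * t - 1 + v‖ ≤ ‖(2 - v) * t‖ + ‖(1 : ℂ)‖ + ‖v‖ :=
          (norm_add_le _ _).trans (by gcongr; exact norm_sub_le _ _)
      _ ≤ 3 * 1 + 1 + 1 := by
          rw [norm_mul, Complex.norm_real, Real.norm_of_nonneg ht.1, norm_one]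
          have := ht.1
          have := ht.2
          gcongr
      _ ≤ 10 := by norm_num
  have dx : ∀ t : ℝ, HasDerivAt (fun t : ℝ => (2 - v) * t) (2 - v) t := fun t => by
    simpa using (hasDerivAt_id t).ofReal_comp.const_mul (2 - v)
  have i1 : IntervalIntegrable (fun t : ℝ => arccosBranch ((2 - v) * t - 1 + v) *
      ((2 - v) * t) ^ ((p : ℂ) - 1) * (2 - v)) volume 0 1 := by
    refine intervalIntegrable_of_continuousOn_Ioo_of_norm_le
      (bd := fun t => (25 * ‖2 - v‖ ^ (p - 1) * 3) * t ^ (p - 1))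
      ((intervalIntegral.intervalIntegrable_rpow' (by linarith)).const_mul _) (fun t ht => ?_)
      fun t ht => ?_
    · exact (((hφ t (Set.Ioo_subset_Icc_self ht)).mul (ContinuousAt.comp
        (f := fun t : ℝ => (2 - v) * t) ((hasDerivAt_id _).cpow_const (hmem t ht)).continuousAt
        (dx t).continuousAt)).mul continuousAt_const).continuousWithinAt
    · have h4 := hφb t (Set.Ioo_subset_Icc_self ht)
      have h5 : 0 ≤ t ^ (p - 1) := Real.rpow_nonneg ht.1.le _
      have h6 : 0 ≤ ‖2 - v‖ ^ (p - 1) := Real.rpow_nonneg (norm_nonneg _) _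
      rw [norm_mul, norm_mul, show (p : ℂ) - 1 = ((p - 1 : ℝ) : ℂ) by push_cast; ring,
        norm_mul_ofReal_cpow _ _ ht.1.le]
      calc _ ≤ 25 * (‖2 - v‖ ^ (p - 1) * t ^ (p - 1)) * 3 := by gcongr
        _ = _ := by ring
  refine ⟨i1, ?_⟩
  have i2 := (intervalIntegrable_periodIntegrand (p := p) (by rw [Complex.ofReal_re]; linarith)
    hE).const_mul ((p : ℂ)⁻¹)
  have hp0 : (p : ℂ) ≠ 0 := Complex.ofReal_ne_zero.2 hp.ne'
  have hb : Tendsto (fun t : ℝ => 25 * (‖2 - v‖ ^ p * t ^ p) * ‖(p : ℂ)⁻¹‖) (𝓝[>] 0) (𝓝 0) := by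
    have hts : ContinuousAt (fun t : ℝ => t ^ p) 0 :=
      Real.continuousAt_rpow_const _ _ (Or.inr hp.le)
    have h7 := (((hts.const_mul (‖2 - v‖ ^ p)).const_mul 25).mul_const ‖(p : ℂ)⁻¹‖).tendsto
    simp only [Real.zero_rpow hp.ne', zero_mul, mul_zero] at h7
    exact h7.mono_left nhdsWithin_le_nhds
  have key := intervalIntegral.integral_eq_sub_of_hasDerivAt_of_tendsto zero_lt_one
    (f := fun t : ℝ => arccosBranch ((2 - v) * t - 1 + v) * ((2 - v) * t) ^ (p : ℂ) * (p : ℂ)⁻¹)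
    (fa := 0) (fb := 0) (fun t ht => ?_) (i1.sub i2) ?_ ?_
  · rw [intervalIntegral.integral_sub i1 i2, intervalIntegral.integral_const_mul, sub_zero,
      sub_eq_zero] at key
    rw [key, periodIntegral]
    ring
  · have dφ : HasDerivAt (fun t : ℝ => arccosBranch ((2 - v) * t - 1 + v))
        (-((1 - ((2 - v) * t - 1 + v)) ^ (1 / 2 : ℂ) *
          (1 + ((2 - v) * t - 1 + v)) ^ (1 / 2 : ℂ))⁻¹ * (2 - v)) t :=
      HasDerivAt.comp t (hasDerivAt_arccosBranch (h1 t (Set.Ioo_subset_Icc_self ht)) (h3 t ht))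
        (((dx t).sub_const 1).add_const v)
    have dp : HasDerivAt (fun t : ℝ => ((2 - v) * t) ^ (p : ℂ))
        (p * ((2 - v) * t) ^ ((p : ℂ) - 1) * (2 - v)) t := by
      have := HasDerivAt.comp t ((hasDerivAt_id ((2 - v) * (t : ℂ))).cpow_const (c := (p : ℂ))
        (hmem t ht)) (dx t)
      exact this.congr_deriv (by simp only [id, mul_one])
    refine ((dφ.mul dp).mul_const _).congr_deriv ?_
    have t0 : (t : ℂ) ≠ 0 := Complex.ofReal_ne_zero.2 ht.1.ne'
    have m1 : ((2 - v) * t) ^ (p : ℂ) = t ^ (p : ℂ) * (2 - v) ^ (p : ℂ) := by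
      rw [mul_comm, ofReal_mul_cpow ht.1 hc]
    have m2 : (2 - v) ^ ((p : ℂ) + 1 / 2) * ((2 - v) ^ (1 / 2 : ℂ)) = (2 - v) ^ (p : ℂ) * (2 - v) := by
      rw [← Complex.cpow_add _ _ hc, show (p : ℂ) + 1 / 2 + 1 / 2 = p + 1 by ring,
        Complex.cpow_add _ _ hc, Complex.cpow_one]
    have n2 : (2 - v) ^ (1 / 2 : ℂ) ≠ 0 := by
      rw [Complex.cpow_ne_zero_iff_of_exponent_ne_zero (by norm_num)]
      exact hc
    rw [hA1, hA2, ofReal_mul_cpow (by linarith [ht.2]) hc, mul_inv, mul_inv]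
    have m3 : ((1 - t : ℝ) : ℂ) ^ (-(1 / 2) : ℂ) = (((1 - t : ℝ) : ℂ) ^ (1 / 2 : ℂ))⁻¹ :=
      Complex.cpow_neg _ _
    unfold periodIntegrand
    rw [Complex.cpow_neg (v + (2 - v) * t), show (1 - t : ℂ) = ((1 - t : ℝ) : ℂ) by push_cast; ring,
      m3, m1]
    have m4 : (2 - v) ^ ((p : ℂ) + 1 / 2) = (2 - v) ^ (p : ℂ) * (2 - v) * ((2 - v) ^ (1 / 2 : ℂ))⁻¹ := by
      rw [← m2, mul_inv_cancel_right₀ n2]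
    rw [m4]
    field_simp
    ring
  · rw [tendsto_zero_iff_norm_tendsto_zero]
    have hI0 : ∀ᶠ t : ℝ in 𝓝[>] 0, t ∈ Set.Ioo (0 : ℝ) 1 := Ioo_mem_nhdsGT zero_lt_one
    refine squeeze_zero' (Eventually.of_forall fun _ => norm_nonneg _) (hI0.mono fun t ht => ?_) hb
    have h4 := hφb t (Set.Ioo_subset_Icc_self ht)
    rw [norm_mul, norm_mul, norm_mul_ofReal_cpow _ _ ht.1.le]
    have h5 : 0 ≤ t ^ p := Real.rpow_nonneg ht.1.le _
    gcongr
  · have c1 := hφ 1 (by simp)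
    have c2 : ContinuousAt (fun t : ℝ => ((2 - v) * t) ^ (p : ℂ)) 1 := by
      refine ContinuousAt.comp (f := fun t : ℝ => (2 - v) * t) (g := fun z => z ^ (p : ℂ))
        ((hasDerivAt_id ((2 - v) * ((1 : ℝ) : ℂ))).cpow_const ?_).continuousAt (dx 1).continuousAt
      rw [id, Complex.ofReal_one, mul_one]
      exact hE.2
    have h7 : Tendsto (fun t : ℝ => arccosBranch ((2 - v) * t - 1 + v) * ((2 - v) * t) ^ (p : ℂ) *
        (p : ℂ)⁻¹) (𝓝 1) (𝓝 (arccosBranch ((2 - v) * (1 : ℝ) - 1 + v) *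
        ((2 - v) * (1 : ℝ)) ^ (p : ℂ) * (p : ℂ)⁻¹)) := ((c1.mul c2).mul_const ((p : ℂ)⁻¹)).tendsto
    rw [Complex.ofReal_one, show (2 - v) * 1 - 1 + v = 1 by ring, arccosBranch_one, zero_mul,
      zero_mul] at h7
    exact h7.mono_left nhdsWithin_le_nhds

theorem periodIntegral_div {p : ℝ} (hp : 0 < p) (v : ℂ) :
    periodIntegral p v / p = Complex.Gamma p / (2 * Real.pi * 2 ^ (p : ℂ)) * normPeriod p v := by
  have hp0 : (p : ℂ) ≠ 0 := Complex.ofReal_ne_zero.2 hp.ne'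
  have h2 : (2 : ℂ) ^ (p : ℂ) ≠ 0 := by simp
  have hG : Complex.Gamma p ≠ 0 := Complex.Gamma_ne_zero_of_re_pos (by simpa using hp)
  have hπ : (Real.pi : ℂ) ≠ 0 := Complex.ofReal_ne_zero.2 Real.pi_ne_zero
  rw [normPeriod, Complex.Gamma_add_one _ hp0]
  field_simp

namespace IsSmallPerturbation

variable {κ : ℝ} {v₀ : ℂ} {P : ℂ → ℂ} {s : ℝ}

theorem mem_slitPlane (h : IsSmallPerturbation κ v₀ P) {v : ℂ}
    (hv : ‖v - v₀‖ < κ / 200 * ‖v₀‖) : v ∈ Complex.slitPlane := by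
  have h1 := mem_slitPlane_of_angle (e := v - v₀) (t := 0) h.pos h.le_one h.ne_zero h.norm_lt h.angle
    le_rfl (by
      have := h.pos
      have h3 := norm_nonneg v₀
      rw [add_zero]
      refine hv.le.trans ?_
      gcongr
      norm_num)
  simpa using h1

/-- At `τ = 0` the root is `2 - v` and `A = z - 1 + v`, so each monomial of the weight contributes
one period. -/
theorem abelianIntegral_zero_eq (h : IsSmallPerturbation κ v₀ P) {n : ℕ} {ι : Type*} {I : Finset ι}
    {a : ι → ℂ} {p : ι → ℝ} (hp : ∀ i ∈ I, 0 < p i)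
    (hP : ∀ x ∈ rightSector, P x ^ n * x ^ ((s : ℂ) - 1) = ∑ i ∈ I, a i * x ^ ((p i : ℂ) - 1))
    {v : ℂ} (hv : ‖v - v₀‖ < κ / 200 * ‖v₀‖) :
    abelianIntegral P s n 0 v = ∑ i ∈ I, a i *
      (Complex.Gamma (p i) / (2 * Real.pi * 2 ^ (p i : ℂ))) * normPeriod (p i) v := by
  have hroot : perturbedRoot P 0 v = 2 - v := by
    have := (h.root_spec (τ := 0) (by simp) hv).2
    rwa [zero_mul, add_zero] at this
  have hv1 : ‖v‖ < 1 := (h.norm_lt_of_sub_lt hv).trans (by norm_num)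
  have hint := fun i hi => integral_arccosBranch_mul_cpow (hp i hi) (h.mem_slitPlane hv) hv1
  calc abelianIntegral P s n 0 v = ∫ t in (0 : ℝ)..1, ∑ i ∈ I, a i *
        (arccosBranch ((2 - v) * t - 1 + v) * ((2 - v) * t) ^ ((p i : ℂ) - 1) * (2 - v)) := by
        refine integral_congr_Ioo fun t ht => ?_
        have hmem := h.root_mul_mem (τ := 0) (by simp) hv ht.1
        rw [hroot] at hmem
        unfold abelianIntegrand perturbedA
        rw [hroot, hP _ hmem, Finset.mul_sum, Finset.sum_mul]
        refine Finset.sum_congr rfl fun i _ => ?_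
        rw [zero_mul, sub_zero]
        ring
    _ = ∑ i ∈ I, a i * (periodIntegral (p i) v / p i) := by
        rw [intervalIntegral.integral_finsetSum fun i hi => (hint i hi).1.const_mul _]
        refine Finset.sum_congr rfl fun i hi => ?_
        rw [intervalIntegral.integral_const_mul, (hint i hi).2]
    _ = _ := Finset.sum_congr rfl fun i hi => by rw [periodIntegral_div (hp i hi)]; ring

theorem iteratedDeriv_abelianIntegral_zero (h : IsSmallPerturbation κ v₀ P) {n : ℕ} {ι : Type*}
    {I : Finset ι} {a : ι → ℂ} {p : ι → ℝ} (hp : ∀ i ∈ I, 0 < p i)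
    (hP : ∀ x ∈ rightSector, P x ^ n * x ^ ((s : ℂ) - 1) = ∑ i ∈ I, a i * x ^ ((p i : ℂ) - 1)) :
    iteratedDeriv n (abelianIntegral P s n 0) v₀ = ∑ i ∈ I, a i *
      (Complex.Gamma (p i) / (2 * Real.pi * 2 ^ (p i : ℂ))) *
        ((-2) ^ n * longY ((n - p i) / 2) v₀) := by
  have hs0 := h.mem_slitPlane h.norm_sub_self_lt
  have hdisc : v₀ ∈ slitDisc := ⟨hs0, by linarith [h.norm_lt]⟩
  have he : abelianIntegral P s n 0 =ᶠ[𝓝 v₀] fun v => ∑ i ∈ I, a i *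
      (Complex.Gamma (p i) / (2 * Real.pi * 2 ^ (p i : ℂ))) * normPeriod (p i) v := by
    have h0 := h.norm_sub_self_lt
    rw [sub_self, norm_zero] at h0
    filter_upwards [Metric.ball_mem_nhds v₀ h0] with v hv
    exact h.abelianIntegral_zero_eq hp hP (mem_ball_iff_norm.1 hv)
  have hd : ∀ i ∈ I, ContDiffAt ℂ n (normPeriod (p i)) v₀ := fun i hi =>
    ((differentiableOn_normPeriod (by simpa using hp i hi)).contDiffOn
      isOpen_doubleSlitPlane).contDiffAt (isOpen_doubleSlitPlane.mem_nhds (slitDisc_subset hdisc))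
  rw [he.iteratedDeriv_eq, iteratedDeriv_fun_sum fun i hi => contDiffAt_const.mul (hd i hi)]
  refine Finset.sum_congr rfl fun i hi => ?_
  rw [iteratedDeriv_const_mul_field, iteratedDeriv_normPeriod_eq_longY (by simpa using hp i hi) n hdisc]

end IsSmallPerturbation

/-! ### Multi-index expansion and unconditional convergence -/

/-- Summation by total degree computes the unordered sum once the sums of norms over the degrees are
dominated by a summable series. -/
theorem hasSum_of_sum_piAntidiag {n : ℕ} {f : (Fin n → ℕ) → ℂ} {a : ℂ} {g : ℕ → ℝ}
    (hsum : HasSum (fun M => ∑ l ∈ Finset.piAntidiag Finset.univ M, f l) a) (hg : Summable g)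
    (hle : ∀ M, ∑ l ∈ Finset.piAntidiag Finset.univ M, ‖f l‖ ≤ g M) : HasSum f a := by
  have hmem : ∀ (M : ℕ) (l : Fin n → ℕ), l ∈ Finset.piAntidiag Finset.univ M ↔ ∑ j, l j = M :=
    fun M l => by simp
  have hfib : ∀ {E : Type} [AddCommMonoid E] [TopologicalSpace E] (F : (Fin n → ℕ) → E) (M : ℕ),
      HasSum (fun x : {l : Fin n → ℕ // ∑ j, l j = M} => F x)
        (∑ l ∈ Finset.piAntidiag Finset.univ M, F l) := fun F M =>
    (Equiv.hasSum_iff (Equiv.subtypeEquivRight (hmem M))).1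
      (Finset.hasSum (Finset.piAntidiag Finset.univ M) F)
  refine (Equiv.hasSum_iff (Equiv.sigmaFiberEquiv fun l : Fin n → ℕ => ∑ j, l j)).1 ?_
  refine HasSum.sigma_of_hasSum hsum (fun M => hfib f M) ?_
  refine Summable.of_norm ?_
  rw [summable_sigma_of_nonneg fun _ => norm_nonneg _]
  refine ⟨fun M => (hfib (fun l => ‖f l‖) M).summable, ?_⟩
  refine Summable.of_nonneg_of_le (fun M => tsum_nonneg fun _ => norm_nonneg _) (fun M => ?_) hg
  exact (hfib (fun l => ‖f l‖) M).tsum_eq.trans_le (hle M)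

/-- Weighted arithmetic-geometric mean inequality. It is the reason for the scaling `u_n = v^(1 -
n/N) v_n`: every term of `P` is small relative to `|v| + |z|`, uniformly as `v → 0`. -/
theorem norm_cpow_mul_cpow_le (v z : ℂ) {θ : ℝ} (h0 : 0 ≤ θ) (h1 : θ ≤ 1) :
    ‖v ^ ((1 - θ : ℝ) : ℂ) * z ^ (θ : ℂ)‖ ≤ ‖v‖ + ‖z‖ := by
  rw [norm_mul, Complex.norm_cpow_real, Complex.norm_cpow_real]
  have := Real.geom_mean_le_arith_mean2_weighted (by linarith : 0 ≤ 1 - θ) h0 (norm_nonneg v)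
    (norm_nonneg z) (by ring)
  nlinarith [norm_nonneg v, norm_nonneg z]

/-- The exponent `n / N` of the modulus `uₙ`. -/
noncomputable def swExp (N : ℕ) (j : Fin (N - 2)) : ℝ := ((j : ℕ) + 1) / N

theorem swExp_nonneg {N : ℕ} (j : Fin (N - 2)) : 0 ≤ swExp N j := by
  unfold swExp; positivity

theorem swExp_le_one {N : ℕ} (j : Fin (N - 2)) : swExp N j ≤ 1 := by
  unfold swExp
  have h : (j : ℕ) + 1 ≤ N := by have := j.2; omega
  have h2 : ((j : ℕ) : ℝ) + 1 ≤ N := by exact_mod_cast h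
  exact div_le_one_of_le₀ h2 (Nat.cast_nonneg _)

/-- The part of `A` that depends on `u₁, …, u_{N-2}`, in the coordinate `z = x ^ N`. -/
noncomputable def swPerturbation (N : ℕ) (ξ v : ℂ) (w : Fin (N - 2) → ℂ) (z : ℂ) : ℂ :=
  ∑ j, v ^ ((1 - swExp N j : ℝ) : ℂ) * w j * ξ ^ ((j : ℕ) + 1) * z ^ (swExp N j : ℂ)

theorem sum_swExp_mul {N : ℕ} (hN : 3 ≤ N) (l : Fin (N - 2) → ℕ) :
    ∑ j, swExp N j * l j = ((wtL l : ℝ) - 1) / N := by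
  have h : (N : ℝ) ≠ 0 := Nat.cast_ne_zero.2 (by omega)
  unfold wtL swExp
  push_cast
  rw [add_sub_cancel_left, Finset.sum_div]
  exact Finset.sum_congr rfl fun j _ => by ring

theorem prod_pow_eq_cpow {n : ℕ} {z : ℂ} (hz : z ≠ 0) (e : Fin n → ℂ) (l : Fin n → ℕ) :
    ∏ j, (z ^ e j) ^ l j = z ^ (∑ j, e j * l j) := by
  rw [Complex.cpow_def_of_ne_zero hz, Finset.mul_sum, Complex.exp_sum]
  refine Finset.prod_congr rfl fun j _ => ?_
  rw [Complex.cpow_def_of_ne_zero hz, ← Complex.exp_nat_mul]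
  congr 1
  ring

theorem prod_cpow_one_sub_swExp {N : ℕ} (hN : 3 ≤ N) {v : ℂ} (hv : v ≠ 0) (l : Fin (N - 2) → ℕ) :
    ∏ j, (v ^ ((1 - swExp N j : ℝ) : ℂ)) ^ l j =
      v ^ ((wtM l - ((wtL l : ℝ) - 1) / N : ℝ) : ℂ) := by
  rw [prod_pow_eq_cpow hv, ← sum_swExp_mul hN, wtM]
  congr 1
  push_cast
  rw [← Finset.sum_sub_distrib]
  exact Finset.sum_congr rfl fun j _ => by ring

theorem prod_pow_succ_mul {N : ℕ} (ξ : ℂ) (l : Fin (N - 2) → ℕ) :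
    ξ * ∏ j : Fin (N - 2), (ξ ^ ((j : ℕ) + 1)) ^ l j = ξ ^ wtL l := by
  unfold wtL
  rw [pow_add, pow_one, ← Finset.prod_pow_eq_pow_sum]
  simp only [pow_mul]

/-- The exponents `n/N` chosen in a multi-index add up to `(L - 1)/N`, and the weight `z^(1/N - 1)`
completes this to `L/N - 1`. -/
theorem swPerturbation_pow_mul {N : ℕ} (hN : 3 ≤ N) (ξ v : ℂ) (w : Fin (N - 2) → ℂ) (n : ℕ) {z : ℂ}
    (hz : z ≠ 0) :
    swPerturbation N ξ v w z ^ n * z ^ (((1 / N : ℝ) : ℂ) - 1) =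
      ∑ l ∈ Finset.piAntidiag Finset.univ n, ((Nat.multinomial Finset.univ l : ℂ) *
        ∏ j, (v ^ ((1 - swExp N j : ℝ) : ℂ) * w j * ξ ^ ((j : ℕ) + 1)) ^ l j) *
          z ^ (((wtL l / N : ℝ) : ℂ) - 1) := by
  unfold swPerturbation
  rw [Finset.sum_pow_eq_sum_piAntidiag, Finset.sum_mul]
  refine Finset.sum_congr rfl fun l _ => ?_
  have hm : ∀ j, (v ^ ((1 - swExp N j : ℝ) : ℂ) * w j * ξ ^ ((j : ℕ) + 1) *
      z ^ (swExp N j : ℂ)) ^ l j = (v ^ ((1 - swExp N j : ℝ) : ℂ) * w j * ξ ^ ((j : ℕ) + 1)) ^ l j *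
      (z ^ (swExp N j : ℂ)) ^ l j := fun j => mul_pow _ _ _
  simp only [hm]
  rw [Finset.prod_mul_distrib]
  rw [prod_pow_eq_cpow hz, ← mul_assoc, mul_assoc _ (z ^ _), ← Complex.cpow_add _ _ hz]
  congr 2
  have h := congrArg (fun x : ℝ => (x : ℂ)) (sum_swExp_mul hN l)
  push_cast at h ⊢
  rw [h]
  ring

theorem differentiableOn_swPerturbation (N : ℕ) (ξ v : ℂ) (w : Fin (N - 2) → ℂ) :
    DifferentiableOn ℂ (swPerturbation N ξ v w) rightSector := by
  unfold swPerturbation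
  refine DifferentiableOn.fun_sum fun j _ => ?_
  refine DifferentiableOn.const_mul (fun z hz => ?_) _
  exact ((hasDerivAt_id z).cpow_const
    (rightSector_subset_slitPlane hz)).differentiableAt.differentiableWithinAt

theorem norm_swPerturbation_le {N : ℕ} {ξ : ℂ} (hξ : ‖ξ‖ = 1) (v : ℂ) {w : Fin (N - 2) → ℂ} {δ : ℝ}
    (hw : ∀ j, ‖w j‖ ≤ δ) (z : ℂ) :
    ‖swPerturbation N ξ v w z‖ ≤ (N - 2 : ℕ) * δ * (‖v‖ + ‖z‖) := by
  unfold swPerturbation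
  refine (norm_sum_le _ _).trans ?_
  have : ∀ j ∈ (Finset.univ : Finset (Fin (N - 2))), ‖v ^ ((1 - swExp N j : ℝ) : ℂ) * w j *
      ξ ^ ((j : ℕ) + 1) * z ^ (swExp N j : ℂ)‖ ≤ δ * (‖v‖ + ‖z‖) := fun j _ => by
    rw [show v ^ ((1 - swExp N j : ℝ) : ℂ) * w j * ξ ^ ((j : ℕ) + 1) * z ^ (swExp N j : ℂ) =
      w j * ξ ^ ((j : ℕ) + 1) * (v ^ ((1 - swExp N j : ℝ) : ℂ) * z ^ (swExp N j : ℂ)) by ring,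
      norm_mul, norm_mul, norm_pow, hξ, one_pow, mul_one]
    gcongr
    · exact (norm_nonneg _).trans (hw j)
    · exact hw j
    · exact norm_cpow_mul_cpow_le v z (swExp_nonneg j) (swExp_le_one j)
  refine (Finset.sum_le_card_nsmul _ _ _ this).trans ?_
  rw [Finset.card_univ, Fintype.card_fin, nsmul_eq_mul, mul_assoc]

theorem norm_prod_coeff_le {N : ℕ} (hN : 3 ≤ N) {ξ : ℂ} (hξ : ‖ξ‖ = 1) {v : ℂ} (hv : v ≠ 0)
    {w : Fin (N - 2) → ℂ} {δ : ℝ} (hw : ∀ j, ‖w j‖ ≤ δ) (l : Fin (N - 2) → ℕ) :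
    ‖∏ j, (v ^ ((1 - swExp N j : ℝ) : ℂ) * w j * ξ ^ ((j : ℕ) + 1)) ^ l j‖ ≤
      ‖v‖ ^ (wtM l - ((wtL l : ℝ) - 1) / N) * δ ^ wtM l := by
  simp only [mul_pow, Finset.prod_mul_distrib]
  rw [norm_mul, norm_mul, prod_cpow_one_sub_swExp hN hv, Complex.norm_cpow_real, norm_prod,
    norm_prod]
  have h1 : ∏ j : Fin (N - 2), ‖(ξ ^ ((j : ℕ) + 1)) ^ l j‖ = 1 :=
    Finset.prod_eq_one fun j _ => by rw [norm_pow, norm_pow, hξ, one_pow, one_pow]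
  rw [h1, mul_one, wtM, ← Finset.prod_pow_eq_pow_sum]
  gcongr with j _
  rw [norm_pow]
  exact pow_le_pow_left₀ (norm_nonneg _) (hw j) _

theorem wtL_ge_one {N : ℕ} (l : Fin (N - 2) → ℕ) : 1 ≤ wtL l := by unfold wtL; omega

theorem IsSmallPerturbation.congr_right {κ : ℝ} {v : ℂ} {P Q : ℂ → ℂ}
    (h : IsSmallPerturbation κ v P) (hd : DifferentiableOn ℂ Q rightSector)
    (hQ : ∀ z ∈ rightSector, ‖Q z‖ ≤ κ / 200 * (‖v‖ + ‖z‖)) : IsSmallPerturbation κ v Q :=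
  ⟨h.pos, h.le_one, h.ne_zero, h.norm_lt, h.angle, hd, hQ⟩

theorem isSmallPerturbation_swPerturbation {κ : ℝ} {v : ℂ} {P : ℂ → ℂ}
    (h : IsSmallPerturbation κ v P) {N : ℕ} (hN : 3 ≤ N) {ξ : ℂ} (hξ : ‖ξ‖ = 1)
    {w : Fin (N - 2) → ℂ} (hw : ∀ j, ‖w j‖ ≤ κ / (400 * N)) :
    IsSmallPerturbation κ v (swPerturbation N ξ v w) := by
  refine h.congr_right (differentiableOn_swPerturbation N ξ v w) fun z _ =>
    (norm_swPerturbation_le hξ v hw z).trans ?_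
  have hκ := h.pos
  have hN0 : (0 : ℝ) < N := Nat.cast_pos.2 (by omega)
  have h1 : ((N - 2 : ℕ) : ℝ) ≤ N := Nat.cast_le.2 (Nat.sub_le _ _)
  gcongr
  rw [mul_div_assoc', div_le_div_iff₀ (by positivity) (by norm_num)]
  nlinarith

/-- The coefficient depends on `ℓ` only through `M` and `L`. The single-term perturbation `(κ/200)
v^(1-θ) z^θ` with `M θ = (L - 1)/N` therefore produces the same one in its `M`-th derivative, and
`norm_iteratedDeriv_abelianIntegral_le` bounds it. -/
theorem norm_coeff_mul_le {κ : ℝ} {v : ℂ} {P : ℂ → ℂ} (h : IsSmallPerturbation κ v P) {N : ℕ}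
    (hN : 3 ≤ N) (l : Fin (N - 2) → ℕ) :
    ‖v‖ ^ (wtM l - ((wtL l : ℝ) - 1) / N) *
      ‖Complex.Gamma ((wtL l / N : ℝ) : ℂ) / (2 * Real.pi * 2 ^ ((wtL l / N : ℝ) : ℂ)) *
        ((-2) ^ wtM l * longY ((wtM l - ((wtL l / N : ℝ) : ℂ)) / 2) v)‖ ≤
      (200 / κ) ^ wtM l * ((wtM l).factorial * (63 * N)) := by
  have hκ := h.pos
  have hN0 : (0 : ℝ) < N := Nat.cast_pos.2 (by omega)
  have hL : (1 : ℝ) ≤ wtL l := Nat.one_le_cast.2 (wtL_ge_one l)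
  have hLM : (wtL l : ℝ) - 1 ≤ N * wtM l := by
    have h1 := wtL_le l
    have h2 : (N - 2) * wtM l ≤ N * wtM l := Nat.mul_le_mul_right _ (Nat.sub_le _ _)
    have h3 : (wtL l : ℝ) ≤ ((1 + N * wtM l : ℕ) : ℝ) := Nat.cast_le.2 (by omega)
    push_cast at h3
    linarith
  set n := wtM l with hn
  -- For `M = 0` this is a division by zero with value `0`, which is consistent because then `L =
  -- 1`.
  set θ : ℝ := ((wtL l : ℝ) - 1) / (N * n) with hθ
  have hnθ : n * θ = ((wtL l : ℝ) - 1) / N := by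
    rcases Nat.eq_zero_or_pos n with h0 | h0
    · rw [h0] at hLM ⊢
      have : (wtL l : ℝ) - 1 = 0 := by
        push_cast at hLM; linarith
      rw [this]; simp
    · have : (n : ℝ) ≠ 0 := Nat.cast_ne_zero.2 h0.ne'
      rw [hθ]; field_simp
  have hθ0 : 0 ≤ θ := by
    rw [hθ]
    exact div_nonneg (by linarith) (by positivity)
  have hθ1 : θ ≤ 1 := div_le_one_of_le₀ hLM (by positivity)
  have hQ : IsSmallPerturbation κ v
      (fun z => ((κ / 200 : ℝ) : ℂ) * v ^ ((1 - θ : ℝ) : ℂ) * z ^ (θ : ℂ)) := by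
    refine h.congr_right (fun z hz => ?_) fun z _ => ?_
    · exact (((hasDerivAt_id z).cpow_const
        (rightSector_subset_slitPlane hz)).differentiableAt.const_mul _).differentiableWithinAt
    · rw [mul_assoc, norm_mul, Complex.norm_real, Real.norm_of_nonneg (by positivity)]
      gcongr
      exact norm_cpow_mul_cpow_le v z hθ0 hθ1
  have hs : (0 : ℝ) < 1 / N := by positivity
  have hs1 : (1 : ℝ) / N ≤ 1 := by
    rw [div_le_one hN0]
    exact Nat.one_le_cast.2 (by omega)
  have h1 := hQ.norm_iteratedDeriv_abelianIntegral_le hs hs1 n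
  rw [hQ.iteratedDeriv_abelianIntegral_zero (I := {()})
    (a := fun _ => (((κ / 200 : ℝ) : ℂ) * v ^ ((1 - θ : ℝ) : ℂ)) ^ n)
    (p := fun _ => (wtL l : ℝ) / N) (fun _ _ => by positivity) (fun x hx => ?_),
    Finset.sum_singleton, mul_assoc, norm_mul, norm_pow, norm_mul, Complex.norm_real,
    Real.norm_of_nonneg (by positivity), Complex.norm_cpow_real, mul_pow] at h1
  · have e1 : (‖v‖ ^ (1 - θ)) ^ n = ‖v‖ ^ (n - ((wtL l : ℝ) - 1) / N) := by
      rw [← Real.rpow_natCast, ← Real.rpow_mul (norm_nonneg _), ← hnθ]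
      congr 1; ring
    rw [e1] at h1
    have e2 : (200 / κ) ^ n * (κ / 200) ^ n = 1 := by
      rw [← mul_pow, div_mul_div_cancel₀ hκ.ne', div_self (by norm_num), one_pow]
    have h2 := mul_le_mul_of_nonneg_left h1 (by positivity : 0 ≤ (200 / κ) ^ n)
    rw [mul_assoc ((κ / 200) ^ n), ← mul_assoc, e2, one_mul] at h2
    refine h2.trans_eq ?_
    congr 2
    field_simp
  · have hx0 := Complex.slitPlane_ne_zero (rightSector_subset_slitPlane hx)
    rw [Finset.sum_singleton, mul_pow, mul_assoc, ← Complex.cpow_nat_mul, ← Complex.cpow_add _ _ hx0]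
    congr 2
    have := congrArg (fun x : ℝ => (x : ℂ)) hnθ
    push_cast at this ⊢
    rw [this]
    ring

/-- Brings a term into the shape of the Taylor expansion: the multinomial coefficient over `M!` is
`1 / ∏ ℓ_j!`, and the signs `(-1)^M` from the exchange of derivatives and from the ladder cancel. -/
theorem longTerm_eq {N : ℕ} (hN : 3 ≤ N) (ξ : ℂ) {v : ℂ} (hv : v ≠ 0) (w : Fin (N - 2) → ℂ)
    (l : Fin (N - 2) → ℕ) :
    longTerm N ξ v w l = ξ / (Real.pi * N) * (((wtM l).factorial : ℂ)⁻¹ * ((-1) ^ wtM l *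
      (((Nat.multinomial Finset.univ l : ℂ) *
        ∏ j, (v ^ ((1 - swExp N j : ℝ) : ℂ) * w j * ξ ^ ((j : ℕ) + 1)) ^ l j) *
      (Complex.Gamma ((wtL l / N : ℝ) : ℂ) / (2 * Real.pi * 2 ^ ((wtL l / N : ℝ) : ℂ))) *
        ((-2) ^ wtM l * longY ((wtM l - ((wtL l / N : ℝ) : ℂ)) / 2) v)))) := by
  have hN0 : (N : ℂ) ≠ 0 := Nat.cast_ne_zero.2 (by omega)
  have hπ : (Real.pi : ℂ) ≠ 0 := Complex.ofReal_ne_zero.2 Real.pi_ne_zero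
  have hα : (wtM l - ((wtL l / N : ℝ) : ℂ)) / 2 = wtAlpha l := by
    unfold wtAlpha
    push_cast
    field_simp
  have hmul : (((wtM l).factorial : ℂ)) =
      (∏ j, ((l j).factorial : ℂ)) * Nat.multinomial Finset.univ l := by
    rw [wtM, ← Nat.multinomial_spec]
    push_cast
    rfl
  have hfac : ∏ j, ((l j).factorial : ℂ) ≠ 0 :=
    Finset.prod_ne_zero_iff.2 fun j _ => Nat.cast_ne_zero.2 (Nat.factorial_ne_zero _)
  have hm0 : (Nat.multinomial Finset.univ l : ℂ) ≠ 0 := fun h0 => by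
    rw [h0, mul_zero] at hmul
    exact Nat.cast_ne_zero.2 (Nat.factorial_ne_zero _) hmul
  have h2 : (2 : ℂ) ^ ((wtM l : ℂ) - (wtL l : ℂ) / N) =
      2 ^ wtM l * (2 ^ ((wtL l / N : ℝ) : ℂ))⁻¹ := by
    rw [Complex.cpow_sub _ _ two_ne_zero, Complex.cpow_natCast]
    push_cast
    rfl
  have hvexp : v ^ (((N : ℂ) * wtM l - wtL l + 1) / N) =
      v ^ ((wtM l - ((wtL l : ℝ) - 1) / N : ℝ) : ℂ) := by
    congr 1
    push_cast
    field_simp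
    ring
  have hsign : (-2 : ℂ) ^ wtM l = (-1) ^ wtM l * 2 ^ wtM l := by rw [← mul_pow]; norm_num
  have hsign2 : (-1 : ℂ) ^ wtM l * (-1) ^ wtM l = 1 := by rw [← mul_pow]; norm_num
  have h2ne : (2 : ℂ) ^ ((wtL l / N : ℝ) : ℂ) ≠ 0 := by
    rw [Complex.cpow_def_of_ne_zero two_ne_zero]; exact Complex.exp_ne_zero _
  have hΓ : ((wtL l : ℂ) / N) = ((wtL l / N : ℝ) : ℂ) := by push_cast; rfl
  rw [hα, longTerm, h2, hvexp, hΓ, ← prod_cpow_one_sub_swExp hN hv, ← prod_pow_succ_mul, hmul, hsign,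
    Finset.prod_div_distrib]
  simp only [mul_pow, Finset.prod_mul_distrib]
  generalize ∏ j, ((l j).factorial : ℂ) = D at *
  generalize (Nat.multinomial Finset.univ l : ℂ) = m at *
  generalize (2 : ℂ) ^ ((wtL l / N : ℝ) : ℂ) = t at *
  generalize Complex.Gamma ((wtL l / N : ℝ) : ℂ) = G
  generalize longY (wtAlpha l) v = Y
  generalize ∏ j, (v ^ ((1 - swExp N j : ℝ) : ℂ)) ^ l j = V
  generalize ∏ j : Fin (N - 2), (ξ ^ ((j : ℕ) + 1)) ^ l j = X
  generalize ∏ j, w j ^ l j = W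
  generalize (2 : ℂ) ^ wtM l = T
  generalize (-1 : ℂ) ^ wtM l = S at *
  field_simp
  linear_combination -(T * ξ * X * G * Y * V * W) * hsign2

/-- The terms with `M = n` add up to the `n`-th Taylor term. Their norms add up to at most `63 /
2^n`: each is bounded by `63 (1/(2N))^n` times its multinomial coefficient, and these coefficients
sum to `(N - 2)^n`. -/
theorem hasSum_longTerm {κ : ℝ} {v : ℂ} {P : ℂ → ℂ} (h : IsSmallPerturbation κ v P) {N : ℕ}
    (hN : 3 ≤ N) {ξ : ℂ} (hξ : ‖ξ‖ = 1) {w : Fin (N - 2) → ℂ}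
    (hw : ∀ j, ‖w j‖ ≤ κ / (400 * N)) :
    HasSum (longTerm N ξ v w) (ξ / (Real.pi * N) *
      abelianIntegral (swPerturbation N ξ v w) (1 / N) 0 1 v) := by
  have hS := isSmallPerturbation_swPerturbation h hN hξ hw
  have hN0 : (0 : ℝ) < N := Nat.cast_pos.2 (by omega)
  have hκ := h.pos
  have hs : (0 : ℝ) < 1 / N := by positivity
  have hs1 : (1 : ℝ) / N ≤ 1 := by
    rw [div_le_one hN0]
    exact Nat.one_le_cast.2 (by omega)
  refine hasSum_of_sum_piAntidiag (g := fun n => 63 * (1 / 2) ^ n) ?_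
    ((summable_geometric_two).mul_left 63) fun n => ?_
  · refine ((hS.hasSum_abelianIntegral hs hs1).mul_left (ξ / (Real.pi * N))).congr_fun fun n => ?_
    rw [hS.iteratedDeriv_abelianIntegral_zero (fun l _ => div_pos (Nat.cast_pos.2 (wtL_ge_one l)) hN0)
      (fun x hx => swPerturbation_pow_mul hN ξ v w n
        (Complex.slitPlane_ne_zero (rightSector_subset_slitPlane hx))), Finset.mul_sum,
      Finset.mul_sum, Finset.mul_sum]
    refine Finset.sum_congr rfl fun l hl => ?_
    have hn : wtM l = n := by simpa [wtM] using hl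
    rw [longTerm_eq hN ξ h.ne_zero w l, hn]
  · have hterm : ∀ l ∈ Finset.piAntidiag (Finset.univ : Finset (Fin (N - 2))) n,
        ‖longTerm N ξ v w l‖ ≤ 63 * (1 / (2 * N)) ^ n * Nat.multinomial Finset.univ l := by
      intro l hl
      have hn : wtM l = n := by simpa [wtM] using hl
      have b1 := norm_prod_coeff_le hN hξ h.ne_zero hw l
      have b2 := norm_coeff_mul_le h hN l
      rw [longTerm_eq hN ξ h.ne_zero w l, mul_assoc (_ * ∏ j, _)]
      rw [hn] at *
      have hf : (0 : ℝ) < n.factorial := Nat.cast_pos.2 (Nat.factorial_pos n)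
      generalize Complex.Gamma ((wtL l / N : ℝ) : ℂ) / (2 * Real.pi * 2 ^ ((wtL l / N : ℝ) : ℂ)) *
        ((-2) ^ n * longY ((n - ((wtL l / N : ℝ) : ℂ)) / 2) v) = B at *
      generalize ∏ j, (v ^ ((1 - swExp N j : ℝ) : ℂ) * w j * ξ ^ ((j : ℕ) + 1)) ^ l j = Q at *
      generalize ‖v‖ ^ (n - ((wtL l : ℝ) - 1) / N) = V at *
      simp only [norm_mul, norm_div, norm_inv, norm_pow, norm_neg, norm_one, one_pow, one_mul, hξ,
        Complex.norm_natCast, Complex.norm_real, Real.norm_of_nonneg Real.pi_pos.le]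
      have hδ : (κ / (400 * N)) ^ n * (200 / κ) ^ n = (1 / (2 * N)) ^ n := by
        rw [← mul_pow]
        congr 1
        field_simp
        norm_num
      have hQB : ‖Q‖ * ‖B‖ ≤ (1 / (2 * N)) ^ n * (n.factorial * (63 * N)) := by
        calc ‖Q‖ * ‖B‖ ≤ V * (κ / (400 * N)) ^ n * ‖B‖ := by gcongr
          _ = (κ / (400 * N)) ^ n * (V * ‖B‖) := by ring
          _ ≤ (κ / (400 * N)) ^ n * ((200 / κ) ^ n * (n.factorial * (63 * N))) := by gcongr
          _ = _ := by rw [← mul_assoc, hδ]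
      have hπ : 1 / Real.pi ≤ 1 := by
        rw [div_le_one Real.pi_pos]
        linarith [Real.pi_gt_three]
      calc 1 / (Real.pi * N) * ((n.factorial : ℝ)⁻¹ * (Nat.multinomial Finset.univ l * ‖Q‖ * ‖B‖))
          = 1 / (Real.pi * N) * ((n.factorial : ℝ)⁻¹ * Nat.multinomial Finset.univ l) *
              (‖Q‖ * ‖B‖) := by ring
        _ ≤ 1 / (Real.pi * N) * ((n.factorial : ℝ)⁻¹ * Nat.multinomial Finset.univ l) *
              ((1 / (2 * N)) ^ n * (n.factorial * (63 * N))) := by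
            have := Real.pi_pos
            gcongr
        _ = 1 / Real.pi * (63 * (1 / (2 * N)) ^ n * Nat.multinomial Finset.univ l) := by
            field_simp
        _ ≤ 1 * (63 * (1 / (2 * N)) ^ n * Nat.multinomial Finset.univ l) := by gcongr
        _ = _ := one_mul _
    refine (Finset.sum_le_sum hterm).trans ?_
    have hmult : ∑ l ∈ Finset.piAntidiag (Finset.univ : Finset (Fin (N - 2))) n,
        (Nat.multinomial Finset.univ l : ℝ) = ((N - 2 : ℕ) : ℝ) ^ n := by
      have := Finset.sum_pow_eq_sum_piAntidiag (Finset.univ : Finset (Fin (N - 2)))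
        (fun _ => (1 : ℝ)) n
      simpa using this.symm
    rw [← Finset.mul_sum, hmult, mul_assoc, ← mul_pow]
    have h1 : ((N - 2 : ℕ) : ℝ) ≤ N := Nat.cast_le.2 (Nat.sub_le _ _)
    gcongr
    rw [div_mul_eq_mul_div, one_mul, div_le_div_iff₀ (by positivity) (by norm_num)]
    linarith

/-! ### From the curve to the integral of the inverse cosine -/

theorem contDiff_swA (N : ℕ) (u : SWModuli N) : ContDiff ℂ ⊤ (swA N u) := by
  unfold swA
  fun_prop

/-- Integrate the derivative of `x arccos(A)` along the segment; it vanishes at both ends. The bound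
`1 - t ≤ Re (1 - A)` gives continuity of `√(1 - A)`, its nonvanishing before the end point and the
integrability of `1/y`. -/
theorem isAbelianQ_of_arccosBranch {N : ℕ} {u : SWModuli N} {b : ℂ}
    (h1 : ∀ t ∈ Set.Icc (0 : ℝ) 1, 1 + swA N u (t * b) ∈ Complex.slitPlane)
    (h2 : ∀ t ∈ Set.Icc (0 : ℝ) 1, 1 - t ≤ (1 - swA N u (t * b)).re) (hb : swA N u b = 1)
    (h0 : swA N u 0 = -u.1) :
    IsAbelianQ N u b (1 / Real.pi * ∫ t in (0 : ℝ)..1, arccosBranch (swA N u (t * b)) * b) := by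
  have hA : Continuous fun t : ℝ => swA N u (t * b) :=
    (contDiff_swA N u).continuous.comp (by fun_prop)
  have hA' : Continuous fun t : ℝ => deriv (swA N u) (t * b) :=
    ((contDiff_swA N u).continuous_deriv le_top).comp (by fun_prop)
  have hp : ContinuousOn (fun t : ℝ => (1 + swA N u (t * b)) ^ (1 / 2 : ℂ)) (Set.Icc 0 1) :=
    fun t ht => (ContinuousAt.comp (f := fun t : ℝ => 1 + swA N u (t * b))
      ((hasDerivAt_id (1 + swA N u (t * b))).cpow_const (h1 t ht)).continuousAt
      (continuous_const.add hA).continuousAt).continuousWithinAt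
  have hm : ContinuousOn (fun t : ℝ => (1 - swA N u (t * b)) ^ (1 / 2 : ℂ)) (Set.Icc 0 1) :=
    fun t ht => (ContinuousAt.comp (f := fun t : ℝ => 1 - swA N u (t * b))
      (Complex.continuousAt_cpow_const_of_re_pos (Or.inl (by linarith [h2 t ht, ht.2]))
      (by norm_num)) (continuous_const.sub hA).continuousAt).continuousWithinAt
  have hφ : ContinuousOn (fun t : ℝ => arccosBranch (swA N u (t * b))) (Set.Icc 0 1) :=
    fun t ht => (ContinuousAt.comp (f := fun t : ℝ => swA N u (t * b))
      (continuousAt_arccosBranch (h1 t ht) (by linarith [h2 t ht, ht.2]))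
      hA.continuousAt).continuousWithinAt
  have hpne : ∀ t ∈ Set.Icc (0 : ℝ) 1, (1 + swA N u (t * b)) ^ (1 / 2 : ℂ) ≠ 0 := fun t ht => by
    rw [Complex.cpow_ne_zero_iff_of_exponent_ne_zero (by norm_num)]
    exact Complex.slitPlane_ne_zero (h1 t ht)
  have hms : ∀ t ∈ Set.Ico (0 : ℝ) 1, 1 - swA N u (t * b) ∈ Complex.slitPlane := fun t ht => by
    rw [Complex.mem_slitPlane_iff]
    exact Or.inl (by linarith [h2 t (Set.Ico_subset_Icc_self ht), ht.2])
  have hmne : ∀ t ∈ Set.Ico (0 : ℝ) 1, (1 - swA N u (t * b)) ^ (1 / 2 : ℂ) ≠ 0 := fun t ht => by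
    rw [Complex.cpow_ne_zero_iff_of_exponent_ne_zero (by norm_num)]
    exact Complex.slitPlane_ne_zero (hms t ht)
  -- At `t = 0` this is the prescribed starting point, since `A(0) = -u₀`.
  set y : ℝ → ℂ := fun t => -Complex.I * (1 + swA N u (t * b)) ^ (1 / 2 : ℂ) *
    (1 - swA N u (t * b)) ^ (1 / 2 : ℂ) with hy
  have hint : IntervalIntegrable (fun t : ℝ => (t * b) * deriv (swA N u) (t * b) / y t * b)
      volume 0 1 := by
    have hcn : ContinuousOn (fun t : ℝ => (t * b) * deriv (swA N u) (t * b) * b /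
        (-Complex.I * (1 + swA N u (t * b)) ^ (1 / 2 : ℂ))) (Set.Icc 0 1) :=
      ContinuousOn.div (by fun_prop) (continuousOn_const.mul hp) fun t ht =>
        mul_ne_zero (neg_ne_zero.2 Complex.I_ne_zero) (hpne t ht)
    obtain ⟨C, hC⟩ := isCompact_Icc.exists_bound_of_continuousOn hcn
    have hy' : ∀ t : ℝ, (t * b) * deriv (swA N u) (t * b) / y t * b =
        (t * b) * deriv (swA N u) (t * b) * b /
        (-Complex.I * (1 + swA N u (t * b)) ^ (1 / 2 : ℂ)) *
          ((1 - swA N u (t * b)) ^ (1 / 2 : ℂ))⁻¹ := fun t => by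
      simp only [hy, div_eq_mul_inv, mul_inv]
      ring
    simp only [hy']
    refine intervalIntegrable_of_continuousOn_Ioo_of_norm_le
      (bd := fun t => C * (t ^ (0 : ℝ) * (1 - t) ^ (-(1 / 2) : ℝ)))
      ((intervalIntegrable_rpow_mul_one_sub_rpow (by norm_num) (by norm_num)).const_mul C)
      ((hcn.mono Set.Ioo_subset_Icc_self).mul ((hm.mono Set.Ioo_subset_Icc_self).inv₀ fun t ht =>
        hmne t (Set.Ioo_subset_Ico_self ht))) fun t ht => ?_
    have ht1 : 0 < 1 - t := by linarith [ht.2]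
    have b1 : 1 - t ≤ ‖1 - swA N u (t * b)‖ :=
      (h2 t (Set.Ioo_subset_Icc_self ht)).trans (Complex.re_le_norm _)
    have b2 : ‖((1 - swA N u (t * b)) ^ (1 / 2 : ℂ))⁻¹‖ ≤ (1 - t) ^ (-(1 / 2) : ℝ) := by
      rw [norm_inv, show (1 / 2 : ℂ) = ((1 / 2 : ℝ) : ℂ) by norm_num, Complex.norm_cpow_real,
        ← Real.rpow_neg (norm_nonneg _)]
      exact Real.rpow_le_rpow_of_nonpos ht1 b1 (by norm_num)
    have hC0 : 0 ≤ C := (norm_nonneg _).trans (hC t (Set.Ioo_subset_Icc_self ht))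
    rw [norm_mul, Real.rpow_zero, one_mul]
    gcongr
    exact hC t (Set.Ioo_subset_Icc_self ht)
  refine ⟨y, ?_, ?_, fun t _ => ?_, fun t ht => ?_, hint, ?_⟩
  · exact (continuousOn_const.mul hp).mul hm
  · simp only [hy, Complex.ofReal_zero, zero_mul, h0, sub_neg_eq_add]
    ring_nf
  · have e1 := cpow_half_sq (1 + swA N u (t * b))
    have e2 := cpow_half_sq (1 - swA N u (t * b))
    simp only [hy]
    rw [mul_pow, mul_pow, e1, e2, neg_sq, Complex.I_sq]
    ring
  · exact mul_ne_zero (mul_ne_zero (neg_ne_zero.2 Complex.I_ne_zero)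
      (hpne t (Set.Ico_subset_Icc_self ht))) (hmne t ht)
  · have hiφ : IntervalIntegrable (fun t : ℝ => arccosBranch (swA N u (t * b)) * b) volume 0 1 := by
      refine ContinuousOn.intervalIntegrable ?_
      rw [Set.uIcc_of_le zero_le_one]
      exact hφ.mul continuousOn_const
    have key := intervalIntegral.integral_eq_sub_of_hasDerivAt_of_le zero_le_one
      (f := fun t : ℝ => arccosBranch (swA N u (t * b)) * (t * b))
      (f' := fun t => arccosBranch (swA N u (t * b)) * b - -Complex.I *
        ((t * b) * deriv (swA N u) (t * b) / y t * b))
      (hφ.mul (by fun_prop)) (fun t ht => ?_) (hiφ.sub (hint.const_mul _))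
    · rw [intervalIntegral.integral_sub hiφ (hint.const_mul _), intervalIntegral.integral_const_mul]
        at key
      simp only [Complex.ofReal_one, Complex.ofReal_zero, one_mul, zero_mul, mul_zero, hb,
        arccosBranch_one, sub_self] at key
      have hπ : (Real.pi : ℂ) ≠ 0 := Complex.ofReal_ne_zero.2 Real.pi_ne_zero
      rw [sub_eq_zero.1 key]
      generalize (∫ t in (0 : ℝ)..1, (t * b) * deriv (swA N u) (t * b) / y t * b) = J
      field_simp
      linear_combination -J * Complex.I_sq
    · have dx : HasDerivAt (fun t : ℝ => (t : ℂ) * b) b t := by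
        simpa using (hasDerivAt_id t).ofReal_comp.mul_const b
      have dA : HasDerivAt (fun t : ℝ => swA N u (t * b)) (deriv (swA N u) (t * b) * b) t :=
        HasDerivAt.comp t (((contDiff_swA N u).differentiable (by simp)) _).hasDerivAt dx
      have dφ : HasDerivAt (fun t : ℝ => arccosBranch (swA N u (t * b)))
          (-((1 - swA N u (t * b)) ^ (1 / 2 : ℂ) * (1 + swA N u (t * b)) ^ (1 / 2 : ℂ))⁻¹ *
            (deriv (swA N u) (t * b) * b)) t :=
        HasDerivAt.comp t (hasDerivAt_arccosBranch (h1 t (Set.Ioo_subset_Icc_self ht))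
          (hms t (Set.Ioo_subset_Ico_self ht))) dA
      refine (dφ.mul dx).congr_deriv ?_
      have n1 := hpne t (Set.Ioo_subset_Icc_self ht)
      have n2 := hmne t (Set.Ioo_subset_Ico_self ht)
      have n3 := Complex.I_ne_zero
      simp only [hy]
      field_simp
      ring

theorem ofReal_pow_mul_cpow {N : ℕ} (hN : N ≠ 0) {z : ℂ} (hz : z ≠ 0) {t : ℝ} (ht : 0 < t) :
    (z * ((t ^ N : ℝ) : ℂ)) ^ ((1 / N : ℝ) : ℂ) = t * z ^ (1 / (N : ℂ)) := by
  rw [mul_comm, ofReal_mul_cpow (pow_pos ht N) hz, ← Complex.ofReal_cpow (pow_pos ht N).le, one_div,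
    Real.pow_rpow_inv_natCast ht.le hN]
  push_cast
  rw [one_div]

theorem cpow_one_div_pow {N : ℕ} (hN : N ≠ 0) (z : ℂ) : (z ^ (1 / (N : ℂ))) ^ N = z := by
  rw [one_div, Complex.cpow_nat_inv_pow z hN]

theorem swA_zero {N : ℕ} (hN : N ≠ 0) (u : SWModuli N) : swA N u 0 = -u.1 := by
  unfold swA
  simp [hN]

/-- The point `t z^(1/N) ξ` has `N`-th power `z t^N`. The positive factor `t^N` may be pulled out of
principal powers, so the fractional powers of `z t^N` in `P` are the integral powers of `x`, up to
`ξ`. -/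
theorem swA_adModuli {N : ℕ} (hN : N ≠ 0) {ξ : ℂ} (hξ : ξ ^ N = 1) (v : ℂ) (w : Fin (N - 2) → ℂ)
    {z : ℂ} (hz : z ≠ 0) {t : ℝ} (ht : 0 < t) :
    swA N (adModuli N v w) (t * (z ^ (1 / (N : ℂ)) * ξ)) =
      perturbedA (swPerturbation N ξ v w) 1 v (z * ((t ^ N : ℝ) : ℂ)) := by
  unfold swA adModuli perturbedA swPerturbation
  simp only
  rw [mul_pow, mul_pow, cpow_one_div_pow hN, hξ, one_mul]
  congr 1
  · push_cast
    ring
  · refine Finset.sum_congr rfl fun j _ => ?_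
    have e1 : (swExp N j : ℂ) = ((j : ℕ) + 1 : ℕ) * ((1 / N : ℝ) : ℂ) := by
      unfold swExp
      push_cast
      ring
    have e2 : (1 - (((j : ℕ) : ℂ) + 1) / N) = ((1 - swExp N j : ℝ) : ℂ) := by
      unfold swExp
      push_cast
      ring
    rw [e1, Complex.cpow_nat_mul, ofReal_pow_mul_cpow hN hz ht, e2, ← mul_assoc (t : ℂ), mul_pow _ ξ]
    ring

namespace IsSmallPerturbation

/-- The substitution of `t^N` for `t` carries the straight segment in `x` to the straight segment in
`z`. The estimates along the ray supply what `isAbelianQ_of_arccosBranch` needs; `t = 0` is treated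
apart because they assume `t > 0`. -/
theorem isAbelianQ {κ : ℝ} {v ξ : ℂ} {N : ℕ} (hN : N ≠ 0) {w : Fin (N - 2) → ℂ}
    (h : IsSmallPerturbation κ v (swPerturbation N ξ v w)) (hξ : ξ ^ N = 1) {b : ℂ}
    (hb : b = perturbedRoot (swPerturbation N ξ v w) 1 v ^ (1 / (N : ℂ)) * ξ) :
    swA N (adModuli N v w) b = 1 ∧ IsAbelianQ N (adModuli N v w) b (ξ / (Real.pi * N) *
      abelianIntegral (swPerturbation N ξ v w) (1 / N) 0 1 v) := by
  have hτ : ‖(1 : ℂ)‖ < 2 := by rw [norm_one]; norm_num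
  have hv := h.norm_sub_self_lt
  have hz : perturbedRoot (swPerturbation N ξ v w) 1 v ≠ 0 := by
    refine norm_pos_iff.1 ?_
    linarith [(h.norm_root_mem hτ hv).2.1]
  have hA : ∀ {t : ℝ}, 0 < t → swA N (adModuli N v w) (t * b) =
      perturbedA (swPerturbation N ξ v w) 1 v
        (perturbedRoot (swPerturbation N ξ v w) 1 v * ((t ^ N : ℝ) : ℂ)) := fun ht => by
    rw [hb]; exact swA_adModuli hN hξ v w hz ht
  have hA0 : swA N (adModuli N v w) ((0 : ℝ) * b) = v - 1 := by
    rw [Complex.ofReal_zero, zero_mul, swA_zero hN]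
    simp [adModuli]
  have hbA : swA N (adModuli N v w) b = 1 := by
    have := hA one_pos
    rwa [one_pow, Complex.ofReal_one, one_mul, mul_one, h.A_root hτ hv] at this
  refine ⟨hbA, ?_⟩
  have hQ := isAbelianQ_of_arccosBranch (u := adModuli N v w) (b := b) (fun t ht => ?_)
    (fun t ht => ?_) hbA (swA_zero hN _)
  · convert hQ using 1
    unfold abelianIntegral
    have hN0 : (0 : ℝ) < N := Nat.cast_pos.2 (Nat.pos_of_ne_zero hN)
    rw [integral_comp_of_deriv_pos (f := fun t => t ^ N) (f' := fun t => N * t ^ (N - 1)) _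
      (by fun_prop) (zero_pow hN) (one_pow N) (fun t _ => hasDerivAt_pow N t)
      (fun t ht => mul_pos hN0 (pow_pos ht.1 _)),
      ← intervalIntegral.integral_const_mul, ← intervalIntegral.integral_const_mul]
    refine integral_congr_Ioo fun t ht => ?_
    have t0 : (t : ℂ) ≠ 0 := Complex.ofReal_ne_zero.2 ht.1.ne'
    have hN1 : (N : ℂ) ≠ 0 := Nat.cast_ne_zero.2 hN
    have hπ : (Real.pi : ℂ) ≠ 0 := Complex.ofReal_ne_zero.2 Real.pi_ne_zero
    have hzt : perturbedRoot (swPerturbation N ξ v w) 1 v * ((t ^ N : ℝ) : ℂ) ≠ 0 :=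
      mul_ne_zero hz (Complex.ofReal_ne_zero.2 (pow_pos ht.1 N).ne')
    have htN : ((t ^ N : ℝ) : ℂ) = t ^ (N - 1) * t := by
      push_cast
      rw [← pow_succ, Nat.sub_add_cancel (Nat.pos_of_ne_zero hN)]
    unfold abelianIntegrand
    rw [hA ht.1, Complex.cpow_sub _ _ hzt, Complex.cpow_one, ofReal_pow_mul_cpow hN hz ht.1, hb]
    generalize arccosBranch (perturbedA (swPerturbation N ξ v w) 1 v
      (perturbedRoot (swPerturbation N ξ v w) 1 v * ((t ^ N : ℝ) : ℂ))) = Φ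
    rw [htN]
    push_cast
    have tN : (t : ℂ) ^ (N - 1) ≠ 0 := pow_ne_zero _ t0
    field_simp
  · rcases eq_or_lt_of_le ht.1 with h0 | h0
    · rw [← h0, hA0, add_sub_cancel]
      exact h.mem_slitPlane hv
    · rw [hA h0]
      exact h.one_add_A_mem hτ hv (pow_pos h0 N) (pow_le_one₀ h0.le ht.2)
  · rcases eq_or_lt_of_le ht.1 with h0 | h0
    · rw [← h0, hA0]
      have h1 := Complex.re_le_norm v
      have h2 := h.norm_lt
      simp only [Complex.sub_re, Complex.one_re]
      linarith
    · rw [hA h0]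
      have := h.one_sub_le_re hτ hv (pow_pos h0 N) (pow_le_one₀ h0.le ht.2)
      have h2 : t ^ N ≤ t := pow_le_of_le_one h0.le ht.2 hN
      linarith

/-! ### Continuity of the branch point and conclusion -/

/-- The contraction argument for two perturbations at the same `v`; it makes the branch point
continuous in the moduli. -/
theorem norm_root_sub_root_le {κ : ℝ} {v : ℂ} {P Q : ℂ → ℂ} (h : IsSmallPerturbation κ v P)
    (h' : IsSmallPerturbation κ v Q) :
    ‖perturbedRoot P 1 v - perturbedRoot Q 1 v‖ ≤
      2 * ‖P (perturbedRoot P 1 v) - Q (perturbedRoot P 1 v)‖ := by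
  have hτ : ‖(1 : ℂ)‖ < 2 := by rw [norm_one]; norm_num
  obtain ⟨a1, a2⟩ := h.root_spec hτ h.norm_sub_self_lt
  obtain ⟨b1, b2⟩ := h'.root_spec hτ h.norm_sub_self_lt
  set z := perturbedRoot P 1 v
  set w := perturbedRoot Q 1 v
  have h1 := h'.norm_sub_le (x := z) (y := w) (by linarith) (by linarith)
  have h3 : ‖z - w‖ ≤ ‖P z - Q z‖ + ‖Q z - Q w‖ := by
    calc ‖z - w‖ = ‖(P z - Q z) + (Q z - Q w)‖ := by congr 1; linear_combination a2 - b2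
      _ ≤ _ := norm_add_le _ _
  have h5 : κ * ‖z - w‖ ≤ 1 * ‖z - w‖ := by gcongr; exact h.le_one
  linarith [norm_nonneg (z - w)]

end IsSmallPerturbation

theorem swPerturbation_sub (N : ℕ) (ξ v : ℂ) (w w' : Fin (N - 2) → ℂ) (z : ℂ) :
    swPerturbation N ξ v w z - swPerturbation N ξ v w' z = swPerturbation N ξ v (w - w') z := by
  unfold swPerturbation
  rw [← Finset.sum_sub_distrib]
  refine Finset.sum_congr rfl fun j _ => ?_
  rw [Pi.sub_apply]
  ring

theorem swPerturbation_zero (N : ℕ) (ξ v z : ℂ) : swPerturbation N ξ v 0 z = 0 := by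
  unfold swPerturbation
  simp

theorem continuousOn_perturbedRoot {κ : ℝ} {v : ℂ} {P : ℂ → ℂ} (h : IsSmallPerturbation κ v P)
    {N : ℕ} (hN : 3 ≤ N) {ξ : ℂ} (hξ : ‖ξ‖ = 1) :
    ContinuousOn (fun w => perturbedRoot (swPerturbation N ξ v w) 1 v)
      {w | ∀ j, ‖w j‖ < κ / (400 * N)} := by
  have hτ : ‖(1 : ℂ)‖ < 2 := by rw [norm_one]; norm_num
  intro w₀ hw₀
  rw [ContinuousWithinAt, tendsto_iff_norm_sub_tendsto_zero]
  have h0 := isSmallPerturbation_swPerturbation h hN hξ fun j => (hw₀ j).le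
  have hlim : Tendsto (fun w : Fin (N - 2) → ℂ => 2 * ((N - 2 : ℕ) * ‖w - w₀‖ * (1 / 4 + 5 / 2)))
      (𝓝[{w | ∀ j, ‖w j‖ < κ / (400 * N)}] w₀) (𝓝 0) := by
    have : ContinuousAt (fun w : Fin (N - 2) → ℂ => 2 * (((N - 2 : ℕ) : ℝ) * ‖w - w₀‖ *
        (1 / 4 + 5 / 2))) w₀ := by fun_prop
    have h2 := this.tendsto
    rw [sub_self, norm_zero, mul_zero, zero_mul, mul_zero] at h2
    exact h2.mono_left nhdsWithin_le_nhds
  refine squeeze_zero' (Eventually.of_forall fun _ => norm_nonneg _) ?_ hlim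
  filter_upwards [self_mem_nhdsWithin] with w hw
  have h1 := isSmallPerturbation_swPerturbation h hN hξ fun j => (hw j).le
  refine (h1.norm_root_sub_root_le h0).trans ?_
  rw [swPerturbation_sub]
  have h2 := norm_swPerturbation_le hξ v (fun j => norm_le_pi_norm (w - w₀) j)
    (perturbedRoot (swPerturbation N ξ v w) 1 v)
  have h3 := (h1.norm_root_mem hτ h1.norm_sub_self_lt).2.2
  have h4 := h.norm_lt
  gcongr
  refine h2.trans ?_
  gcongr

/-- Supplies the angle condition of `IsSmallPerturbation`. The minimum with `π/2` keeps the sine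
monotone and positive for large `η`. -/
theorem sin_mul_norm_le_abs_im {η : ℝ} (hη : 0 < η) {v : ℂ} (harg : |v.arg| ≤ Real.pi - η)
    (hre : v.re < 0) : Real.sin (min η (Real.pi / 2)) * ‖v‖ ≤ |v.im| := by
  have h1 : Real.pi / 2 < |v.arg| := by
    by_contra h2
    have := Complex.abs_arg_le_pi_div_two_iff.1 (not_lt.1 h2)
    linarith
  have h2 : |v.im| = Real.sin (Real.pi - |v.arg|) * ‖v‖ := by
    have h3 : v.im = ‖v‖ * Real.sin v.arg := (Complex.norm_mul_sin_arg v).symm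
    rw [h3, abs_mul, abs_norm, mul_comm, Real.sin_pi_sub]
    congr 1
    rw [← Real.abs_sin_eq_sin_abs_of_abs_le_pi (Complex.abs_arg_le_pi v)]
  rw [h2]
  refine mul_le_mul_of_nonneg_right (Real.sin_le_sin_of_le_of_le_pi_div_two ?_ ?_ ?_) (norm_nonneg v)
  · have := le_min hη.le Real.pi_div_two_pos.le
    linarith [Real.pi_pos]
  · linarith
  · exact (min_le_left _ _).trans (by linarith)

theorem exists_expansion {N : ℕ} (hN : 3 ≤ N) {ξ : ℂ} (hξ : ξ ^ N = 1) {η : ℝ} (hη : 0 < η) :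
    ∃ δ : ℝ, 0 < δ ∧ ∀ v : ℂ, v ≠ 0 → ‖v‖ < 1 / 4 → |v.arg| ≤ Real.pi - η →
      ∃ β : (Fin (N - 2) → ℂ) → ℂ, ContinuousOn β {w | ∀ j, ‖w j‖ < δ} ∧
        β 0 = (2 - v) ^ (1 / (N : ℂ)) * ξ ∧
        ∀ w : Fin (N - 2) → ℂ, (∀ j, ‖w j‖ < δ) → swA N (adModuli N v w) (β w) = 1 ∧
          ∃ q : ℂ, IsAbelianQ N (adModuli N v w) (β w) q ∧ HasSum (longTerm N ξ v w) q := by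
  have hN0 : N ≠ 0 := by omega
  have hNpos : (0 : ℝ) < N := Nat.cast_pos.2 (by omega)
  have hκ : 0 < Real.sin (min η (Real.pi / 2)) :=
    Real.sin_pos_of_pos_of_lt_pi (lt_min hη Real.pi_div_two_pos)
      ((min_le_right _ _).trans_lt (by linarith [Real.pi_pos]))
  have hξ1 : ‖ξ‖ = 1 := Complex.norm_eq_one_of_pow_eq_one hξ hN0
  -- Half of this size would already be twice covered by the smallness of `P`: `κ / (200 N)`
  -- suffices there, and the further factor `2` gives the ratio `1/2` of the dominating geometric
  -- series.
  refine ⟨Real.sin (min η (Real.pi / 2)) / (400 * N), by positivity, fun v hv hv4 harg => ?_⟩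
  -- The zero perturbation records the conditions on `v` alone; those on the actual `P` are added
  -- through `isSmallPerturbation_swPerturbation`.
  have h : IsSmallPerturbation (Real.sin (min η (Real.pi / 2))) v 0 :=
    ⟨hκ, Real.sin_le_one _, hv, hv4, sin_mul_norm_le_abs_im hη harg,
      differentiableOn_const 0, fun z _ => by
        rw [Pi.zero_apply, norm_zero]; positivity⟩
  have hτ : ‖(1 : ℂ)‖ < 2 := by rw [norm_one]; norm_num
  refine ⟨fun w => perturbedRoot (swPerturbation N ξ v w) 1 v ^ (1 / (N : ℂ)) * ξ, ?_, ?_,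
    fun w hw => ?_⟩
  · refine ContinuousOn.mul (fun w hw => ?_) continuousOn_const
    have h1 := isSmallPerturbation_swPerturbation h hN hξ1 fun j => (hw j).le
    have h2 := h1.root_mul_mem hτ h1.norm_sub_self_lt one_pos
    rw [Complex.ofReal_one, mul_one] at h2
    exact ContinuousAt.comp_continuousWithinAt
      (f := fun w => perturbedRoot (swPerturbation N ξ v w) 1 v)
      ((hasDerivAt_id _).cpow_const (rightSector_subset_slitPlane h2)).continuousAt
      (continuousOn_perturbedRoot h hN hξ1 w hw)
  · have h1 := isSmallPerturbation_swPerturbation h hN hξ1 (w := 0) fun j => by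
      rw [Pi.zero_apply, norm_zero]; positivity
    have h2 := (h1.root_spec hτ h1.norm_sub_self_lt).2
    rw [swPerturbation_zero, mul_zero, add_zero] at h2
    simp only [h2]
  · have h1 := isSmallPerturbation_swPerturbation h hN hξ1 fun j => (hw j).le
    have h2 := h1.isAbelianQ hN0 hξ rfl
    exact ⟨h2.1, _, h2.2, hasSum_longTerm h hN hξ1 fun j => (hw j).le⟩

theorem hasSum_longTerm_zero (N : ℕ) (ξ v : ℂ) :
    HasSum (longTerm N ξ v 0) (longTerm N ξ v 0 0) := by
  refine hasSum_single 0 fun l hl => ?_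
  obtain ⟨j, hj⟩ : ∃ j, l j ≠ 0 := by
    by_contra hn
    push Not at hn
    exact hl (funext hn)
  unfold longTerm
  rw [Finset.prod_eq_zero (Finset.mem_univ j), mul_zero]
  rw [Pi.zero_apply, zero_pow hj, zero_div]

theorem longTerm_zero_zero {N : ℕ} (hN : 3 ≤ N) (ξ v : ℂ) :
    longTerm N ξ v 0 0 = (2 : ℂ) ^ (-1 / (N : ℂ)) / (2 * Real.pi ^ 2 * N) * ξ *
      Complex.Gamma (1 / N) * longComb (-1 / (2 * N)) v := by
  have hN0 : (N : ℂ) ≠ 0 := Nat.cast_ne_zero.2 (by omega)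
  have hL : wtL (0 : Fin (N - 2) → ℕ) = 1 := by simp [wtL]
  have hM : wtM (0 : Fin (N - 2) → ℕ) = 0 := by simp [wtM]
  have hα : wtAlpha (0 : Fin (N - 2) → ℕ) = -1 / (2 * N) := by
    simp [wtAlpha, hL, hM]
  -- No limit is needed here: `4α = -2/N` is an odd integer only if `N` divides `2`.
  have hY : longY (-1 / (2 * (N : ℂ))) v = longComb (-1 / (2 * N)) v := by
    refine if_neg ?_
    rintro ⟨k, hk⟩
    have h1 : ((N : ℤ) * (2 * k + 1) : ℂ) = ((-2 : ℤ) : ℂ) := by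
      push_cast
      rw [← hk]
      field_simp
      norm_num
    have h2 : (N : ℤ) * (2 * k + 1) = -2 := by exact_mod_cast h1
    have h3 : (N : ℤ) ∣ 2 := ⟨-(2 * k + 1), by linarith⟩
    have := Int.le_of_dvd two_pos h3
    omega
  unfold longTerm
  rw [hL, hM, hα, hY]
  have h1 : ((N : ℂ) * (0 : ℕ) - (1 : ℕ) + 1) / N = 0 := by push_cast; ring
  have h2 : ((0 : ℕ) : ℂ) - ((1 : ℕ) : ℂ) / N = -1 / N := by push_cast; ring
  have h3 : ∏ j : Fin (N - 2), (0 : Fin (N - 2) → ℂ) j ^ (0 : Fin (N - 2) → ℕ) j /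
      (((0 : Fin (N - 2) → ℕ) j).factorial : ℂ) = 1 := Finset.prod_eq_one fun j _ => by simp
  rw [h1, h2, h3, Complex.cpow_zero, Nat.cast_one, pow_one, mul_one, mul_one]

theorem mainTheorem5 (N : ℕ) (hN : 3 ≤ N) (ξ : ℂ) (hξ : ξ ^ N = 1) :
    -- the coefficient `Y(1, α; 1 - v)` is the stated combination of `f₁` and `f₂`
    (∀ (l : Fin (N - 2) → ℕ) (v : ℂ), ‖1 - v‖ < 1 →
      swY 1 (wtAlpha l) (1 - v) = longY (wtAlpha l) v) ∧
    -- the limit in `α` that `longY` takes at exceptional values of `α` exists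
    (∀ (l : Fin (N - 2) → ℕ) (v : ℂ), v ∈ Complex.slitPlane → ‖v‖ < 2 →
      Tendsto (fun a => longComb a v) (𝓝[≠] wtAlpha l) (𝓝 (longY (wtAlpha l) v))) ∧
    ∃ r : ℝ, 0 < r ∧
      -- the expansion; `β w` is the large branch point labelled by `ξ`
      (∀ η : ℝ, 0 < η → ∃ δ : ℝ, 0 < δ ∧
        ∀ v : ℂ, v ≠ 0 → ‖v‖ < r → |v.arg| ≤ Real.pi - η →
          ∃ β : (Fin (N - 2) → ℂ) → ℂ,
            ContinuousOn β {w | ∀ j, ‖w j‖ < δ} ∧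
            β 0 = (2 - v) ^ (1 / (N : ℂ)) * ξ ∧
            ∀ w : Fin (N - 2) → ℂ, (∀ j, ‖w j‖ < δ) →
              swA N (adModuli N v w) (β w) = 1 ∧
              ∃ q : ℂ, IsAbelianQ N (adModuli N v w) (β w) q ∧
                HasSum (longTerm N ξ v w) q) ∧
      -- the special case `vₙ = 0` for `n > 0`
      (∀ v : ℂ, v ∈ Complex.slitPlane → ‖v‖ < r →
        IsAbelianQ N (1 - v, 0) ((2 - v) ^ (1 / (N : ℂ)) * ξ)
          ((2 : ℂ) ^ (-1 / (N : ℂ)) / (2 * Real.pi ^ 2 * N) * ξ * Complex.Gamma (1 / N) *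
            longComb (-1 / (2 * N)) v)) := by
  refine ⟨fun l v hv => swY_wtAlpha_eq_longY hN l hv,
    fun l v hv hv2 => tendsto_longComb_longY _ ⟨hv, hv2⟩, 1 / 4, by norm_num,
    fun η hη => exists_expansion hN hξ hη, fun v hv hv4 => ?_⟩
  -- For `v_n = 0` no uniformity in `v` is asked, so the distance of `arg v` from `±π` itself serves
  -- as `η`.
  have harg : 0 < Real.pi - |v.arg| := by
    have h1 := Complex.abs_arg_le_pi v
    rcases h1.lt_or_eq with h2 | h2
    · linarith
    · exfalso
      have h3 := Complex.mem_slitPlane_iff_arg.1 hv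
      rcases abs_eq Real.pi_pos.le |>.1 h2 with h4 | h4
      · exact h3.1 h4
      · linarith [Complex.neg_pi_lt_arg v]
  obtain ⟨δ, hδ, hmain⟩ := exists_expansion hN hξ harg
  obtain ⟨β, -, hβ0, hβ⟩ := hmain v (Complex.slitPlane_ne_zero hv) hv4 (by linarith)
  obtain ⟨-, q, hq, hsum⟩ := hβ 0 fun j => by simpa using hδ
  have had : adModuli N v 0 = (1 - v, 0) := by
    unfold adModuli
    congr 1
    funext j
    simp
  rw [hβ0, had, hsum.unique (hasSum_longTerm_zero N ξ v), longTerm_zero_zero hN] at hq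
  exact hq
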